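/- **Corollary 8.6.** *Language.* The language of $\mathrm{IA}_1$ is two-sorted, with number variables $x,y,z,\dots$ and function variables $\alpha,\beta,\gamma,\dots$, logical symbols $\to,\&,\vee,\neg,\forall,\exists$ (quantifiers for both sorts), equality $=$ between terms as the only predicate symbol, Church's $\lambda$, and 27 function(al) constants. Terms and functors are generated simultaneously: $0$ and number variables are terms; function variables and the constants with a single number argument are functors; each constant applied to terms and functors according to its arity is a term; if $u$ is a functor and $t$ a term, $(u)(t)$ is a term; if $t$ is a term, $\lambda x.t$ is a functor. Expressions that differ only in the names of bound variables are identified. The logic is two-sorted intuitionistic predicate logic. For functors, $u=v$ abbreviates $\forall x\,(u)(x)=(v)(x)$; put $\langle a,b\rangle=2^a\cdot 3^b$. *Axioms of $\mathrm{IA}_1$.* Equality and induction: $a=b\to(a=c\to b=c)$; $\ \neg a'=0$; $\ a=b\to a'=b'$; $\ a'=b'\to a=b$; $\ x=y\to\alpha(x)=\alpha(y)$; $\lambda$-conversion $(\lambda x.t(x))(s)=t(s)$; induction $A(0)\,\&\,\forall x(A(x)\to A(x'))\to A(x)$ for all formulas $A$; and the defining equations of the constants: $a+0=a$, $a+b'=(a+b)'$;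 $a\cdot0=0$, $a\cdot b'=a\cdot b+a$; $a^0=1$, $a^{b'}=a^b\cdot a$; $0!=1$, $(a')!=a!\cdot a'$; $\mathrm{pd}(0)=0$, $\mathrm{pd}(a')=a$; $a\dot-0=a$, $a\dot-b'=\mathrm{pd}(a\dot-b)$; $\min(a,b)=b\dot-(b\dot-a)$; $\max(a,b)=(a\dot-b)+b$; $\overline{\mathrm{sg}}(0)=1$, $\overline{\mathrm{sg}}(a')=0$; $\mathrm{sg}(0)=0$, $\mathrm{sg}(a')=1$; $|a-b|=(a\dot-b)+(b\dot-a)$; $\mathrm{rm}(0,b)=0$, $\mathrm{rm}(a',b)=(\mathrm{rm}(a,b))'\cdot\mathrm{sg}|b-(\mathrm{rm}(a,b))'|$; $[0/b]=0$, $[a'/b]=[a/b]+\overline{\mathrm{sg}}|b-(\mathrm{rm}(a,b))'|$; the functionals $\sum_{y<z}\alpha(y)$, $\prod_{y<z}\alpha(y)$, $\min_{y\le z}\alpha(y)$, $\max_{y\le z}\alpha(y)$ with their usual recursion equations in $z$; $p_0=2$, $p_{i'}=\mu b_{b<p_i!+2}[p_i<b\,\&\,\mathrm{Pr}(b)]$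 (with $\mathrm{Pr}(b)$: $b$ is prime); $(a)_i=\mu x_{x<a}[p_i^x\mid a\,\&\,\neg\,p_i^{x'}\mid a]$; $\mathrm{lh}(a)=\sum_{i<a}\mathrm{sg}((a)_i)$; $a*b=a\cdot\prod_{i<\mathrm{lh}(b)}p_{\mathrm{lh}(a)+i}^{(b)_i}$; $\overline\alpha(x)=\prod_{i<x}p_i^{\alpha(i)+1}$; $\widetilde\alpha(x)=\prod_{i<x}p_i^{\alpha(i)}$; $a\circ b=\prod_{i<\max(a,b)}p_i^{\max((a)_i,(b)_i)}$; and $\mathrm{ccp}(0)=1$, $\mathrm{ccp}(y')=\mathrm{ccp}(y)\cdot p_y^{r(y,\mathrm{ccp}(y))}$. Here $a<b$ means $a'\dot-b=0$, $a\mid b$ means $\mathrm{sg}(\mathrm{rm}(b,a))=0$, and $\mu y_{y<z}R(y)$ is $\sum_{x<z}\prod_{y<x'}q(y)$, where $q$ is a term with values $\le 1$ that is $0$ exactly if $R$ holds. The term $r(y,z)$ is a fixed term of the language with no free variables other than $y,z$ and not containing $\mathrm{ccp}$; the result holds for every choice of such a term $r$. *Schema and axiom.* $\mathrm{QF\text{-}AC}_{00}$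 is $\forall x\exists y\,A(x,y)\to\exists\alpha\forall x\,A(x,\alpha(x))$ for quantifier-free $A(x,y)$ not containing $\alpha$, with $x$ free for $y$. Let $A(x,\alpha,y,w)$ be the formula $$\exists\beta\,[\,\beta(0)=x\;\&\;\forall z\,\beta(z')=\alpha(\langle\beta(z),z\rangle)\;\&\;\beta(y)=w\,].$$ $\mathrm{IA}_1+\mathrm{QF\text{-}AC}_{00}+\mathrm{Rec}$ is obtained from $\mathrm{IA}_1+\mathrm{QF\text{-}AC}_{00}$ by adding a constant $\mathrm{rec}$ with the formation rule "if $t,s$ are terms and $u$ is a functor, then $\mathrm{rec}(t,u,s)$ is a term", extending all axiom schemata to the new language, and adding the axiom $\mathrm{Rec}$: $A(x,\alpha,y,\mathrm{rec}(x,\alpha,y))$. *Definitional extension.* Let the language and the theorems of a system $S_2$ extend those of $S_1$. $S_2$ is a definitional extension of $S_1$ if there is an effective mapping $'$ from the formulas of $S_2$ to those of $S_1$ (recursive on Gödel numbers) such that: (I) $E'\equiv E$ for every formula $E$ of $S_1$; (II) $\vdash_{S_2}E'\leftrightarrow E$; (III) if $\Gamma\vdash_{S_2}E$, then $\Gamma'\vdash_{S_1}E'$,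 for every list $\Gamma$ of formulas and every formula $E$, where deducibility holds the free variables of the assumptions constant; (IV) $'$ commutes with $\&,\vee,\to,\neg$ and with $\forall,\exists$ of both sorts. *Claim.* The following hold. (1) $\mathrm{IA}_1+\mathrm{QF\text{-}AC}_{00}\vdash\exists\beta\,[\,\beta(0)=x\,\&\,\forall z\,\beta(z')=\alpha(\langle\beta(z),z\rangle)\,]$. (2) $\mathrm{IA}_1+\mathrm{QF\text{-}AC}_{00}\vdash\exists!\beta\,[\,\beta(0)=x\,\&\,\forall z\,\beta(z')=\alpha(\langle\beta(z),z\rangle)\,]$, where $\exists!\beta\,C(\beta)$ abbreviates $\exists\beta[C(\beta)\,\&\,\forall\gamma(C(\gamma)\to\beta=\gamma)]$. (3) Let $t,s$ be terms and $u$ a functor of $\mathrm{IA}_1$, let $x_0,\dots,x_k$ include all number variables free in $t,u,s$, let $w$ be a number variable not occurring in $t,u,s$, and let $t^w,u^w,s^w$ result from $t,u,s$ by replacing each free $x_i$ by $(w)_i$. Then, for a function variable $\gamma$ not free in $t,u,s$, $\mathrm{IA}_1+\mathrm{QF\text{-}AC}_{00}\vdash\exists!\gamma\,\forall w\,A(t^w,u^w,s^w,\gamma(w))$.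 (4) $\mathrm{IA}_1+\mathrm{QF\text{-}AC}_{00}+\mathrm{Rec}$ is a definitional extension of $\mathrm{IA}_1+\mathrm{QF\text{-}AC}_{00}$. -/

import Mathlib

namespace TwoSortedArith

/-! ## Syntax

Two sorts: natural numbers and one-place number-theoretic functions. Bound variables are
represented by de Bruijn indices, with a separate numbering for each sort, so that syntactic
identity is identity up to renaming of bound variables. A free occurrence of an index refers to the
free variable of that sort with that number. -/

/-- The two sorts: `num` for terms (numbers), `fn` for functors (one-place functions). -/
inductive Srt : Type
  | num : Srt
  | fn : Srt

/-- The function constants with one number argument; they are functors. -/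
inductive UnConst : Type
  | succ | fact | pd | sgbar | sg | prime | lh | ccp

/-- The function constants with two number arguments: `comp a i` is `(a)_i`, `dist a b` is
`|a - b|`, `quot a b` is `[a / b]`, `cat a b` is `a * b` (concatenation), `circ a b` is `a ∘ b`. -/
inductive BinConst : Type
  | add | mul | exp | monus | min | max | dist | rm | quot | comp | cat | circ

/-- The functional constants with one number and one function argument: bounded sum, product,
minimum, maximum, and the two course-of-values functionals `bar` and `tilde`. -/
inductive FnlConst : Type
  | sum | prod | minLe | maxLe | bar | tilde

/-- Expressions: terms (sort `num`) and functors (sort `fn`). The parameter `R` is the type of the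
additional constants taking two number arguments and one function argument in the order of
`rec(t, u, s)`: it is `Empty` for the language of `IA₁` and `Unit` for the language with `rec`. -/
inductive Expr (R : Type) : Srt → Type
  | var (s : Srt) (n : ℕ) : Expr R s
  | zero : Expr R .num
  | un (f : UnConst) : Expr R .fn
  | bin (f : BinConst) (a b : Expr R .num) : Expr R .num
  | fnl (f : FnlConst) (a : Expr R .num) (u : Expr R .fn) : Expr R .num
  | rcr (c : R) (t : Expr R .num) (u : Expr R .fn) (s : Expr R .num) : Expr R .num
  | app (u : Expr R .fn) (t : Expr R .num) : Expr R .num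
  | lam (t : Expr R .num) : Expr R .fn

/-- Formulas. The prime formulas are the equations between terms; `all s` and `ex s` quantify over
the variable of sort `s` with index `0`. -/
inductive Fml (R : Type) : Type
  | eq (a b : Expr R .num) : Fml R
  | and (A B : Fml R) : Fml R
  | or (A B : Fml R) : Fml R
  | imp (A B : Fml R) : Fml R
  | neg (A : Fml R) : Fml R
  | all (s : Srt) (A : Fml R) : Fml R
  | ex (s : Srt) (A : Fml R) : Fml R

variable {R R₁ R₂ : Type}

/-! ### Renaming and substitution -/

/-- The renaming that makes room for a new variable of sort `s` with index `0`. -/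
def shiftRen : Srt → Srt → ℕ → ℕ
  | .num, .num, n => n + 1
  | .num, .fn, n => n
  | .fn, .num, n => n
  | .fn, .fn, n => n + 1

/-- A renaming carried under a binder of the given sort. -/
def liftRen : Srt → (Srt → ℕ → ℕ) → Srt → ℕ → ℕ
  | .num, _, .num, 0 => 0
  | .num, ρ, .num, n + 1 => ρ .num n + 1
  | .num, ρ, .fn, n => ρ .fn n
  | .fn, ρ, .num, n => ρ .num n
  | .fn, _, .fn, 0 => 0
  | .fn, ρ, .fn, n + 1 => ρ .fn n + 1

def Expr.ren : {s : Srt} → Expr R s → (Srt → ℕ → ℕ) → Expr R s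
  | _, .var s n, ρ => .var s (ρ s n)
  | _, .zero, _ => .zero
  | _, .un f, _ => .un f
  | _, .bin f a b, ρ => .bin f (a.ren ρ) (b.ren ρ)
  | _, .fnl f a u, ρ => .fnl f (a.ren ρ) (u.ren ρ)
  | _, .rcr c t u s, ρ => .rcr c (t.ren ρ) (u.ren ρ) (s.ren ρ)
  | _, .app u t, ρ => .app (u.ren ρ) (t.ren ρ)
  | _, .lam t, ρ => .lam (t.ren (liftRen .num ρ))

/-- Weakening by a new variable of sort `s'`. -/
def Expr.shift (s' : Srt) {s : Srt} (e : Expr R s) : Expr R s := e.ren (shiftRen s')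

/-- A simultaneous substitution carried under a binder of the given sort. -/
def liftSub : Srt → ((s : Srt) → ℕ → Expr R s) → (s : Srt) → ℕ → Expr R s
  | .num, _, .num, 0 => .var .num 0
  | .num, σ, .num, n + 1 => (σ .num n).shift .num
  | .num, σ, .fn, n => (σ .fn n).shift .num
  | .fn, σ, .num, n => (σ .num n).shift .fn
  | .fn, _, .fn, 0 => .var .fn 0
  | .fn, σ, .fn, n + 1 => (σ .fn n).shift .fn

/-- Simultaneous capture-avoiding substitution for the variables of both sorts. -/
def Expr.sub : {s : Srt} → Expr R s → ((s : Srt) → ℕ → Expr R s) → Expr R s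
  | _, .var s n, σ => σ s n
  | _, .zero, _ => .zero
  | _, .un f, _ => .un f
  | _, .bin f a b, σ => .bin f (a.sub σ) (b.sub σ)
  | _, .fnl f a u, σ => .fnl f (a.sub σ) (u.sub σ)
  | _, .rcr c t u s, σ => .rcr c (t.sub σ) (u.sub σ) (s.sub σ)
  | _, .app u t, σ => .app (u.sub σ) (t.sub σ)
  | _, .lam t, σ => .lam (t.sub (liftSub .num σ))

def Fml.ren : Fml R → (Srt → ℕ → ℕ) → Fml R
  | .eq a b, ρ => .eq (a.ren ρ) (b.ren ρ)
  | .and A B, ρ => .and (A.ren ρ) (B.ren ρ)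
  | .or A B, ρ => .or (A.ren ρ) (B.ren ρ)
  | .imp A B, ρ => .imp (A.ren ρ) (B.ren ρ)
  | .neg A, ρ => .neg (A.ren ρ)
  | .all s A, ρ => .all s (A.ren (liftRen s ρ))
  | .ex s A, ρ => .ex s (A.ren (liftRen s ρ))

def Fml.shift (s' : Srt) (A : Fml R) : Fml R := A.ren (shiftRen s')

def Fml.sub : Fml R → ((s : Srt) → ℕ → Expr R s) → Fml R
  | .eq a b, σ => .eq (a.sub σ) (b.sub σ)
  | .and A B, σ => .and (A.sub σ) (B.sub σ)
  | .or A B, σ => .or (A.sub σ) (B.sub σ)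
  | .imp A B, σ => .imp (A.sub σ) (B.sub σ)
  | .neg A, σ => .neg (A.sub σ)
  | .all s A, σ => .all s (A.sub (liftSub s σ))
  | .ex s A, σ => .ex s (A.sub (liftSub s σ))

/-- The substitution of `e` for the variable with index `0` of its sort; the other indices of that
sort drop by one. -/
def instSub : (s : Srt) → Expr R s → (s' : Srt) → ℕ → Expr R s'
  | .num, e, .num, 0 => e
  | .num, _, .num, n + 1 => .var .num n
  | .num, _, .fn, n => .var .fn n
  | .fn, _, .num, n => .var .num n
  | .fn, e, .fn, 0 => e
  | .fn, _, .fn, n + 1 => .var .fn n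

def Expr.inst {s' : Srt} (t : Expr R s') (s : Srt) (e : Expr R s) : Expr R s' := t.sub (instSub s e)

def Fml.inst (A : Fml R) (s : Srt) (e : Expr R s) : Fml R := A.sub (instSub s e)

/-- The inclusion of languages induced by an inclusion of the sets of additional constants. -/
def Expr.map (ι : R₁ ↪ R₂) : {s : Srt} → Expr R₁ s → Expr R₂ s
  | _, .var s n => .var s n
  | _, .zero => .zero
  | _, .un f => .un f
  | _, .bin f a b => .bin f (a.map ι) (b.map ι)
  | _, .fnl f a u => .fnl f (a.map ι) (u.map ι)
  | _, .rcr c t u s => .rcr (ι c) (t.map ι) (u.map ι) (s.map ι)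
  | _, .app u t => .app (u.map ι) (t.map ι)
  | _, .lam t => .lam (t.map ι)

def Fml.map (ι : R₁ ↪ R₂) : Fml R₁ → Fml R₂
  | .eq a b => .eq (a.map ι) (b.map ι)
  | .and A B => .and (A.map ι) (B.map ι)
  | .or A B => .or (A.map ι) (B.map ι)
  | .imp A B => .imp (A.map ι) (B.map ι)
  | .neg A => .neg (A.map ι)
  | .all s A => .all s (A.map ι)
  | .ex s A => .ex s (A.map ι)

/-- The free number variables are among those with index `< k`, the free function variables among
those with index `< l`. -/
def Expr.VarsBelow : {s : Srt} → Expr R s → ℕ → ℕ → Prop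
  | _, .var .num n, k, _ => n < k
  | _, .var .fn n, _, l => n < l
  | _, .zero, _, _ => True
  | _, .un _, _, _ => True
  | _, .bin _ a b, k, l => a.VarsBelow k l ∧ b.VarsBelow k l
  | _, .fnl _ a u, k, l => a.VarsBelow k l ∧ u.VarsBelow k l
  | _, .rcr _ t u s, k, l => t.VarsBelow k l ∧ u.VarsBelow k l ∧ s.VarsBelow k l
  | _, .app u t, k, l => u.VarsBelow k l ∧ t.VarsBelow k l
  | _, .lam t, k, l => t.VarsBelow (k + 1) l

/-- The constant `ccp` does not occur. -/
def Expr.CcpFree : {s : Srt} → Expr R s → Prop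
  | _, .var _ _ => True
  | _, .zero => True
  | _, .un .ccp => False
  | _, .un _ => True
  | _, .bin _ a b => a.CcpFree ∧ b.CcpFree
  | _, .fnl _ a u => a.CcpFree ∧ u.CcpFree
  | _, .rcr _ t u s => t.CcpFree ∧ u.CcpFree ∧ s.CcpFree
  | _, .app u t => u.CcpFree ∧ t.CcpFree
  | _, .lam t => t.CcpFree

def Fml.QuantifierFree : Fml R → Prop
  | .eq _ _ => True
  | .and A B => A.QuantifierFree ∧ B.QuantifierFree
  | .or A B => A.QuantifierFree ∧ B.QuantifierFree
  | .imp A B => A.QuantifierFree ∧ B.QuantifierFree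
  | .neg A => A.QuantifierFree
  | .all _ _ => False
  | .ex _ _ => False

/-! ### Gödel numbering and effective mappings -/

def UnConst.code : UnConst → ℕ
  | .succ => 0
  | .fact => 1
  | .pd => 2
  | .sgbar => 3
  | .sg => 4
  | .prime => 5
  | .lh => 6
  | .ccp => 7

def BinConst.code : BinConst → ℕ
  | .add => 0
  | .mul => 1
  | .exp => 2
  | .monus => 3
  | .min => 4
  | .max => 5
  | .dist => 6
  | .rm => 7
  | .quot => 8
  | .comp => 9
  | .cat => 10
  | .circ => 11

def FnlConst.code : FnlConst → ℕ
  | .sum => 0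
  | .prod => 1
  | .minLe => 2
  | .maxLe => 3
  | .bar => 4
  | .tilde => 5

def Srt.code : Srt → ℕ
  | .num => 0
  | .fn => 1

/-- The Gödel number of an expression. -/
def Expr.code [Encodable R] : {s : Srt} → Expr R s → ℕ
  | _, .var s n => Nat.pair 0 (Nat.pair s.code n) + 1
  | _, .zero => Nat.pair 1 0 + 1
  | _, .un f => Nat.pair 2 f.code + 1
  | _, .bin f a b => Nat.pair 3 (Nat.pair f.code (Nat.pair a.code b.code)) + 1
  | _, .fnl f a u => Nat.pair 4 (Nat.pair f.code (Nat.pair a.code u.code)) + 1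
  | _, .rcr c t u s =>
      Nat.pair 5 (Nat.pair (Encodable.encode c) (Nat.pair t.code (Nat.pair u.code s.code))) + 1
  | _, .app u t => Nat.pair 6 (Nat.pair u.code t.code) + 1
  | _, .lam t => Nat.pair 7 t.code + 1

/-- The Gödel number of a formula. -/
def Fml.code [Encodable R] : Fml R → ℕ
  | .eq a b => Nat.pair 0 (Nat.pair a.code b.code) + 1
  | .and A B => Nat.pair 1 (Nat.pair A.code B.code) + 1
  | .or A B => Nat.pair 2 (Nat.pair A.code B.code) + 1
  | .imp A B => Nat.pair 3 (Nat.pair A.code B.code) + 1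
  | .neg A => Nat.pair 4 A.code + 1
  | .all s A => Nat.pair 5 (Nat.pair s.code A.code) + 1
  | .ex s A => Nat.pair 6 (Nat.pair s.code A.code) + 1

/-- A mapping between formulas is effective if it is computed, on Gödel numbers, by a (total)
recursive function. -/
def Effective [Encodable R₁] [Encodable R₂] (tr : Fml R₂ → Fml R₁) : Prop :=
  ∃ g : ℕ → ℕ, Computable g ∧ ∀ E : Fml R₂, g E.code = (tr E).code

/-! ## Two-sorted intuitionistic predicate logic -/

/-- `Prov T Γ A`: the formula `A` is deducible from the list of assumptions `Γ` in the formal system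
with nonlogical axioms `T`, by the natural deduction rules of two-sorted intuitionistic predicate
logic. The free variables of the assumptions are held constant, those of the axioms may be
generalized upon. -/
inductive Prov (T : Set (Fml R)) : List (Fml R) → Fml R → Prop
  | ax {Γ : List (Fml R)} {A : Fml R} : A ∈ T → Prov T Γ A
  | hyp {Γ : List (Fml R)} {A : Fml R} : A ∈ Γ → Prov T Γ A
  | andI {Γ : List (Fml R)} {A B : Fml R} : Prov T Γ A → Prov T Γ B → Prov T Γ (.and A B)
  | andE₁ {Γ : List (Fml R)} {A B : Fml R} : Prov T Γ (.and A B) → Prov T Γ A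
  | andE₂ {Γ : List (Fml R)} {A B : Fml R} : Prov T Γ (.and A B) → Prov T Γ B
  | orI₁ {Γ : List (Fml R)} {A B : Fml R} : Prov T Γ A → Prov T Γ (.or A B)
  | orI₂ {Γ : List (Fml R)} {A B : Fml R} : Prov T Γ B → Prov T Γ (.or A B)
  | orE {Γ : List (Fml R)} {A B C : Fml R} :
      Prov T Γ (.or A B) → Prov T (A :: Γ) C → Prov T (B :: Γ) C → Prov T Γ C
  | impI {Γ : List (Fml R)} {A B : Fml R} : Prov T (A :: Γ) B → Prov T Γ (.imp A B)
  | impE {Γ : List (Fml R)} {A B : Fml R} : Prov T Γ (.imp A B) → Prov T Γ A → Prov T Γ B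
  | negI {Γ : List (Fml R)} {A B : Fml R} :
      Prov T (A :: Γ) B → Prov T (A :: Γ) (.neg B) → Prov T Γ (.neg A)
  | negE {Γ : List (Fml R)} {A B : Fml R} : Prov T Γ (.neg A) → Prov T Γ A → Prov T Γ B
  | allI {Γ : List (Fml R)} {s : Srt} {A : Fml R} :
      Prov T (Γ.map (Fml.shift s)) A → Prov T Γ (.all s A)
  | allE {Γ : List (Fml R)} {s : Srt} {A : Fml R} (e : Expr R s) :
      Prov T Γ (.all s A) → Prov T Γ (A.inst s e)
  | exI {Γ : List (Fml R)} {s : Srt} {A : Fml R} (e : Expr R s) :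
      Prov T Γ (A.inst s e) → Prov T Γ (.ex s A)
  | exE {Γ : List (Fml R)} {s : Srt} {A B : Fml R} :
      Prov T Γ (.ex s A) → Prov T (A :: Γ.map (Fml.shift s)) (B.shift s) → Prov T Γ B

/-- `A ↔ B`. -/
def Fml.iff (A B : Fml R) : Fml R := .and (.imp A B) (.imp B A)

/-- The formal system with axioms `T₂` is a definitional extension of the one with axioms `T₁`, where
`ι` includes the language of the latter in that of the former: the second system extends the first,
and there is an effective mapping `tr` that satisfies the elimination relations: it is the identity
on the formulas of the smaller language, every formula is equivalent to its translation in the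
extended system, the translation preserves deducibility, and it commutes with the logical
operations. -/
def IsDefinitionalExtension [Encodable R₁] [Encodable R₂] (ι : R₁ ↪ R₂)
    (T₁ : Set (Fml R₁)) (T₂ : Set (Fml R₂)) : Prop :=
  (∀ (Γ : List (Fml R₁)) (E : Fml R₁), Prov T₁ Γ E → Prov T₂ (Γ.map (Fml.map ι)) (E.map ι)) ∧
  ∃ tr : Fml R₂ → Fml R₁,
    Effective tr ∧
    (∀ E : Fml R₁, tr (E.map ι) = E) ∧
    (∀ E : Fml R₂, Prov T₂ [] (Fml.iff ((tr E).map ι) E)) ∧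
    (∀ (Γ : List (Fml R₂)) (E : Fml R₂), Prov T₂ Γ E → Prov T₁ (Γ.map tr) (tr E)) ∧
    ((∀ A B : Fml R₂, tr (.and A B) = .and (tr A) (tr B)) ∧
      (∀ A B : Fml R₂, tr (.or A B) = .or (tr A) (tr B)) ∧
      (∀ A B : Fml R₂, tr (.imp A B) = .imp (tr A) (tr B)) ∧
      (∀ A : Fml R₂, tr (.neg A) = .neg (tr A)) ∧
      (∀ (s : Srt) (A : Fml R₂), tr (.all s A) = .all s (tr A)) ∧
      (∀ (s : Srt) (A : Fml R₂), tr (.ex s A) = .ex s (tr A)))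

/-! ## Abbreviations for terms and formulas -/

/-- The number variable with index `n`. -/
def nv (n : ℕ) : Expr R .num := .var .num n
/-- The function variable with index `n`. -/
def fv (n : ℕ) : Expr R .fn := .var .fn n

def succ (a : Expr R .num) : Expr R .num := .app (.un .succ) a
def fact (a : Expr R .num) : Expr R .num := .app (.un .fact) a
def pd (a : Expr R .num) : Expr R .num := .app (.un .pd) a
def sgbar (a : Expr R .num) : Expr R .num := .app (.un .sgbar) a
def sg (a : Expr R .num) : Expr R .num := .app (.un .sg) a
/-- The `a`-th prime number (`2` is the `0`-th). -/
def prime (a : Expr R .num) : Expr R .num := .app (.un .prime) a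
def lh (a : Expr R .num) : Expr R .num := .app (.un .lh) a
def ccp (a : Expr R .num) : Expr R .num := .app (.un .ccp) a

def add (a b : Expr R .num) : Expr R .num := .bin .add a b
def mul (a b : Expr R .num) : Expr R .num := .bin .mul a b
def exp (a b : Expr R .num) : Expr R .num := .bin .exp a b
def monus (a b : Expr R .num) : Expr R .num := .bin .monus a b
def tmin (a b : Expr R .num) : Expr R .num := .bin .min a b
def tmax (a b : Expr R .num) : Expr R .num := .bin .max a b
def dist (a b : Expr R .num) : Expr R .num := .bin .dist a b
def rm (a b : Expr R .num) : Expr R .num := .bin .rm a b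
def quot (a b : Expr R .num) : Expr R .num := .bin .quot a b
/-- `(a)_i`. -/
def comp (a i : Expr R .num) : Expr R .num := .bin .comp a i
def cat (a b : Expr R .num) : Expr R .num := .bin .cat a b
def circ (a b : Expr R .num) : Expr R .num := .bin .circ a b

/-- The numeral for `n`. -/
def numeral : ℕ → Expr R .num
  | 0 => .zero
  | n + 1 => succ (numeral n)

/-- `Σ_{y<z} t(y)`, where in `t` the index `0` stands for `y`. -/
def bsum (z t : Expr R .num) : Expr R .num := .fnl .sum z (.lam t)
/-- `Π_{y<z} t(y)`, where in `t` the index `0` stands for `y`. -/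
def bprod (z t : Expr R .num) : Expr R .num := .fnl .prod z (.lam t)

/-- `μy_{y<z} (t(y) = 0)`, that is `Σ_{x<z} Π_{y<x'} t(y)`, for a term `t` with values `≤ 1`
in which the index `0` stands for `y`. -/
def bmu (z t : Expr R .num) : Expr R .num :=
  bsum z (bprod (succ (nv 0)) (t.ren (liftRen .num (shiftRen .num))))

/-- A term that is `0` or `1`, and is `0` exactly if `a < b`, that is `a' ∸ b = 0`. -/
def ltTm (a b : Expr R .num) : Expr R .num := sg (monus (succ a) b)
/-- A term that is `0` or `1`, and is `0` exactly if `a ∣ b`, that is `sg(rm(b, a)) = 0`. -/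
def dvdTm (a b : Expr R .num) : Expr R .num := sg (rm b a)
/-- A term that is `0` or `1`, and is `0` exactly if `a` is a prime number: `1 < a` and there is no
`c < a` with `1 < c` and `c ∣ a`. -/
def prTm (a : Expr R .num) : Expr R .num :=
  sg (add (ltTm (numeral 1) a)
    (bsum a (mul (sgbar (ltTm (numeral 1) (nv 0))) (sgbar (dvdTm (nv 0) (a.shift .num))))))

/-- The coding `⟨a, b⟩ = 2^a · 3^b` of pairs. -/
def pair (a b : Expr R .num) : Expr R .num :=
  mul (exp (numeral 2) a) (exp (numeral 3) b)

/-- Equality of functors, `∀x (u)(x) = (v)(x)`. -/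
def eqFn (u v : Expr R .fn) : Fml R :=
  .all .num (.eq (.app (u.shift .num) (nv 0)) (.app (v.shift .num) (nv 0)))

/-- `∃!β C(β) ≡ ∃β [C(β) & ∀γ (C(γ) → β = γ)]`, where in `C` the function index `0` stands
for `β`. -/
def exUniqueFn (C : Fml R) : Fml R :=
  .ex .fn (.and C
    (.all .fn (.imp (C.ren (liftRen .fn (shiftRen .fn))) (eqFn (fv 1) (fv 0)))))

/-- `b(0) = x & ∀z b(z') = u(⟨b(z), z⟩)`. -/
def recEqs (x : Expr R .num) (u b : Expr R .fn) : Fml R :=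
  .and (.eq (.app b .zero) x)
    (.all .num (.eq (.app (b.shift .num) (succ (nv 0)))
      (.app (u.shift .num) (pair (.app (b.shift .num) (nv 0)) (nv 0)))))

/-- The formula `A(x, u, y, w) ≡ ∃β [β(0) = x & ∀z β(z') = u(⟨β(z), z⟩) & β(y) = w]`. -/
def recFml (x : Expr R .num) (u : Expr R .fn) (y w : Expr R .num) : Fml R :=
  .ex .fn (.and (recEqs (x.shift .fn) (u.shift .fn) (fv 0))
    (.eq (.app (fv 0) (y.shift .fn)) (w.shift .fn)))

/-! ## The axioms -/

/-- The mathematical axioms of `IA₁`. The variables written `a`, `b`, `x`, ... in the usual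
presentation are the number variables with indices `0`, `1`, `2`, and `α` is the function variable
with index `0`. The parameter `r` is the term used in the recursion equation of the constant `ccp`,
in which the index `0` stands for the recursion variable and the index `1` for the previous value. -/
inductive IA₁ (r : Expr R .num) : Fml R → Prop
  | eq_trans : IA₁ r (.imp (.eq (nv 0) (nv 1)) (.imp (.eq (nv 0) (nv 2)) (.eq (nv 1) (nv 2))))
  | succ_ne : IA₁ r (.neg (.eq (succ (nv 0)) .zero))
  | succ_congr : IA₁ r (.imp (.eq (nv 0) (nv 1)) (.eq (succ (nv 0)) (succ (nv 1))))
  | succ_inj : IA₁ r (.imp (.eq (succ (nv 0)) (succ (nv 1))) (.eq (nv 0) (nv 1)))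
  | add_zero : IA₁ r (.eq (add (nv 0) .zero) (nv 0))
  | add_succ : IA₁ r (.eq (add (nv 0) (succ (nv 1))) (succ (add (nv 0) (nv 1))))
  | mul_zero : IA₁ r (.eq (mul (nv 0) .zero) .zero)
  | mul_succ : IA₁ r (.eq (mul (nv 0) (succ (nv 1))) (add (mul (nv 0) (nv 1)) (nv 0)))
  | exp_zero : IA₁ r (.eq (exp (nv 0) .zero) (numeral 1))
  | exp_succ : IA₁ r (.eq (exp (nv 0) (succ (nv 1))) (mul (exp (nv 0) (nv 1)) (nv 0)))
  | fact_zero : IA₁ r (.eq (fact .zero) (numeral 1))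
  | fact_succ : IA₁ r (.eq (fact (succ (nv 0))) (mul (fact (nv 0)) (succ (nv 0))))
  | pd_zero : IA₁ r (.eq (pd .zero) .zero)
  | pd_succ : IA₁ r (.eq (pd (succ (nv 0))) (nv 0))
  | monus_zero : IA₁ r (.eq (monus (nv 0) .zero) (nv 0))
  | monus_succ : IA₁ r (.eq (monus (nv 0) (succ (nv 1))) (pd (monus (nv 0) (nv 1))))
  | min_def : IA₁ r (.eq (tmin (nv 0) (nv 1)) (monus (nv 1) (monus (nv 1) (nv 0))))
  | max_def : IA₁ r (.eq (tmax (nv 0) (nv 1)) (add (monus (nv 0) (nv 1)) (nv 1)))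
  | sgbar_zero : IA₁ r (.eq (sgbar .zero) (numeral 1))
  | sgbar_succ : IA₁ r (.eq (sgbar (succ (nv 0))) .zero)
  | sg_zero : IA₁ r (.eq (sg .zero) .zero)
  | sg_succ : IA₁ r (.eq (sg (succ (nv 0))) (numeral 1))
  | dist_def : IA₁ r (.eq (dist (nv 0) (nv 1)) (add (monus (nv 0) (nv 1)) (monus (nv 1) (nv 0))))
  | rm_zero : IA₁ r (.eq (rm .zero (nv 1)) .zero)
  | rm_succ : IA₁ r (.eq (rm (succ (nv 0)) (nv 1))
      (mul (succ (rm (nv 0) (nv 1))) (sg (dist (nv 1) (succ (rm (nv 0) (nv 1)))))))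
  | quot_zero : IA₁ r (.eq (quot .zero (nv 1)) .zero)
  | quot_succ : IA₁ r (.eq (quot (succ (nv 0)) (nv 1))
      (add (quot (nv 0) (nv 1)) (sgbar (dist (nv 1) (succ (rm (nv 0) (nv 1)))))))
  | sum_zero : IA₁ r (.eq (.fnl .sum .zero (fv 0)) .zero)
  | sum_succ : IA₁ r (.eq (.fnl .sum (succ (nv 0)) (fv 0))
      (add (.fnl .sum (nv 0) (fv 0)) (.app (fv 0) (nv 0))))
  | prod_zero : IA₁ r (.eq (.fnl .prod .zero (fv 0)) (numeral 1))
  | prod_succ : IA₁ r (.eq (.fnl .prod (succ (nv 0)) (fv 0))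
      (mul (.fnl .prod (nv 0) (fv 0)) (.app (fv 0) (nv 0))))
  | minLe_zero : IA₁ r (.eq (.fnl .minLe .zero (fv 0)) (.app (fv 0) .zero))
  | minLe_succ : IA₁ r (.eq (.fnl .minLe (succ (nv 0)) (fv 0))
      (tmin (.fnl .minLe (nv 0) (fv 0)) (.app (fv 0) (succ (nv 0)))))
  | maxLe_zero : IA₁ r (.eq (.fnl .maxLe .zero (fv 0)) (.app (fv 0) .zero))
  | maxLe_succ : IA₁ r (.eq (.fnl .maxLe (succ (nv 0)) (fv 0))
      (tmax (.fnl .maxLe (nv 0) (fv 0)) (.app (fv 0) (succ (nv 0)))))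
  | prime_zero : IA₁ r (.eq (prime .zero) (numeral 2))
    /-- `p_{i'} = μb_{b < p_i! + 2} [p_i < b & Pr(b)]` -/
  | prime_succ : IA₁ r (.eq (prime (succ (nv 0)))
      (bmu (add (fact (prime (nv 0))) (numeral 2))
        (sg (add (ltTm (prime (nv 1)) (nv 0)) (prTm (nv 0))))))
    /-- `(a)_i = μx_{x < a} [p_i^x ∣ a & ¬ p_i^{x'} ∣ a]` -/
  | comp_def : IA₁ r (.eq (comp (nv 0) (nv 1))
      (bmu (nv 0) (sg (add (dvdTm (exp (prime (nv 2)) (nv 0)) (nv 1))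
        (sgbar (dvdTm (exp (prime (nv 2)) (succ (nv 0))) (nv 1)))))))
  | lh_def : IA₁ r (.eq (lh (nv 0)) (bsum (nv 0) (sg (comp (nv 1) (nv 0)))))
  | cat_def : IA₁ r (.eq (cat (nv 0) (nv 1))
      (mul (nv 0) (bprod (lh (nv 1)) (exp (prime (add (lh (nv 1)) (nv 0))) (comp (nv 2) (nv 0))))))
  | bar_def : IA₁ r (.eq (.fnl .bar (nv 0) (fv 0))
      (bprod (nv 0) (exp (prime (nv 0)) (add (.app (fv 0) (nv 0)) (numeral 1)))))
  | tilde_def : IA₁ r (.eq (.fnl .tilde (nv 0) (fv 0))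
      (bprod (nv 0) (exp (prime (nv 0)) (.app (fv 0) (nv 0)))))
  | circ_def : IA₁ r (.eq (circ (nv 0) (nv 1))
      (bprod (tmax (nv 0) (nv 1))
        (exp (prime (nv 0)) (tmax (comp (nv 1) (nv 0)) (comp (nv 2) (nv 0))))))
  | ccp_zero : IA₁ r (.eq (ccp .zero) (numeral 1))
  | ccp_succ : IA₁ r (.eq (ccp (succ (nv 0)))
      (mul (ccp (nv 0)) (exp (prime (nv 0)) (r.sub fun
        | .num, 0 => nv 0
        | .num, 1 => ccp (nv 0)
        | s, n => .var s n))))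
    /-- The equality axiom for function variables. -/
  | fn_congr : IA₁ r (.imp (.eq (nv 0) (nv 1)) (.eq (.app (fv 0) (nv 0)) (.app (fv 0) (nv 1))))
    /-- The schema of `λ`-conversion `(λx.t(x))(s) = t(s)`. -/
  | lam_conv (t s : Expr R .num) : IA₁ r (.eq (.app (.lam t) s) (t.inst .num s))
    /-- The schema of mathematical induction `A(0) & ∀x (A(x) → A(x')) → ∀x A(x)`. -/
  | ind (A : Fml R) : IA₁ r
      (.imp (.and (A.inst .num .zero)
          (.all .num (.imp A (A.sub fun
            | .num, 0 => succ (nv 0)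
            | s, n => .var s n))))
        (.all .num A))

/-- The schema `QF-AC₀₀`, `∀x ∃y A(x, y) → ∃α ∀x A(x, α(x))` for quantifier-free `A(x, y)`; in `A`
the number index `0` stands for `y` and `1` for `x`. -/
inductive QFAC₀₀ : Fml R → Prop
  | mk (A : Fml R) (hA : A.QuantifierFree) : QFAC₀₀
      (.imp (.all .num (.ex .num A))
        (.ex .fn (.all .num (A.sub fun
          | .num, 0 => .app (fv 0) (nv 0)
          | .num, n + 1 => nv n
          | .fn, n => fv (n + 1)))))

/-- The axiom `Rec`, `A(x, α, y, rec(x, α, y))`. -/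
inductive Rec : Fml Unit → Prop
  | mk : Rec (recFml (nv 0) (fv 0) (nv 1) (.rcr () (nv 0) (fv 0) (nv 1)))

/-- The inclusion of the language of `IA₁` in the language with the constant `rec`. -/
def incl : Empty ↪ Unit := Function.Embedding.ofIsEmpty

/-- The system `IA₁ + QF-AC₀₀`. -/
def IA₁QF (r : Expr Empty .num) : Set (Fml Empty) := {A | IA₁ r A ∨ QFAC₀₀ A}

/-- The system `IA₁ + QF-AC₀₀ + Rec`; all schemata are extended to the language with `rec`. -/
def IA₁QFRec (r : Expr Empty .num) : Set (Fml Unit) :=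
  {A | IA₁ (r.map incl) A ∨ QFAC₀₀ A ∨ Rec A}

/-- The substitution `(·)^w` under the binders of `∃γ ∀w`: the number variable with index `n` is
replaced by `(w)_i` for `i = e n`, its place in a list of variables, and the function variables are
unchanged. -/
def wSub (e : ℕ → ℕ) : (s : Srt) → ℕ → Expr R s
  | .num, n => comp (nv 0) (numeral (e n))
  | .fn, n => fv (n + 1)

end TwoSortedArith

/-!
The work is done inside the formal systems, and two devices keep it close to ordinary mathematics.
Formulas are always considered in an environment, as `A.sub σ`, and rules are stated for such
instances. And for a system containing `IA₁` and a list `Γ` of assumptions, the terms up to equality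
provable from `Γ` form a type `Q T Γ`. Induction in the system makes it an ordered commutative
semiring with truncated subtraction, so that equations and inequalities of the system are proved by
`ring`, `gcongr` and the like.

*Definition by recursion.* Pairs and finite sequences of numbers are coded in this semiring
(`mk_entry_seqCode`), and by induction on `y` there is a code of the first `y + 1` values of the
function to be defined (`Prov.exists_approxF`). That `v` is such a code is expressed without
quantifiers, hence `QF-AC₀₀` gives a function choosing the codes, and reading off their entries gives
the function (`Prov.exists_rec`). Uniqueness is an induction (`recEqs_unique`). Since the codes may
be chosen uniformly in a parameter, the values are uniform as well (`Prov.exists_recFml_family`).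

*Elimination of `rec`.* Every expression of the language with `rec` has a graph, a formula without
`rec` in which `rec(t, u, s)` is described by the formula `A` (`Expr.graph`). The values are unique
(`Expr.graph_functional`), and they exist. The existence proof must pass under `λ`, where values are
needed for all arguments at once: so the induction shows that the values in all environments of a
number variable are given by one function (`Expr.repEx_graph`), which at `λ` is achieved by pairing
and at `rec` by the uniform recursion above. The translation `tr` leaves an equation without `rec`
as it is, lets any other say that both sides have a common value, and commutes with the logical
symbols. Because taking values commutes with substitution (`Values.graph_sub`, `Values.tr_sub`),
translated derivations remain derivations once the translated axioms are theorems (`Prov.tr`). For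
`QF-AC₀₀` this is not immediate, as the translation of a quantifier-free formula may contain
quantifiers; but it is equivalent to the vanishing of some function (`repEx_tr`), to which
`QF-AC₀₀` applies (`Prov.choice_tr`). In the presence of `Rec` every expression is its own value, and
every formula is equivalent to its translation (`map_tr_iff`).

*Effectiveness.* Graphs and translations are computed by course-of-values recursion on codes. Renaming
of variables changes its parameter at each binder, and this form of recursion is obtained from the
recursion theorem (`exists_computable_rec`).
-/

namespace TwoSortedArith
variable {R R₁ R₂ : Type}

set_option linter.unusedSectionVars false
set_option linter.unusedSimpArgs false

/-! ### Substitution calculus -/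

/-- Simultaneous substitutions for the variables of both sorts. `Expr.var` is the identity. -/
abbrev Subst (R : Type) : Type := (s : Srt) → ℕ → Expr R s

/-- The substitution of `e` for the variable with index `0` of sort `s` and of `σ` for the remaining
variables: an environment extended by one value. -/
def scons : (s : Srt) → Expr R s → Subst R → Subst R
  | .num, e, _, .num, 0 => e
  | .num, _, σ, .num, n + 1 => σ .num n
  | .num, _, σ, .fn, n => σ .fn n
  | .fn, _, σ, .num, n => σ .num n
  | .fn, e, _, .fn, 0 => e
  | .fn, _, σ, .fn, n + 1 => σ .fn n

/-- The environment `σ` weakened by a new variable of sort `s'`. -/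
def Subst.shift (s' : Srt) (σ : Subst R) : Subst R := fun s n => (σ s n).shift s'

theorem liftRen_comp (s : Srt) (ρ ρ' : Srt → ℕ → ℕ) :
    liftRen s (fun s n => ρ' s (ρ s n)) = fun s' n => liftRen s ρ' s' (liftRen s ρ s' n) := by
  funext s' n; cases s <;> cases s' <;> cases n <;> rfl

theorem Expr.ren_ren {s : Srt} (e : Expr R s) (ρ ρ' : Srt → ℕ → ℕ) :
    (e.ren ρ).ren ρ' = e.ren (fun s n => ρ' s (ρ s n)) := by
  induction e generalizing ρ ρ' <;> simp_all [Expr.ren, liftRen_comp]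

theorem Fml.ren_ren (A : Fml R) (ρ ρ' : Srt → ℕ → ℕ) :
    (A.ren ρ).ren ρ' = A.ren (fun s n => ρ' s (ρ s n)) := by
  induction A generalizing ρ ρ' <;> simp_all [Fml.ren, liftRen_comp, Expr.ren_ren]

theorem liftSub_ren (s : Srt) (ρ : Srt → ℕ → ℕ) (σ : Subst R) :
    liftSub s (fun s n => σ s (ρ s n)) = fun s' n => liftSub s σ s' (liftRen s ρ s' n) := by
  funext s' n; cases s <;> cases s' <;> cases n <;> rfl

theorem Expr.sub_ren {s : Srt} (e : Expr R s) (ρ : Srt → ℕ → ℕ) (σ : Subst R) :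
    (e.ren ρ).sub σ = e.sub (fun s n => σ s (ρ s n)) := by
  induction e generalizing ρ σ <;> simp_all [Expr.ren, Expr.sub, liftSub_ren]

theorem Fml.sub_ren (A : Fml R) (ρ : Srt → ℕ → ℕ) (σ : Subst R) :
    (A.ren ρ).sub σ = A.sub (fun s n => σ s (ρ s n)) := by
  induction A generalizing ρ σ <;> simp_all [Fml.ren, Fml.sub, liftSub_ren, Expr.sub_ren]

theorem liftRen_shiftRen (s : Srt) (ρ : Srt → ℕ → ℕ) :
    (fun s' n => liftRen s ρ s' (shiftRen s s' n)) = fun s' n => shiftRen s s' (ρ s' n) := by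
  funext s' n; cases s <;> cases s' <;> rfl

theorem Expr.shift_ren {s' : Srt} (s : Srt) (e : Expr R s') (ρ : Srt → ℕ → ℕ) :
    (e.shift s).ren (liftRen s ρ) = (e.ren ρ).shift s := by
  simp only [Expr.shift, Expr.ren_ren, liftRen_shiftRen]

theorem liftSub_eq (s : Srt) (σ : Subst R) :
    liftSub s σ = scons s (.var s 0) (σ.shift s) := by
  funext s' n; cases s <;> cases s' <;> cases n <;> rfl

theorem liftSub_ren_right (s : Srt) (ρ : Srt → ℕ → ℕ) (σ : Subst R) :
    liftSub s (fun s n => (σ s n).ren ρ) = fun s' n => (liftSub s σ s' n).ren (liftRen s ρ) := by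
  funext s' n
  cases s <;> cases s' <;> cases n <;>
    simp [liftSub, Expr.ren, liftRen, Expr.shift_ren]

theorem Expr.ren_sub {s : Srt} (e : Expr R s) (σ : Subst R) (ρ : Srt → ℕ → ℕ) :
    (e.sub σ).ren ρ = e.sub (fun s n => (σ s n).ren ρ) := by
  induction e generalizing ρ σ <;> simp_all [Expr.ren, Expr.sub, liftSub_ren_right]

theorem Fml.ren_sub (A : Fml R) (σ : Subst R) (ρ : Srt → ℕ → ℕ) :
    (A.sub σ).ren ρ = A.sub (fun s n => (σ s n).ren ρ) := by
  induction A generalizing ρ σ <;> simp_all [Fml.ren, Fml.sub, liftSub_ren_right, Expr.ren_sub]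

theorem liftSub_shiftRen (s : Srt) (σ : Subst R) :
    (fun s' n => liftSub s σ s' (shiftRen s s' n)) = σ.shift s := by
  funext s' n; cases s <;> cases s' <;> rfl

theorem Expr.shift_sub_lift {s' : Srt} (s : Srt) (e : Expr R s') (σ : Subst R) :
    (e.shift s).sub (liftSub s σ) = (e.sub σ).shift s := by
  rw [Expr.shift, Expr.sub_ren, liftSub_shiftRen, Expr.shift, Expr.ren_sub]; rfl

theorem Fml.shift_sub_lift (s : Srt) (A : Fml R) (σ : Subst R) :
    (A.shift s).sub (liftSub s σ) = (A.sub σ).shift s := by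
  rw [Fml.shift, Fml.sub_ren, liftSub_shiftRen, Fml.shift, Fml.ren_sub]; rfl

theorem liftSub_comp (s : Srt) (σ τ : Subst R) :
    liftSub s (fun s n => (σ s n).sub τ) = fun s' n => (liftSub s σ s' n).sub (liftSub s τ) := by
  funext s' n
  cases s <;> cases s' <;> cases n <;>
    simp [liftSub, Expr.sub, Expr.shift_sub_lift]

theorem Expr.sub_sub {s : Srt} (e : Expr R s) (σ τ : Subst R) :
    (e.sub σ).sub τ = e.sub (fun s n => (σ s n).sub τ) := by
  induction e generalizing σ τ <;> simp_all [Expr.sub, liftSub_comp]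

theorem Fml.sub_sub (A : Fml R) (σ τ : Subst R) :
    (A.sub σ).sub τ = A.sub (fun s n => (σ s n).sub τ) := by
  induction A generalizing σ τ <;> simp_all [Fml.sub, liftSub_comp, Expr.sub_sub]

theorem liftSub_var (s : Srt) : liftSub s (Expr.var (R := R)) = Expr.var := by
  funext s' n; cases s <;> cases s' <;> cases n <;> rfl

theorem Expr.sub_var {s : Srt} (e : Expr R s) : e.sub Expr.var = e := by
  induction e <;> simp_all [Expr.sub, liftSub_var]

theorem Fml.sub_var (A : Fml R) : A.sub Expr.var = A := by
  induction A <;> simp_all [Fml.sub, liftSub_var, Expr.sub_var]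

theorem Expr.ren_eq_sub {s : Srt} (e : Expr R s) (ρ : Srt → ℕ → ℕ) :
    e.ren ρ = e.sub (fun s n => .var s (ρ s n)) := by
  rw [← Expr.sub_ren, Expr.sub_var]

theorem Fml.ren_eq_sub (A : Fml R) (ρ : Srt → ℕ → ℕ) :
    A.ren ρ = A.sub (fun s n => .var s (ρ s n)) := by
  rw [← Fml.sub_ren, Fml.sub_var]

theorem instSub_eq (s : Srt) (e : Expr R s) : instSub s e = scons s e Expr.var := by
  funext s' n; cases s <;> cases s' <;> cases n <;> rfl

theorem scons_shiftRen (s : Srt) (e : Expr R s) (σ : Subst R) :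
    (fun s' n => scons s e σ s' (shiftRen s s' n)) = σ := by
  funext s' n; cases s <;> cases s' <;> rfl

theorem Expr.shift_sub {s' : Srt} (s : Srt) (t : Expr R s') (e : Expr R s) (σ : Subst R) :
    (t.shift s).sub (scons s e σ) = t.sub σ := by
  rw [Expr.shift, Expr.sub_ren, scons_shiftRen]

theorem Fml.shift_sub (s : Srt) (A : Fml R) (e : Expr R s) (σ : Subst R) :
    (A.shift s).sub (scons s e σ) = A.sub σ := by
  rw [Fml.shift, Fml.sub_ren, scons_shiftRen]

theorem liftSub_inst (s : Srt) (e : Expr R s) (σ : Subst R) :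
    (fun s' n => (liftSub s σ s' n).sub (instSub s e)) = scons s e σ := by
  funext s' n
  rw [instSub_eq]
  cases s <;> cases s' <;> cases n <;>
    simp [liftSub, scons, Expr.sub, Expr.shift_sub, Expr.sub_var]

theorem Expr.sub_lift_inst {s' : Srt} (s : Srt) (t : Expr R s') (e : Expr R s) (σ : Subst R) :
    (t.sub (liftSub s σ)).inst s e = t.sub (scons s e σ) := by
  rw [Expr.inst, Expr.sub_sub, liftSub_inst]

theorem Fml.sub_lift_inst (s : Srt) (A : Fml R) (e : Expr R s) (σ : Subst R) :
    (A.sub (liftSub s σ)).inst s e = A.sub (scons s e σ) := by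
  rw [Fml.inst, Fml.sub_sub, liftSub_inst]

theorem scons_sub (s : Srt) (e : Expr R s) (σ τ : Subst R) :
    (fun s' n => (scons s e σ s' n).sub τ) = scons s (e.sub τ) (fun s' n => (σ s' n).sub τ) := by
  funext s' n; cases s <;> cases s' <;> cases n <;> rfl

theorem Fml.inst_sub (s : Srt) (A : Fml R) (e : Expr R s) (σ : Subst R) :
    (A.inst s e).sub σ = A.sub (scons s (e.sub σ) σ) := by
  rw [Fml.inst, Fml.sub_sub, instSub_eq, scons_sub]; rfl

theorem Fml.inst_eq (s : Srt) (A : Fml R) (e : Expr R s) :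
    A.inst s e = A.sub (scons s e Expr.var) := by
  rw [Fml.inst, instSub_eq]

theorem Expr.sub_shift {s' : Srt} (s : Srt) (e : Expr R s') (σ : Subst R) :
    (e.sub σ).shift s = e.sub (σ.shift s) := by
  rw [Expr.shift, Expr.ren_sub]; rfl

theorem Fml.sub_shift (s : Srt) (A : Fml R) (σ : Subst R) :
    (A.sub σ).shift s = A.sub (σ.shift s) := by
  rw [Fml.shift, Fml.ren_sub]; rfl

theorem scons_var_shift (s : Srt) :
    scons s (.var s 0) (Subst.shift s (Expr.var (R := R))) = Expr.var := by
  rw [← liftSub_eq, liftSub_var]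

theorem scons_shift (s s' : Srt) (e : Expr R s) (σ : Subst R) :
    (scons s e σ).shift s' = scons s (e.shift s') (σ.shift s') := by
  funext s'' n; cases s <;> cases s'' <;> cases n <;> rfl

/-! ### Free variables -/

/-- Substitutions that agree on the variables below the given bounds. -/
def AgreeBelow (k l : ℕ) (σ τ : Subst R) : Prop :=
  (∀ n < k, σ .num n = τ .num n) ∧ ∀ n < l, σ .fn n = τ .fn n

theorem AgreeBelow.lift {k l : ℕ} {σ τ : Subst R} (h : AgreeBelow k l σ τ) :
    AgreeBelow (k + 1) l (liftSub .num σ) (liftSub .num τ) ∧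
    AgreeBelow k (l + 1) (liftSub .fn σ) (liftSub .fn τ) := by
  refine ⟨⟨fun n hn => ?_, fun n hn => ?_⟩, ⟨fun n hn => ?_, fun n hn => ?_⟩⟩
  · cases n with
    | zero => rfl
    | succ n => simp [liftSub, h.1 n (by omega)]
  · simp [liftSub, h.2 n hn]
  · simp [liftSub, h.1 n hn]
  · cases n with
    | zero => rfl
    | succ n => simp [liftSub, h.2 n (by omega)]

theorem AgreeBelow.mono {k l k' l' : ℕ} {σ τ : Subst R} (h : AgreeBelow k' l' σ τ)
    (hk : k ≤ k') (hl : l ≤ l') : AgreeBelow k l σ τ :=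
  ⟨fun n hn => h.1 n (by omega), fun n hn => h.2 n (by omega)⟩

theorem Expr.exists_agree {s : Srt} (e : Expr R s) :
    ∃ k l, ∀ σ τ : Subst R, AgreeBelow k l σ τ → e.sub σ = e.sub τ := by
  induction e with
  | var s n =>
    refine ⟨n + 1, n + 1, fun σ τ h => ?_⟩
    cases s
    · exact h.1 n (by omega)
    · exact h.2 n (by omega)
  | zero => exact ⟨0, 0, fun _ _ _ => rfl⟩
  | un f => exact ⟨0, 0, fun _ _ _ => rfl⟩
  | bin f a b iha ihb | fnl f a b iha ihb | app a b iha ihb =>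
    obtain ⟨k, l, h⟩ := iha
    obtain ⟨k', l', h'⟩ := ihb
    refine ⟨max k k', max l l', fun σ τ hs => ?_⟩
    simp only [Expr.sub]
    rw [h σ τ (hs.mono (by omega) (by omega)), h' σ τ (hs.mono (by omega) (by omega))]
  | rcr c a b d iha ihb ihd =>
    obtain ⟨k, l, h⟩ := iha
    obtain ⟨k', l', h'⟩ := ihb
    obtain ⟨k₂, l₂, h₂⟩ := ihd
    refine ⟨max (max k k') k₂, max (max l l') l₂, fun σ τ hs => ?_⟩
    simp only [Expr.sub]
    rw [h σ τ (hs.mono (by omega) (by omega)), h' σ τ (hs.mono (by omega) (by omega)),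
      h₂ σ τ (hs.mono (by omega) (by omega))]
  | lam t ih =>
    obtain ⟨k, l, h⟩ := ih
    refine ⟨k, l, fun σ τ hs => ?_⟩
    simp only [Expr.sub]
    rw [h _ _ (hs.lift.1.mono (by omega) (by omega))]

theorem Fml.exists_agree (A : Fml R) :
    ∃ k l, ∀ σ τ : Subst R, AgreeBelow k l σ τ → A.sub σ = A.sub τ := by
  induction A with
  | eq a b =>
    obtain ⟨k, l, h⟩ := a.exists_agree
    obtain ⟨k', l', h'⟩ := b.exists_agree
    refine ⟨max k k', max l l', fun σ τ hs => ?_⟩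
    simp only [Fml.sub]
    rw [h σ τ (hs.mono (by omega) (by omega)), h' σ τ (hs.mono (by omega) (by omega))]
  | and a b iha ihb | or a b iha ihb | imp a b iha ihb =>
    obtain ⟨k, l, h⟩ := iha
    obtain ⟨k', l', h'⟩ := ihb
    refine ⟨max k k', max l l', fun σ τ hs => ?_⟩
    simp only [Fml.sub]
    rw [h σ τ (hs.mono (by omega) (by omega)), h' σ τ (hs.mono (by omega) (by omega))]
  | neg a ih =>
    obtain ⟨k, l, h⟩ := ih
    exact ⟨k, l, fun σ τ hs => by simp only [Fml.sub]; rw [h σ τ hs]⟩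
  | all s a ih | ex s a ih =>
    obtain ⟨k, l, h⟩ := ih
    refine ⟨k, l, fun σ τ hs => ?_⟩
    simp only [Fml.sub]
    cases s
    · rw [h _ _ (hs.lift.1.mono (by omega) (by omega))]
    · rw [h _ _ (hs.lift.2.mono (by omega) (by omega))]

/-! ### Structural properties of deducibility -/

theorem Prov.mono {T : Set (Fml R)} {Γ Δ : List (Fml R)} {A : Fml R} (h : Prov T Γ A)
    (hs : Γ ⊆ Δ) : Prov T Δ A := by
  induction h generalizing Δ with
  | ax h => exact .ax h
  | hyp h => exact .hyp (hs h)
  | andI _ _ h₁ h₂ => exact .andI (h₁ hs) (h₂ hs)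
  | andE₁ _ h => exact .andE₁ (h hs)
  | andE₂ _ h => exact .andE₂ (h hs)
  | orI₁ _ h => exact .orI₁ (h hs)
  | orI₂ _ h => exact .orI₂ (h hs)
  | orE _ _ _ h₁ h₂ h₃ =>
    exact .orE (h₁ hs) (h₂ (List.cons_subset_cons _ hs)) (h₃ (List.cons_subset_cons _ hs))
  | impI _ h => exact .impI (h (List.cons_subset_cons _ hs))
  | impE _ _ h₁ h₂ => exact .impE (h₁ hs) (h₂ hs)
  | negI _ _ h₁ h₂ =>
    exact .negI (h₁ (List.cons_subset_cons _ hs)) (h₂ (List.cons_subset_cons _ hs))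
  | negE _ _ h₁ h₂ => exact .negE (h₁ hs) (h₂ hs)
  | allI _ h => exact .allI (h (List.map_subset _ hs))
  | allE e _ h => exact .allE e (h hs)
  | exI e _ h => exact .exI e (h hs)
  | exE _ _ h₁ h₂ => exact .exE (h₁ hs) (h₂ (List.cons_subset_cons _ (List.map_subset _ hs)))

theorem Prov.weaken {T : Set (Fml R)} {Γ : List (Fml R)} {A B : Fml R} (h : Prov T Γ A) :
    Prov T (B :: Γ) A :=
  h.mono (List.subset_cons_self _ _)

theorem Prov.of_nil {T : Set (Fml R)} {Γ : List (Fml R)} {A : Fml R} (h : Prov T [] A) :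
    Prov T Γ A :=
  h.mono (List.nil_subset _)

/-- The substitution of the values of `σ` for the first `k` variables of sort `s`, the others of that
sort dropping by `k`. -/
def takeSub (s : Srt) (k : ℕ) (σ : Subst R) : Subst R
  | .num, n => match s with
    | .num => if n < k then σ .num n else .var .num (n - k)
    | .fn => .var .num n
  | .fn, n => match s with
    | .num => .var .fn n
    | .fn => if n < k then σ .fn n else .var .fn (n - k)

/-- The renaming that raises the variables of sort `s` by `k`. -/
def raiseRen (s : Srt) (k : ℕ) : Srt → ℕ → ℕ
  | .num, n => match s with
    | .num => n + k
    | .fn => n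
  | .fn, n => match s with
    | .num => n
    | .fn => n + k

theorem takeSub_raiseRen (s : Srt) (k : ℕ) (σ : Subst R) :
    (fun s' n => takeSub s k σ s' (raiseRen s k s' n)) = Expr.var := by
  funext s' n
  cases s <;> cases s' <;> simp [takeSub, raiseRen]

/-- A theorem may be instantiated simultaneously for its first `k` variables of one sort: this is done
one variable at a time, the substituted expressions being first raised above the remaining
variables. -/
theorem Prov.takeSub {T : Set (Fml R)} (s : Srt) (k : ℕ) {A : Fml R} (h : Prov T [] A)
    (σ : Subst R) : Prov T [] (A.sub (takeSub s k σ)) := by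
  induction k generalizing A σ with
  | zero =>
    have : TwoSortedArith.takeSub s 0 σ = Expr.var := by
      funext s' n; cases s <;> cases s' <;> simp [TwoSortedArith.takeSub]
    rw [this, Fml.sub_var]; exact h
  | succ k ih =>
    have h₁ : Prov T [] (A.inst s ((σ s 0).ren (raiseRen s k))) := .allE _ (.allI h)
    have h₂ := ih h₁ (fun s n => σ s (n + 1))
    rw [Fml.inst_sub, Expr.sub_ren, takeSub_raiseRen, Expr.sub_var] at h₂
    convert h₂ using 2
    funext s' n
    cases s <;> cases s' <;> cases n <;> simp [TwoSortedArith.takeSub, scons]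

theorem Prov.sub_nil {T : Set (Fml R)} {A : Fml R} (h : Prov T [] A) (σ : Subst R) :
    Prov T [] (A.sub σ) := by
  obtain ⟨k, l, hkl⟩ := A.exists_agree
  -- The function variables of the values for the number variables are raised by `l`, out of
  -- reach of the second instantiation.
  have h₁ := (h.takeSub .num k (fun s n => (σ s n).ren (raiseRen .fn l))).takeSub .fn l σ
  rw [Fml.sub_sub] at h₁
  convert h₁ using 1
  apply hkl
  refine ⟨fun n hn => ?_, fun n hn => ?_⟩
  · simp only [TwoSortedArith.takeSub, if_pos hn]
    rw [Expr.sub_ren, takeSub_raiseRen, Expr.sub_var]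
  · simp [TwoSortedArith.takeSub, if_pos hn, Expr.sub]

/-- Deducibility is closed under substitution, the axioms being open to generalization. -/
theorem Prov.sub {T : Set (Fml R)} {Γ : List (Fml R)} {A : Fml R} (h : Prov T Γ A) (σ : Subst R) :
    Prov T (Γ.map (Fml.sub · σ)) (A.sub σ) := by
  have hsh : ∀ (s : Srt) (Γ : List (Fml R)) (σ : Subst R),
      (Γ.map (Fml.shift s)).map (Fml.sub · (liftSub s σ)) =
        (Γ.map (Fml.sub · σ)).map (Fml.shift s) := by
    intro s Γ σ
    simp [Fml.shift_sub_lift]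
  induction h generalizing σ with
  | ax h => exact (Prov.sub_nil (.ax h) σ).of_nil
  | hyp h => exact .hyp (List.mem_map_of_mem h)
  | andI _ _ h₁ h₂ => exact .andI (h₁ σ) (h₂ σ)
  | andE₁ _ h => exact .andE₁ (h σ)
  | andE₂ _ h => exact .andE₂ (h σ)
  | orI₁ _ h => exact .orI₁ (h σ)
  | orI₂ _ h => exact .orI₂ (h σ)
  | orE _ _ _ h₁ h₂ h₃ => exact .orE (h₁ σ) (h₂ σ) (h₃ σ)
  | impI _ h => exact .impI (h σ)
  | impE _ _ h₁ h₂ => exact .impE (h₁ σ) (h₂ σ)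
  | negI _ _ h₁ h₂ => exact .negI (h₁ σ) (h₂ σ)
  | negE _ _ h₁ h₂ => exact .negE (h₁ σ) (h₂ σ)
  | @allI Γ s A _ h =>
    have := h (liftSub s σ)
    rw [hsh] at this
    exact .allI this
  | @allE Γ s A e _ h =>
    have := Prov.allE (e.sub σ) (h σ)
    rw [Fml.sub_lift_inst] at this
    rw [Fml.inst_sub]; exact this
  | @exI Γ s A e _ h =>
    have := h σ
    rw [Fml.inst_sub, ← Fml.sub_lift_inst] at this
    exact .exI _ this
  | @exE Γ s A B _ _ h₁ h₂ =>
    have := h₂ (liftSub s σ)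
    rw [List.map_cons, hsh, Fml.shift_sub_lift] at this
    exact .exE (h₁ σ) this

theorem Prov.ren {T : Set (Fml R)} {Γ : List (Fml R)} {A : Fml R} (h : Prov T Γ A)
    (ρ : Srt → ℕ → ℕ) : Prov T (Γ.map (Fml.ren · ρ)) (A.ren ρ) := by
  simpa only [Fml.ren_eq_sub] using h.sub (fun s n => .var s (ρ s n))

theorem Prov.shift {T : Set (Fml R)} {Γ : List (Fml R)} {A : Fml R} (h : Prov T Γ A) (s : Srt) :
    Prov T (Γ.map (Fml.shift s)) (A.shift s) :=
  h.ren _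

theorem Prov.shift_sub {T : Set (Fml R)} {Γ : List (Fml R)} {A : Fml R} {σ : Subst R}
    (h : Prov T Γ (A.sub σ)) (s : Srt) : Prov T (Γ.map (Fml.shift s)) (A.sub (σ.shift s)) := by
  rw [← Fml.sub_shift]; exact h.shift s

/-- Using an assumption in an arbitrary extension of the context. -/
theorem Prov.assume {T : Set (Fml R)} {Γ : List (Fml R)} {A C : Fml R}
    (h : ∀ Δ, Γ ⊆ Δ → Prov T Δ A → Prov T Δ C) : Prov T (A :: Γ) C :=
  h _ (List.subset_cons_self _ _) (.hyp List.mem_cons_self)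

/-! Quantifier rules for a formula in an environment. -/

section
variable {T : Set (Fml R)} {Γ : List (Fml R)} {s : Srt} {A : Fml R} {σ : Subst R}

theorem Prov.exI_sub (e : Expr R s) (h : Prov T Γ (A.sub (scons s e σ))) :
    Prov T Γ ((Fml.ex s A).sub σ) :=
  .exI e (by rw [Fml.sub_lift_inst]; exact h)

theorem Prov.allE_sub (e : Expr R s) (h : Prov T Γ ((Fml.all s A).sub σ)) :
    Prov T Γ (A.sub (scons s e σ)) := by
  rw [← Fml.sub_lift_inst]; exact .allE e h

theorem Prov.all_var (h : Prov T Γ (.all s A)) : Prov T (Γ.map (Fml.shift s)) A := by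
  rw [← Fml.sub_var (.all s A)] at h
  have := (h.shift_sub s).allE_sub (.var s 0)
  rwa [scons_var_shift, Fml.sub_var] at this

theorem Prov.allI_sub
    (h : Prov T (Γ.map (Fml.shift s)) (A.sub (scons s (.var s 0) (σ.shift s)))) :
    Prov T Γ ((Fml.all s A).sub σ) :=
  .allI (by rw [liftSub_eq]; exact h)

theorem Prov.exE_sub {C : Fml R} (h : Prov T Γ ((Fml.ex s A).sub σ))
    (h' : Prov T (A.sub (scons s (.var s 0) (σ.shift s)) :: Γ.map (Fml.shift s)) (C.shift s)) :
    Prov T Γ C :=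
  .exE h (by rw [liftSub_eq]; exact h')

end

/-! ### Arithmetical systems and equality -/

/-- A system that contains the axioms of `IA₁` in its language (for some term in the recursion
equations of `ccp`) and proves the axiom `Rec` for each of its additional constants. Both `IA₁` and
the system with the constant `rec` are of this kind. -/
class IsArith (T : Set (Fml R)) : Prop where
  base : ∃ r, ∀ A, IA₁ r A → A ∈ T
  recAx : ∀ c : R, Prov T [] (recFml (nv 0) (fv 0) (nv 1) (.rcr c (nv 0) (fv 0) (nv 1)))

/-- The environment with three numbers and one function. -/
def env (a b c : Expr R .num) (u : Expr R .fn) : Subst R :=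
  scons .num a (scons .num b (scons .num c (scons .fn u Expr.var)))

/-- Equality at either sort. -/
def eqE : (s : Srt) → Expr R s → Expr R s → Fml R
  | .num, a, b => .eq a b
  | .fn, u, v => eqFn u v

theorem eqFn_sub (u v : Expr R .fn) (σ : Subst R) :
    (eqFn u v).sub σ = eqFn (u.sub σ) (v.sub σ) := by
  simp only [eqFn, Fml.sub, Expr.sub, Expr.shift_sub_lift]; rfl

theorem eqE_sub {s : Srt} (u v : Expr R s) (σ : Subst R) :
    (eqE s u v).sub σ = eqE s (u.sub σ) (v.sub σ) := by
  cases s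
  · rfl
  · exact eqFn_sub u v σ

theorem eqE_ren {s : Srt} (u v : Expr R s) (ρ : Srt → ℕ → ℕ) :
    (eqE s u v).ren ρ = eqE s (u.ren ρ) (v.ren ρ) := by
  simp only [Fml.ren_eq_sub, Expr.ren_eq_sub, eqE_sub]

theorem eqE_shift {s : Srt} (s' : Srt) (u v : Expr R s) :
    (eqE s u v).shift s' = eqE s (u.shift s') (v.shift s') :=
  eqE_ren _ _ _

section
variable (σ : Subst R) (a b c : Expr R .num) (u : Expr R .fn)

@[simp] theorem nv_sub (n : ℕ) : (nv n).sub σ = σ .num n := rfl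
@[simp] theorem fv_sub (n : ℕ) : (fv n).sub σ = σ .fn n := rfl
@[simp] theorem zero_sub : (Expr.zero : Expr R .num).sub σ = .zero := rfl
@[simp] theorem bin_sub (f : BinConst) : (Expr.bin f a b).sub σ = .bin f (a.sub σ) (b.sub σ) := rfl
@[simp] theorem fnl_sub (f : FnlConst) : (Expr.fnl f a u).sub σ = .fnl f (a.sub σ) (u.sub σ) := rfl
@[simp] theorem app_sub : (Expr.app u a).sub σ = .app (u.sub σ) (a.sub σ) := rfl
@[simp] theorem succ_sub : (succ a).sub σ = succ (a.sub σ) := rfl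
@[simp] theorem pd_sub : (pd a).sub σ = pd (a.sub σ) := rfl
@[simp] theorem sg_sub : (sg a).sub σ = sg (a.sub σ) := rfl
@[simp] theorem sgbar_sub : (sgbar a).sub σ = sgbar (a.sub σ) := rfl
@[simp] theorem add_sub : (add a b).sub σ = add (a.sub σ) (b.sub σ) := rfl
@[simp] theorem mul_sub : (mul a b).sub σ = mul (a.sub σ) (b.sub σ) := rfl
@[simp] theorem exp_sub : (exp a b).sub σ = exp (a.sub σ) (b.sub σ) := rfl
@[simp] theorem monus_sub : (monus a b).sub σ = monus (a.sub σ) (b.sub σ) := rfl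
@[simp] theorem dist_sub : (dist a b).sub σ = dist (a.sub σ) (b.sub σ) := rfl
@[simp] theorem rm_sub : (rm a b).sub σ = rm (a.sub σ) (b.sub σ) := rfl
@[simp] theorem quot_sub : (quot a b).sub σ = quot (a.sub σ) (b.sub σ) := rfl
@[simp] theorem pair_sub : (pair a b).sub σ = pair (a.sub σ) (b.sub σ) := rfl

variable (s : Srt)

@[simp] theorem nv_shift_num (n : ℕ) : (nv n).shift .num = (nv (n + 1) : Expr R .num) := rfl
@[simp] theorem nv_shift_fn (n : ℕ) : (nv n).shift .fn = (nv n : Expr R .num) := rfl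
@[simp] theorem zero_shift : (Expr.zero : Expr R .num).shift s = .zero := rfl
@[simp] theorem bin_shift (f : BinConst) : (Expr.bin f a b).shift s = .bin f (a.shift s) (b.shift s) := rfl
@[simp] theorem fnl_shift (f : FnlConst) : (Expr.fnl f a u).shift s =
    .fnl f (a.shift s) (u.shift s) := rfl
@[simp] theorem succ_shift : (succ a).shift s = succ (a.shift s) := rfl
@[simp] theorem add_shift : (add a b).shift s = add (a.shift s) (b.shift s) := rfl

@[simp] theorem scons_num_zero : scons .num a σ .num 0 = a := rfl
@[simp] theorem scons_num_succ (n : ℕ) : scons .num a σ .num (n + 1) = σ .num n := rfl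
@[simp] theorem scons_num_one : scons .num a σ .num 1 = σ .num 0 := rfl
@[simp] theorem scons_num_fn (n : ℕ) : scons .num a σ .fn n = σ .fn n := rfl
@[simp] theorem scons_fn_zero : scons .fn u σ .fn 0 = u := rfl
@[simp] theorem scons_fn_succ (n : ℕ) : scons .fn u σ .fn (n + 1) = σ .fn n := rfl
@[simp] theorem scons_fn_num (n : ℕ) : scons .fn u σ .num n = σ .num n := rfl
@[simp] theorem Subst.shift_apply (s s' : Srt) (n : ℕ) :
    Subst.shift s σ s' n = (σ s' n).shift s := rfl
@[simp] theorem nv_def (n : ℕ) : (Expr.var .num n : Expr R .num) = nv n := rfl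
@[simp] theorem fv_def (n : ℕ) : (Expr.var .fn n : Expr R .fn) = fv n := rfl
attribute [simp] Fml.sub

end

section
variable {T : Set (Fml R)} {Γ : List (Fml R)}

theorem Prov.eqFn_app {u v : Expr R .fn} (h : Prov T Γ (eqFn u v)) (a : Expr R .num) :
    Prov T Γ (.eq (.app u a) (.app v a)) := by
  have := Prov.allE a h
  simp only [Fml.inst_eq, Fml.sub, Expr.sub, Expr.shift_sub, Expr.sub_var] at this
  exact this

theorem Prov.eqFn_intro {u v : Expr R .fn}
    (h : Prov T (Γ.map (Fml.shift .num))
      (.eq (.app (u.shift .num) (nv 0)) (.app (v.shift .num) (nv 0)))) : Prov T Γ (eqFn u v) :=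
  .allI h

variable [hT : IsArith T]

theorem Prov.ax_inst {F : Fml R} (h : ∀ r, IA₁ r F) (a b c : Expr R .num) (u : Expr R .fn) :
    Prov T Γ (F.sub (env a b c u)) := by
  obtain ⟨r, hr⟩ := hT.base
  exact (Prov.sub_nil (.ax (hr _ (h r))) _).of_nil

/-- A functor without further meaning, for unused places in environments. -/
abbrev idleFn : Expr R .fn := .un .succ

theorem Prov.eq_trans' {a b c : Expr R .num} (h : Prov T Γ (.eq a b)) (h' : Prov T Γ (.eq a c)) :
    Prov T Γ (.eq b c) := by
  have := Prov.ax_inst (T := T) (Γ := Γ) (fun r => IA₁.eq_trans (r := r)) a b c idleFn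
  exact .impE (.impE this h) h'

theorem Prov.eq_refl (a : Expr R .num) : Prov T Γ (.eq a a) := by
  have : Prov T Γ (.eq (add a .zero) a) :=
    Prov.ax_inst (T := T) (Γ := Γ) (fun r => IA₁.add_zero (r := r)) a a a idleFn
  exact this.eq_trans' this

theorem Prov.eq_symm {a b : Expr R .num} (h : Prov T Γ (.eq a b)) : Prov T Γ (.eq b a) :=
  h.eq_trans' (.eq_refl a)

theorem Prov.eq_trans {a b c : Expr R .num} (h : Prov T Γ (.eq a b)) (h' : Prov T Γ (.eq b c)) :
    Prov T Γ (.eq a c) :=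
  h.eq_symm.eq_trans' h'

theorem Prov.app_congr_arg (u : Expr R .fn) {a b : Expr R .num} (h : Prov T Γ (.eq a b)) :
    Prov T Γ (.eq (.app u a) (.app u b)) := by
  have := Prov.ax_inst (T := T) (Γ := Γ) (fun r => IA₁.fn_congr (r := r)) a b b u
  exact .impE this h

theorem Prov.lam_conv (t a : Expr R .num) : Prov T Γ (.eq (.app (.lam t) a) (t.inst .num a)) := by
  obtain ⟨r, hr⟩ := hT.base
  exact .ax (hr _ (.lam_conv t a))

theorem Prov.lam_conv_sub (t a : Expr R .num) (σ : Subst R) :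
    Prov T Γ (.eq (.app ((Expr.lam t).sub σ) a) (t.sub (scons .num a σ))) := by
  rw [← Expr.sub_lift_inst]; exact .lam_conv _ _

theorem Prov.sub_congr_arg (t : Expr R .num) (σ : Subst R) {a b : Expr R .num}
    (h : Prov T Γ (.eq a b)) :
    Prov T Γ (.eq (t.sub (scons .num a σ)) (t.sub (scons .num b σ))) :=
  (Prov.lam_conv_sub t a σ).eq_trans' (.eq_trans (.app_congr_arg _ h) (.lam_conv_sub t b σ))

theorem Prov.bin_congr (f : BinConst) {a a' b b' : Expr R .num} (h : Prov T Γ (.eq a a'))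
    (h' : Prov T Γ (.eq b b')) : Prov T Γ (.eq (.bin f a b) (.bin f a' b')) :=
  .eq_trans (Prov.sub_congr_arg (.bin f (nv 0) (nv 1)) (scons .num b Expr.var) h)
    (Prov.sub_congr_arg (.bin f (nv 1) (nv 0)) (scons .num a' Expr.var) h')

theorem Prov.fnl_congr_arg (f : FnlConst) (u : Expr R .fn) {a a' : Expr R .num}
    (h : Prov T Γ (.eq a a')) : Prov T Γ (.eq (.fnl f a u) (.fnl f a' u)) :=
  Prov.sub_congr_arg (.fnl f (nv 0) (fv 0)) (scons .fn u Expr.var) h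

theorem Prov.eqFn_refl (u : Expr R .fn) : Prov T Γ (eqFn u u) :=
  .eqFn_intro (.eq_refl _)

theorem Prov.eqFn_symm {u v : Expr R .fn} (h : Prov T Γ (eqFn u v)) : Prov T Γ (eqFn v u) := by
  have := h.shift .num
  rw [show (eqFn u v).shift .num = _ from eqE_shift (s := .fn) .num u v] at this
  exact .eqFn_intro (this.eqFn_app _).eq_symm

theorem Prov.eqFn_trans {u v w : Expr R .fn} (h : Prov T Γ (eqFn u v))
    (h' : Prov T Γ (eqFn v w)) : Prov T Γ (eqFn u w) := by
  have h₁ := h.shift .num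
  have h₂ := h'.shift .num
  rw [show (eqFn u v).shift .num = _ from eqE_shift (s := .fn) .num u v] at h₁
  rw [show (eqFn v w).shift .num = _ from eqE_shift (s := .fn) .num v w] at h₂
  exact .eqFn_intro ((h₁.eqFn_app _).eq_trans (h₂.eqFn_app _))

theorem Prov.eqE_refl {s : Srt} (a : Expr R s) : Prov T Γ (eqE s a a) := by
  cases s
  · exact .eq_refl a
  · exact .eqFn_refl a

theorem Prov.eqE_symm {s : Srt} {a b : Expr R s} (h : Prov T Γ (eqE s a b)) :
    Prov T Γ (eqE s b a) := by
  cases s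
  · exact .eq_symm h
  · exact .eqFn_symm h

theorem Prov.eqE_trans {s : Srt} {a b c : Expr R s} (h : Prov T Γ (eqE s a b))
    (h' : Prov T Γ (eqE s b c)) : Prov T Γ (eqE s a c) := by
  cases s
  · exact .eq_trans h h'
  · exact .eqFn_trans h h'

theorem Expr.lam_shift_inst (t : Expr R .num) :
    (t.ren (liftRen .num (shiftRen .num))).inst .num (nv 0) = t := by
  rw [Expr.inst, Expr.sub_ren]
  conv_rhs => rw [← Expr.sub_var t]
  congr 1
  funext s n; cases s <;> cases n <;> rfl

theorem Prov.lam_shift_app (t : Expr R .num) :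
    Prov T Γ (.eq (.app ((Expr.lam t).shift .num) (nv 0)) t) := by
  have := Prov.lam_conv (T := T) (Γ := Γ) (t.ren (liftRen .num (shiftRen .num))) (nv 0)
  rwa [Expr.lam_shift_inst] at this

theorem Prov.lam_congr {t t' : Expr R .num} (h : Prov T (Γ.map (Fml.shift .num)) (.eq t t')) :
    Prov T Γ (eqFn (.lam t) (.lam t')) :=
  .eqFn_intro ((Prov.lam_shift_app t).eq_trans (h.eq_trans (Prov.lam_shift_app t').eq_symm))

/-- Induction for a formula in an environment. -/
theorem Prov.ind_sub (A : Fml R) (σ : Subst R) (e : Expr R .num)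
    (h0 : Prov T Γ (A.sub (scons .num .zero σ)))
    (hs : Prov T (A.sub (scons .num (nv 0) (σ.shift .num)) :: Γ.map (Fml.shift .num))
      (A.sub (scons .num (succ (nv 0)) (σ.shift .num)))) :
    Prov T Γ (A.sub (scons .num e σ)) := by
  obtain ⟨r, hr⟩ := hT.base
  have h := Prov.ax (Γ := Γ) (hr _ (.ind (A.sub (liftSub .num σ))))
  have h₁ := Prov.allE e (Prov.impE h (.andI ?_ (.allI (.impI ?_))))
  · rwa [Fml.sub_lift_inst] at h₁
  · rwa [Fml.sub_lift_inst]
  · rw [Fml.sub_sub, liftSub_eq]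
    refine Eq.subst (motive := fun τ => Prov T _ (A.sub τ)) ?_ hs
    funext s n; cases s <;> cases n <;>
      simp only [scons, Subst.shift, Expr.shift, Expr.sub_ren]
    · rfl
    all_goals
      rw [Expr.ren_eq_sub]
      congr 1
      funext s n; cases s <;> rfl

/-- The terms up to provable equality from the assumptions `Γ`. Arithmetic inside the system becomes
algebra in this quotient, which turns out to be an ordered commutative semiring. -/
def Q.setoid (T : Set (Fml R)) [IsArith T] (Γ : List (Fml R)) : Setoid (Expr R .num) where
  r a b := Prov T Γ (.eq a b)
  iseqv := ⟨fun a => .eq_refl a, fun h => h.eq_symm, fun h h' => h.eq_trans h'⟩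

/-- The quotient by provable equality. -/
def Q (T : Set (Fml R)) [IsArith T] (Γ : List (Fml R)) : Type := Quotient (Q.setoid T Γ)

/-- The class of a term. -/
def mk (a : Expr R .num) : Q T Γ := Quotient.mk (Q.setoid T Γ) a

theorem mk_eq {a b : Expr R .num} : (mk a : Q T Γ) = mk b ↔ Prov T Γ (.eq a b) :=
  ⟨fun h => Quotient.exact (s := Q.setoid T Γ) h, fun h => Quotient.sound (s := Q.setoid T Γ) h⟩

/-- The operation of a two-place constant. -/
def Q.bin (f : BinConst) : Q T Γ → Q T Γ → Q T Γ :=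
  Quotient.map₂ (.bin f) (fun _ _ h _ _ h' => Prov.bin_congr f h h')

/-- The operation of a functor. -/
def Q.app (u : Expr R .fn) : Q T Γ → Q T Γ :=
  Quotient.map (.app u) (fun _ _ h => Prov.app_congr_arg u h)

instance : Zero (Q T Γ) := ⟨mk .zero⟩
instance : One (Q T Γ) := ⟨mk (succ .zero)⟩
instance : Add (Q T Γ) := ⟨Q.bin .add⟩
instance : Mul (Q T Γ) := ⟨Q.bin .mul⟩
instance : Sub (Q T Γ) := ⟨Q.bin .monus⟩

theorem mk_zero : (mk .zero : Q T Γ) = 0 := rfl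
theorem mk_add (a b : Expr R .num) : (mk (add a b) : Q T Γ) = mk a + mk b := rfl
theorem mk_mul (a b : Expr R .num) : (mk (mul a b) : Q T Γ) = mk a * mk b := rfl
theorem mk_monus (a b : Expr R .num) : (mk (monus a b) : Q T Γ) = mk a - mk b := rfl
theorem mk_app (u : Expr R .fn) (a : Expr R .num) : (mk (.app u a) : Q T Γ) = Q.app u (mk a) := rfl
theorem mk_pd (a : Expr R .num) : (mk (pd a) : Q T Γ) = Q.app (.un .pd) (mk a) := rfl

theorem mk_add_zero (a : Expr R .num) : (mk a + 0 : Q T Γ) = mk a :=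
  mk_eq.2 (Prov.ax_inst (fun r => IA₁.add_zero (r := r)) a a a idleFn)

theorem mk_add_succ (a b : Expr R .num) : (mk a + mk (succ b) : Q T Γ) = mk (succ (add a b)) :=
  mk_eq.2 (Prov.ax_inst (fun r => IA₁.add_succ (r := r)) a b a idleFn)

theorem mk_succ_congr {a b : Expr R .num} (h : (mk a : Q T Γ) = mk b) :
    (mk (succ a) : Q T Γ) = mk (succ b) :=
  mk_eq.2 (.app_congr_arg _ (mk_eq.1 h))

theorem mk_succ (a : Expr R .num) : (mk (succ a) : Q T Γ) = mk a + 1 := by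
  change _ = mk a + mk (succ .zero)
  rw [mk_add_succ]
  exact mk_succ_congr (mk_add_zero a).symm

/-- Induction for an equation in an environment. -/
theorem mk_ind (t t' : Expr R .num) (σ : Subst R) (e : Expr R .num)
    (h0 : (mk (t.sub (scons .num .zero σ)) : Q T Γ) = mk (t'.sub (scons .num .zero σ)))
    (hs : ∀ Δ : List (Fml R), Γ.map (Fml.shift .num) ⊆ Δ →
      (mk (t.sub (scons .num (nv 0) (σ.shift .num))) : Q T Δ) =
        mk (t'.sub (scons .num (nv 0) (σ.shift .num))) →
      (mk (t.sub (scons .num (succ (nv 0)) (σ.shift .num))) : Q T Δ) =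
        mk (t'.sub (scons .num (succ (nv 0)) (σ.shift .num)))) :
    (mk (t.sub (scons .num e σ)) : Q T Γ) = mk (t'.sub (scons .num e σ)) :=
  mk_eq.2 (Prov.ind_sub (.eq t t') σ e (mk_eq.1 h0)
    (mk_eq.1 (hs _ (List.subset_cons_self _ _) (mk_eq.2 (.hyp List.mem_cons_self)))))

theorem Q.ind {motive : Q T Γ → Prop} (h : ∀ a, motive (mk a)) (x : Q T Γ) : motive x :=
  Quotient.ind h x

theorem Q.add_succ (x y : Q T Γ) : x + (y + 1) = x + y + 1 := by
  induction x using Q.ind with | _ a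
  induction y using Q.ind with | _ b
  rw [← mk_succ, mk_add_succ, mk_succ, mk_add]

theorem Q.add_zero (x : Q T Γ) : x + 0 = x := by
  induction x using Q.ind with | _ a
  exact mk_add_zero a

theorem Q.zero_add (x : Q T Γ) : 0 + x = x := by
  induction x using Q.ind with | _ a
  refine mk_ind (add .zero (nv 0)) (nv 0) Expr.var a (mk_add_zero _) fun Δ _ h => ?_
  simp only [add_sub, nv_sub, zero_sub, scons_num_zero, mk_add, mk_succ, mk_zero] at h ⊢
  rw [Q.add_succ, h]

theorem Q.succ_add (x y : Q T Γ) : x + 1 + y = x + y + 1 := by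
  induction x using Q.ind with | _ a
  induction y using Q.ind with | _ b
  rw [← mk_succ, ← mk_add a b, ← mk_succ]
  refine mk_ind (add (succ (nv 1)) (nv 0)) (succ (add (nv 1) (nv 0))) (scons .num a Expr.var) b
    ?_ fun Δ _ h => ?_
  · simp [mk_add, mk_succ, mk_zero, Q.add_zero]
  · simp [mk_add, mk_succ, Q.add_succ] at h ⊢
    rw [h]

theorem Q.add_comm (x y : Q T Γ) : x + y = y + x := by
  induction x using Q.ind with | _ a
  induction y using Q.ind with | _ b
  refine mk_ind (add (nv 1) (nv 0)) (add (nv 0) (nv 1)) (scons .num a Expr.var) b ?_ fun Δ _ h => ?_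
  · simp [mk_add, mk_zero, Q.add_zero, Q.zero_add]
  · simp [mk_add, mk_succ, Q.add_succ, Q.succ_add] at h ⊢
    rw [h]

theorem Q.add_assoc (x y z : Q T Γ) : x + y + z = x + (y + z) := by
  induction x using Q.ind with | _ a
  induction y using Q.ind with | _ b
  induction z using Q.ind with | _ c
  refine mk_ind (add (add (nv 1) (nv 2)) (nv 0)) (add (nv 1) (add (nv 2) (nv 0)))
    (scons .num a (scons .num b Expr.var)) c ?_ fun Δ _ h => ?_
  · simp [mk_add, mk_zero, Q.add_zero]
  · simp [mk_add, mk_succ, Q.add_succ] at h ⊢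
    rw [h]

instance : AddCommMonoid (Q T Γ) where
  add_assoc := Q.add_assoc
  zero_add := Q.zero_add
  add_zero := Q.add_zero
  add_comm := Q.add_comm
  nsmul := nsmulRec

theorem Q.mul_zero (x : Q T Γ) : x * 0 = 0 := by
  induction x using Q.ind with | _ a
  exact mk_eq.2 (Prov.ax_inst (fun r => IA₁.mul_zero (r := r)) a a a idleFn)

theorem Q.mul_succ (x y : Q T Γ) : x * (y + 1) = x * y + x := by
  induction x using Q.ind with | _ a
  induction y using Q.ind with | _ b
  rw [← mk_succ]
  exact mk_eq.2 (Prov.ax_inst (fun r => IA₁.mul_succ (r := r)) a b a idleFn)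

theorem Q.zero_mul (x : Q T Γ) : 0 * x = 0 := by
  induction x using Q.ind with | _ a
  refine mk_ind (mul .zero (nv 0)) .zero Expr.var a ?_ fun Δ _ h => ?_
  · simp [mk_mul, mk_zero, Q.mul_zero]
  · simp [mk_mul, mk_succ, mk_zero, Q.mul_succ] at h ⊢
    exact h

theorem Q.succ_mul (x y : Q T Γ) : (x + 1) * y = x * y + y := by
  induction x using Q.ind with | _ a
  induction y using Q.ind with | _ b
  rw [← mk_succ]
  refine mk_ind (mul (succ (nv 1)) (nv 0)) (add (mul (nv 1) (nv 0)) (nv 0))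
    (scons .num a Expr.var) b ?_ fun Δ _ h => ?_
  · simp [mk_add, mk_mul, mk_zero, Q.mul_zero]
  · simp [mk_add, mk_mul, mk_succ, Q.mul_succ] at h ⊢
    rw [h]; abel

theorem Q.mul_comm (x y : Q T Γ) : x * y = y * x := by
  induction x using Q.ind with | _ a
  induction y using Q.ind with | _ b
  refine mk_ind (mul (nv 1) (nv 0)) (mul (nv 0) (nv 1)) (scons .num a Expr.var) b ?_ fun Δ _ h => ?_
  · simp [mk_mul, mk_zero, Q.mul_zero, Q.zero_mul]
  · simp [mk_mul, mk_succ, Q.mul_succ, Q.succ_mul] at h ⊢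
    rw [h]

theorem Q.mul_add (x y z : Q T Γ) : x * (y + z) = x * y + x * z := by
  induction x using Q.ind with | _ a
  induction y using Q.ind with | _ b
  induction z using Q.ind with | _ c
  refine mk_ind (mul (nv 1) (add (nv 2) (nv 0))) (add (mul (nv 1) (nv 2)) (mul (nv 1) (nv 0)))
    (scons .num a (scons .num b Expr.var)) c ?_ fun Δ _ h => ?_
  · simp [mk_add, mk_mul, mk_zero, Q.mul_zero]
  · simp [mk_add, mk_mul, mk_succ, Q.add_succ, Q.mul_succ] at h ⊢
    rw [h]; abel

theorem Q.mul_one (x : Q T Γ) : x * 1 = x := by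
  rw [← Q.zero_add 1, Q.mul_succ, Q.mul_zero, Q.zero_add]

theorem Q.mul_assoc (x y z : Q T Γ) : x * y * z = x * (y * z) := by
  induction x using Q.ind with | _ a
  induction y using Q.ind with | _ b
  induction z using Q.ind with | _ c
  refine mk_ind (mul (mul (nv 1) (nv 2)) (nv 0)) (mul (nv 1) (mul (nv 2) (nv 0)))
    (scons .num a (scons .num b Expr.var)) c ?_ fun Δ _ h => ?_
  · simp [mk_mul, mk_zero, Q.mul_zero]
  · simp [mk_mul, mk_succ, Q.mul_add, Q.mul_one] at h ⊢
    rw [h]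

instance : CommSemiring (Q T Γ) where
  mul_assoc := Q.mul_assoc
  zero_mul := Q.zero_mul
  mul_zero := Q.mul_zero
  mul_one := Q.mul_one
  one_mul x := by rw [Q.mul_comm, Q.mul_one]
  left_distrib := Q.mul_add
  right_distrib x y z := by rw [Q.mul_comm, Q.mul_add, Q.mul_comm z x, Q.mul_comm z y]
  mul_comm := Q.mul_comm

end

/-! ### Order -/

section
variable {T : Set (Fml R)} [hT : IsArith T] {Γ : List (Fml R)}

theorem Q.pd_zero : Q.app (.un .pd) (0 : Q T Γ) = 0 :=
  mk_eq.2 (Prov.ax_inst (fun r => IA₁.pd_zero (r := r)) .zero .zero .zero idleFn)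

theorem Q.pd_succ (x : Q T Γ) : Q.app (.un .pd) (x + 1) = x := by
  induction x using Q.ind with | _ a
  rw [← mk_succ]
  exact mk_eq.2 (Prov.ax_inst (fun r => IA₁.pd_succ (r := r)) a a a idleFn)

theorem Q.sub_zero (x : Q T Γ) : x - 0 = x := by
  induction x using Q.ind with | _ a
  exact mk_eq.2 (Prov.ax_inst (fun r => IA₁.monus_zero (r := r)) a a a idleFn)

theorem Q.sub_succ (x y : Q T Γ) : x - (y + 1) = Q.app (.un .pd) (x - y) := by
  induction x using Q.ind with | _ a
  induction y using Q.ind with | _ b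
  rw [← mk_succ]
  exact mk_eq.2 (Prov.ax_inst (fun r => IA₁.monus_succ (r := r)) a b a idleFn)

theorem Q.zero_sub (x : Q T Γ) : 0 - x = 0 := by
  induction x using Q.ind with | _ a
  refine mk_ind (monus .zero (nv 0)) .zero Expr.var a ?_ fun Δ _ h => ?_
  · simp [mk_monus, mk_zero, Q.sub_zero]
  · simp [mk_monus, mk_succ, mk_zero, Q.sub_succ] at h ⊢
    rw [h, Q.pd_zero]

theorem Q.succ_sub_succ (x y : Q T Γ) : x + 1 - (y + 1) = x - y := by
  induction x using Q.ind with | _ a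
  induction y using Q.ind with | _ b
  rw [← mk_succ, ← mk_succ]
  refine mk_ind (monus (succ (nv 1)) (succ (nv 0))) (monus (nv 1) (nv 0)) (scons .num a Expr.var) b
    ?_ fun Δ _ h => ?_
  · simp only [monus_sub, succ_sub, nv_sub, scons_num_zero, scons_num_one, mk_monus, mk_succ, mk_zero]
    rw [Q.sub_succ, Q.sub_zero, Q.pd_succ, Q.sub_zero]
  · simp [mk_monus, mk_succ] at h ⊢
    rw [Q.sub_succ, h, Q.sub_succ]

theorem Q.sub_self (x : Q T Γ) : x - x = 0 := by
  induction x using Q.ind with | _ a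
  refine mk_ind (monus (nv 0) (nv 0)) .zero Expr.var a ?_ fun Δ _ h => ?_
  · simp [mk_monus, mk_zero, Q.sub_zero]
  · simp [mk_monus, mk_succ, mk_zero, Q.succ_sub_succ] at h ⊢
    exact h

theorem Q.add_sub_right (x y : Q T Γ) : x + y - y = x := by
  induction x using Q.ind with | _ a
  induction y using Q.ind with | _ b
  refine mk_ind (monus (add (nv 1) (nv 0)) (nv 0)) (nv 1) (scons .num a Expr.var) b
    ?_ fun Δ _ h => ?_
  · simp [mk_monus, mk_add, mk_zero, Q.sub_zero]
  · simp [mk_monus, mk_add, mk_succ, Q.add_succ, Q.succ_sub_succ] at h ⊢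
    exact h

theorem Q.sub_add (x y z : Q T Γ) : x - (y + z) = x - y - z := by
  induction x using Q.ind with | _ a
  induction y using Q.ind with | _ b
  induction z using Q.ind with | _ c
  refine mk_ind (monus (nv 1) (add (nv 2) (nv 0))) (monus (monus (nv 1) (nv 2)) (nv 0))
    (scons .num a (scons .num b Expr.var)) c ?_ fun Δ _ h => ?_
  · simp [mk_monus, mk_add, mk_zero, Q.sub_zero]
  · simp [mk_monus, mk_add, mk_succ, Q.add_succ, Q.sub_succ] at h ⊢
    rw [h]

/-- A distinction of cases between `0` and a successor. -/
theorem Prov.cases_pd (b : Expr R .num) {C : Fml R}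
    (h0 : ∀ Δ : List (Fml R), Γ ⊆ Δ → (mk b : Q T Δ) = 0 → Prov T Δ C)
    (hs : ∀ Δ : List (Fml R), Γ ⊆ Δ → (mk b : Q T Δ) = mk (pd b) + 1 → Prov T Δ C) :
    Prov T Γ C := by
  have h : Prov T Γ (.or (.eq b .zero) (.eq b (succ (pd b)))) := by
    refine Prov.ind_sub (.or (.eq (nv 0) .zero) (.eq (nv 0) (succ (pd (nv 0))))) Expr.var b
      (.orI₁ (.eq_refl _)) (.orI₂ (mk_eq.1 ?_))
    simp only [nv_sub, scons_num_zero, succ_sub, pd_sub, mk_succ, mk_pd, Q.pd_succ]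
  refine .orE h (h0 _ (List.subset_cons_self _ _) ?_) (hs _ (List.subset_cons_self _ _) ?_)
  · exact mk_eq.2 (.hyp List.mem_cons_self)
  · rw [← mk_succ]; exact mk_eq.2 (.hyp List.mem_cons_self)

/-- Both sides are the maximum. The outer induction is on `x`, for all `y`; on `y` there is
only a distinction of cases. -/
theorem Q.add_sub_comm (x y : Q T Γ) : x + (y - x) = y + (x - y) := by
  induction x using Q.ind with | _ a
  induction y using Q.ind with | _ b
  let F : Fml R := .eq (add (nv 1) (monus (nv 0) (nv 1))) (add (nv 0) (monus (nv 1) (nv 0)))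
  have h := Prov.ind_sub (T := T) (Γ := Γ) (.all .num F) Expr.var a (Prov.allI_sub ?_)
    (Prov.allI_sub ?_)
  · have := h.allE_sub b
    simpa [F, mk_monus, mk_add] using mk_eq.2 this
  · refine mk_eq.1 ?_
    simp [mk_monus, mk_add, mk_zero, Q.zero_sub, Q.sub_zero]
  · refine Prov.cases_pd (nv 0) (fun Δ _ h => mk_eq.1 ?_) fun Δ hΔ h => mk_eq.1 ?_
    · simp [mk_monus, mk_add, h, Q.zero_sub, Q.sub_zero]
    · have hyp : Prov T Δ ((Fml.all .num F).sub (scons .num (nv 1) (Subst.shift .num Expr.var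
          |>.shift .num))) := by
        refine (Prov.hyp ?_).mono hΔ
        rw [← nv_shift_num, ← scons_shift, ← Fml.sub_shift]
        exact List.mem_map_of_mem List.mem_cons_self
      have := mk_eq.2 (hyp.allE_sub (pd (nv 0)))
      simp [mk_monus, mk_add, mk_succ, h, Q.succ_sub_succ] at this ⊢
      rw [Q.succ_add, this, Q.succ_add]

instance : PartialOrder (Q T Γ) where
  le x y := x - y = 0
  le_refl := Q.sub_self
  le_antisymm x y (h : x - y = 0) (h' : y - x = 0) := by
    have := Q.add_sub_comm x y
    rwa [h, h', add_zero, add_zero] at this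
  le_trans x y z (h : x - y = 0) (h' : y - z = 0) := by
    have h₁ := Q.add_sub_comm x y
    have h₂ := Q.add_sub_comm y z
    rw [h, add_zero] at h₁
    rw [h', add_zero] at h₂
    rw [← h₂, ← h₁, add_assoc, Q.sub_add, Q.sub_self, Q.zero_sub]

theorem Q.le_iff {x y : Q T Γ} : x ≤ y ↔ x - y = 0 := Iff.rfl

theorem Q.le_add (x y : Q T Γ) : x ≤ x + y := by
  rw [Q.le_iff, Q.sub_add, Q.sub_self, Q.zero_sub]

theorem Q.add_sub_of_le {x y : Q T Γ} (h : x ≤ y) : x + (y - x) = y := by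
  rw [Q.add_sub_comm, Q.le_iff.1 h, add_zero]

instance : IsOrderedAddMonoid (Q T Γ) where
  add_le_add_left x y h z := by
    rw [← Q.add_sub_of_le h, add_right_comm]
    exact Q.le_add _ _

instance : CanonicallyOrderedAdd (Q T Γ) where
  exists_add_of_le h := ⟨_, (Q.add_sub_of_le h).symm⟩
  le_add_self x y := by rw [add_comm]; exact Q.le_add _ _
  le_self_add := Q.le_add

instance : OrderedSub (Q T Γ) where
  tsub_le_iff_right x y z := by
    rw [Q.le_iff, Q.le_iff, add_comm, Q.sub_add]

instance : IsCancelAdd (Q T Γ) where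
  add_left_cancel x y z (h : x + y = x + z) := by
    rw [← Q.add_sub_right y x, add_comm y, h, add_comm, Q.add_sub_right]
  add_right_cancel x y z (h : y + x = z + x) := by
    rw [← Q.add_sub_right y x, h, Q.add_sub_right]

instance : IsOrderedCancelAddMonoid (Q T Γ) where
  le_of_add_le_add_left x y z h := by
    have h' := Q.add_sub_of_le h
    rw [add_assoc] at h'
    rw [← add_left_cancel h']
    exact Q.le_add _ _

instance : IsOrderedRing (Q T Γ) :=
  { (inferInstance : IsOrderedAddMonoid (Q T Γ)) with
    zero_le_one := _root_.zero_le
    mul_le_mul_of_nonneg_left := fun x _ y z h => by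
      rw [← Q.add_sub_of_le h, mul_add]
      exact Q.le_add _ _
    mul_le_mul_of_nonneg_right := fun x _ y z h => by
      rw [← Q.add_sub_of_le h, add_mul]
      exact Q.le_add _ _ }

theorem mk_mono {Δ : List (Fml R)} (h : Γ ⊆ Δ) {a b : Expr R .num}
    (h' : (mk a : Q T Γ) = mk b) : (mk a : Q T Δ) = mk b :=
  mk_eq.2 ((mk_eq.1 h').mono h)

/-- The formula `a ≤ b`. -/
def leF (a b : Expr R .num) : Fml R := .eq (monus a b) .zero

@[simp] theorem leF_sub (a b : Expr R .num) (σ : Subst R) :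
    (leF a b).sub σ = leF (a.sub σ) (b.sub σ) := rfl

theorem mk_le {a b : Expr R .num} : (mk a : Q T Γ) ≤ mk b ↔ Prov T Γ (leF a b) := by
  rw [Q.le_iff]; exact mk_eq (b := .zero)

theorem Prov.le_or_lt (a b : Expr R .num) : Prov T Γ (.or (leF a b) (leF (succ b) a)) := by
  refine Prov.ind_sub (.or (leF (nv 0) (nv 1)) (leF (succ (nv 1)) (nv 0))) (scons .num b Expr.var) a
    (.orI₁ (mk_le.1 ?_)) (.orE (.hyp List.mem_cons_self) (.assume fun Δ _ h => ?_)
      (.assume fun Δ _ h => .orI₂ (mk_le.1 ?_)))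
  · exact _root_.zero_le
  · replace h : (mk (nv 0) : Q T Δ) ≤ mk (b.shift .num) := mk_le.2 h
    refine Prov.cases_pd (monus (b.shift .num) (nv 0)) (fun Δ' hΔ' h' => .orI₂ (mk_le.1 ?_))
      (fun Δ' hΔ' h' => .orI₁ (mk_le.1 ?_))
    · simp only [succ_sub, nv_sub, scons_num_zero, scons_num_one, Subst.shift_apply, mk_succ]
      rw [mk_monus, ← Q.le_iff] at h'
      gcongr
    · simp only [nv_sub, scons_num_zero, scons_num_one, Subst.shift_apply, mk_succ]
      have h₂ : (mk (nv 0) : Q T Δ') ≤ mk (b.shift .num) := mk_le.2 ((mk_le.1 h).mono hΔ')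
      rw [← Q.add_sub_of_le h₂, ← mk_monus, h']
      gcongr
      exact le_add_self
  · replace h : (mk (succ (b.shift .num)) : Q T Δ) ≤ mk (nv 0) := mk_le.2 h
    exact (h.trans le_self_add).trans_eq (mk_succ _).symm

/-- A distinction of cases according to the order. -/
theorem Prov.cases_le (a b : Expr R .num) {C : Fml R}
    (h : ∀ Δ : List (Fml R), Γ ⊆ Δ → (mk a : Q T Δ) ≤ mk b → Prov T Δ C)
    (h' : ∀ Δ : List (Fml R), Γ ⊆ Δ → (mk b + 1 : Q T Δ) ≤ mk a → Prov T Δ C) :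
    Prov T Γ C := by
  refine .orE (.le_or_lt a b) (h _ (List.subset_cons_self _ _) (mk_le.2 (.hyp List.mem_cons_self)))
    (h' _ (List.subset_cons_self _ _) ?_)
  rw [← mk_succ]
  exact mk_le.2 (.hyp List.mem_cons_self)

theorem mk_le_mono {Δ : List (Fml R)} (h : Γ ⊆ Δ) {a b : Expr R .num}
    (h' : (mk a : Q T Γ) ≤ mk b) : (mk a : Q T Δ) ≤ mk b :=
  mk_le.2 ((mk_le.1 h').mono h)

/-- Weakening by a variable, for equations. -/
theorem mk_shift (s : Srt) {a b : Expr R .num} (h : (mk a : Q T Γ) = mk b) :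
    (mk (a.shift s) : Q T (Γ.map (Fml.shift s))) = mk (b.shift s) :=
  mk_eq.2 ((mk_eq.1 h).shift s)

theorem mk_le_shift (s : Srt) {a b : Expr R .num} (h : (mk a : Q T Γ) ≤ mk b) :
    (mk (a.shift s) : Q T (Γ.map (Fml.shift s))) ≤ mk (b.shift s) :=
  mk_le.2 ((mk_le.1 h).shift s)

/-- Induction up to a bound `N`, for an equation in an environment. -/
theorem mk_ind_le (t t' : Expr R .num) (σ : Subst R) (e N : Expr R .num)
    (h0 : (mk (t.sub (scons .num .zero σ)) : Q T Γ) = mk (t'.sub (scons .num .zero σ)))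
    (hs : ∀ Δ : List (Fml R), Γ.map (Fml.shift .num) ⊆ Δ →
      (mk (nv 0) + 1 : Q T Δ) ≤ mk ((N.sub σ).shift .num) →
      (mk (t.sub (scons .num (nv 0) (σ.shift .num))) : Q T Δ) =
        mk (t'.sub (scons .num (nv 0) (σ.shift .num))) →
      (mk (t.sub (scons .num (succ (nv 0)) (σ.shift .num))) : Q T Δ) =
        mk (t'.sub (scons .num (succ (nv 0)) (σ.shift .num))))
    (hle : (mk e : Q T Γ) ≤ mk (N.sub σ)) :
    (mk (t.sub (scons .num e σ)) : Q T Γ) = mk (t'.sub (scons .num e σ)) := by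
  have key := Prov.ind_sub (T := T) (Γ := Γ) (.imp (leF (nv 0) (N.shift .num)) (.eq t t')) σ e
    (.impI ((mk_eq.1 h0).weaken))
    (.assume fun Δ hΔ ih => .impI (.assume fun Δ' hΔ' h => mk_eq.1 (hs _ (List.Subset.trans hΔ hΔ') ?_ ?_)))
  · refine mk_eq.2 (.impE key ?_)
    simpa [Expr.shift_sub] using mk_le.1 hle
  all_goals
    simp only [leF_sub, Fml.sub, nv_sub, scons_num_zero, Expr.shift_sub,
      ← Expr.sub_shift] at h ih
    replace h := mk_le.2 h
    rw [mk_succ] at h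
  · exact h
  · exact mk_eq.2 (.impE (ih.mono hΔ') (mk_le.1 (le_self_add.trans h)))

end

/-! ### Elementary functions -/

section
variable {T : Set (Fml R)} [hT : IsArith T] {Γ : List (Fml R)}

theorem mk_sg (a : Expr R .num) : (mk (sg a) : Q T Γ) = Q.app (.un .sg) (mk a) := rfl
theorem mk_sgbar (a : Expr R .num) : (mk (sgbar a) : Q T Γ) = Q.app (.un .sgbar) (mk a) := rfl
theorem mk_exp (a b : Expr R .num) : (mk (exp a b) : Q T Γ) = Q.bin .exp (mk a) (mk b) := rfl
theorem mk_rm (a b : Expr R .num) : (mk (rm a b) : Q T Γ) = Q.bin .rm (mk a) (mk b) := rfl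
theorem mk_quot (a b : Expr R .num) : (mk (quot a b) : Q T Γ) = Q.bin .quot (mk a) (mk b) := rfl

theorem Q.sg_zero : Q.app (.un .sg) (0 : Q T Γ) = 0 :=
  mk_eq.2 (Prov.ax_inst (fun r => IA₁.sg_zero (r := r)) .zero .zero .zero idleFn)

theorem Q.sg_succ (x : Q T Γ) : Q.app (.un .sg) (x + 1) = 1 := by
  induction x using Q.ind with | _ a
  rw [← mk_succ]
  exact mk_eq.2 (Prov.ax_inst (fun r => IA₁.sg_succ (r := r)) a a a idleFn)

theorem Q.sgbar_zero : Q.app (.un .sgbar) (0 : Q T Γ) = 1 :=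
  mk_eq.2 (Prov.ax_inst (fun r => IA₁.sgbar_zero (r := r)) .zero .zero .zero idleFn)

theorem Q.sgbar_succ (x : Q T Γ) : Q.app (.un .sgbar) (x + 1) = 0 := by
  induction x using Q.ind with | _ a
  rw [← mk_succ]
  exact mk_eq.2 (Prov.ax_inst (fun r => IA₁.sgbar_succ (r := r)) a a a idleFn)

theorem mk_dist (a b : Expr R .num) :
    (mk (dist a b) : Q T Γ) = (mk a - mk b) + (mk b - mk a) :=
  mk_eq.2 (Prov.ax_inst (fun r => IA₁.dist_def (r := r)) a b b idleFn)

theorem mk_dist_eq_zero {a b : Expr R .num} : (mk (dist a b) : Q T Γ) = 0 ↔ mk a = (mk b : Q T Γ) := by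
  rw [mk_dist]
  constructor
  · intro h
    obtain ⟨h₁, h₂⟩ := add_eq_zero.1 h
    exact le_antisymm (Q.le_iff.2 h₁) (Q.le_iff.2 h₂)
  · intro h
    rw [h, tsub_self, add_zero]

theorem Q.exp_zero (x : Q T Γ) : Q.bin .exp x 0 = 1 := by
  induction x using Q.ind with | _ a
  exact mk_eq.2 (Prov.ax_inst (fun r => IA₁.exp_zero (r := r)) a a a idleFn)

theorem Q.exp_succ (x y : Q T Γ) : Q.bin .exp x (y + 1) = Q.bin .exp x y * x := by
  induction x using Q.ind with | _ a
  induction y using Q.ind with | _ b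
  rw [← mk_succ]
  exact mk_eq.2 (Prov.ax_inst (fun r => IA₁.exp_succ (r := r)) a b b idleFn)

theorem Q.exp_add (x y z : Q T Γ) : Q.bin .exp x (y + z) = Q.bin .exp x y * Q.bin .exp x z := by
  induction x using Q.ind with | _ a
  induction y using Q.ind with | _ b
  induction z using Q.ind with | _ c
  refine mk_ind (exp (nv 1) (add (nv 2) (nv 0))) (mul (exp (nv 1) (nv 2)) (exp (nv 1) (nv 0)))
    (scons .num a (scons .num b Expr.var)) c ?_ fun Δ _ h => ?_
  · simp [mk_exp, mk_add, mk_mul, mk_zero, Q.exp_zero]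
  · simp [mk_exp, mk_add, mk_mul, mk_succ, ← add_assoc, Q.exp_succ] at h ⊢
    rw [h, mul_assoc]

theorem Q.one_le_exp (x y : Q T Γ) : 1 ≤ Q.bin .exp (x + 1) y := by
  induction x using Q.ind with | _ a
  induction y using Q.ind with | _ b
  rw [← mk_succ]
  refine mk_le.2 (Prov.ind_sub (leF (succ .zero) (exp (succ (nv 1)) (nv 0))) (scons .num a Expr.var) b
    (mk_le.1 ?_) (.assume fun Δ _ h => mk_le.1 ?_))
  · simp [mk_exp, mk_succ, mk_zero, Q.exp_zero]
  · replace h := mk_le.2 h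
    simp [mk_exp, mk_succ, mk_zero, Q.exp_succ, mul_add] at h ⊢
    exact h.trans le_add_self

/-! ### Division with remainder

All divisors are successors. -/

theorem Q.rm_zero (x : Q T Γ) : Q.bin .rm 0 x = 0 := by
  induction x using Q.ind with | _ a
  exact mk_eq.2 (Prov.ax_inst (fun r => IA₁.rm_zero (r := r)) a a a idleFn)

theorem mk_rm_succ (a b : Expr R .num) : (mk (rm (succ a) b) : Q T Γ) =
    (mk (rm a b) + 1) * Q.app (.un .sg) (mk (dist b (succ (rm a b)))) := by
  rw [← mk_succ]
  exact mk_eq.2 (Prov.ax_inst (fun r => IA₁.rm_succ (r := r)) a b b idleFn)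

theorem Q.quot_zero (x : Q T Γ) : Q.bin .quot 0 x = 0 := by
  induction x using Q.ind with | _ a
  exact mk_eq.2 (Prov.ax_inst (fun r => IA₁.quot_zero (r := r)) a a a idleFn)

theorem mk_quot_succ (a b : Expr R .num) : (mk (quot (succ a) b) : Q T Γ) =
    mk (quot a b) + Q.app (.un .sgbar) (mk (dist b (succ (rm a b)))) :=
  mk_eq.2 (Prov.ax_inst (fun r => IA₁.quot_succ (r := r)) a b b idleFn)

/-- Below the divisor, the distance in the recursion equations does not vanish. -/
theorem mk_dist_of_lt {a m b : Expr R .num} (h : (mk a + 1 : Q T Γ) ≤ mk m)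
    (hb : (mk b : Q T Γ) = mk a) : ∃ k, (mk (dist (succ m) (succ b)) : Q T Γ) = k + 1 := by
  obtain ⟨k, hk⟩ := exists_add_of_le h
  refine ⟨k, ?_⟩
  rw [mk_dist, mk_succ, mk_succ, hb, hk]
  have h₁ : (mk a + 1 + k + 1 : Q T Γ) = (k + 1) + (mk a + 1) := by ring
  rw [h₁, add_tsub_cancel_right, tsub_eq_zero_of_le le_add_self, add_zero]

theorem mk_rm_of_le {a m : Expr R .num} (h : (mk a : Q T Γ) ≤ mk m) :
    (mk (rm a (succ m)) : Q T Γ) = mk a := by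
  refine mk_ind_le (rm (nv 0) (succ (nv 1))) (nv 0) (scons .num m Expr.var) a (nv 0) ?_ ?_ h
  · simp [mk_rm, mk_zero, Q.rm_zero]
  · intro Δ _ h₁ h₂
    simp at h₁ h₂ ⊢
    rw [mk_rm_succ]
    obtain ⟨k, hk⟩ := mk_dist_of_lt h₁ h₂
    rw [hk, Q.sg_succ, mul_one, h₂, mk_succ]

theorem mk_quot_of_le {a m : Expr R .num} (h : (mk a : Q T Γ) ≤ mk m) :
    (mk (quot a (succ m)) : Q T Γ) = 0 := by
  refine mk_ind_le (quot (nv 0) (succ (nv 1))) .zero (scons .num m Expr.var) a (nv 0) ?_ ?_ h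
  · simp [mk_quot, mk_zero, Q.quot_zero]
  · intro Δ _ h₁ h₂
    simp at h₁ h₂ ⊢
    rw [mk_quot_succ]
    obtain ⟨k, hk⟩ := mk_dist_of_lt h₁ (mk_rm_of_le (le_self_add.trans h₁))
    rw [hk, Q.sgbar_succ, h₂, mk_zero, add_zero]

theorem mk_rm_self (m : Expr R .num) : (mk (rm (succ m) (succ m)) : Q T Γ) = 0 := by
  have h : (mk (succ m) : Q T Γ) = mk (succ (rm m (succ m))) :=
    mk_succ_congr (mk_rm_of_le le_rfl).symm
  rw [mk_rm_succ, mk_dist_eq_zero.2 h, Q.sg_zero, mul_zero]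

theorem mk_quot_self (m : Expr R .num) : (mk (quot (succ m) (succ m)) : Q T Γ) = 1 := by
  have h : (mk (succ m) : Q T Γ) = mk (succ (rm m (succ m))) :=
    mk_succ_congr (mk_rm_of_le le_rfl).symm
  rw [mk_quot_succ, mk_dist_eq_zero.2 h, Q.sgbar_zero, mk_quot_of_le le_rfl, zero_add]

theorem mk_dist_congr {a a' b b' : Expr R .num} (h : (mk a : Q T Γ) = mk a')
    (h' : (mk b : Q T Γ) = mk b') : (mk (dist a b) : Q T Γ) = mk (dist a' b') := by
  rw [mk_dist, mk_dist, h, h']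

theorem mk_rm_add_self (a m : Expr R .num) :
    (mk (rm (add (succ m) a) (succ m)) : Q T Γ) = mk (rm a (succ m)) := by
  refine mk_ind (rm (add (succ (nv 1)) (nv 0)) (succ (nv 1))) (rm (nv 0) (succ (nv 1)))
    (scons .num m Expr.var) a ?_ fun Δ _ h => ?_
  · have := mk_rm_self (T := T) (Γ := Γ) m
    simp [mk_rm, mk_add, mk_zero, Q.rm_zero] at this ⊢
    exact this
  · simp at h ⊢
    have h₁ : (mk (add (succ (m.shift .num)) (succ (nv 0))) : Q T Δ) =
        mk (succ (add (succ (m.shift .num)) (nv 0))) := by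
      simp only [mk_add, mk_succ]; ring
    rw [mk_rm, h₁, ← mk_rm, mk_rm_succ, mk_rm_succ, h, mk_dist_congr rfl (mk_succ_congr h)]

theorem mk_quot_add_self (a m : Expr R .num) :
    (mk (quot (add (succ m) a) (succ m)) : Q T Γ) = mk (quot a (succ m)) + 1 := by
  rw [← mk_succ]
  refine mk_ind (quot (add (succ (nv 1)) (nv 0)) (succ (nv 1))) (succ (quot (nv 0) (succ (nv 1))))
    (scons .num m Expr.var) a ?_ fun Δ _ h => ?_
  · have := mk_quot_self (T := T) (Γ := Γ) m
    simp [mk_quot, mk_succ, mk_add, mk_zero, Q.quot_zero] at this ⊢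
    exact this
  · simp at h ⊢
    have h₁ : (mk (add (succ (m.shift .num)) (succ (nv 0))) : Q T Δ) =
        mk (succ (add (succ (m.shift .num)) (nv 0))) := by
      simp only [mk_add, mk_succ]; ring
    rw [mk_quot, h₁, ← mk_quot, mk_quot_succ, h, mk_succ, mk_succ, mk_quot_succ,
      mk_dist_congr rfl (mk_succ_congr (mk_rm_add_self (nv 0) (m.shift .num)))]
    ring

theorem mk_rm_add_mul (a m k : Expr R .num) :
    (mk (rm (add a (mul (succ m) k)) (succ m)) : Q T Γ) = mk (rm a (succ m)) := by
  refine mk_ind (rm (add (nv 2) (mul (succ (nv 1)) (nv 0))) (succ (nv 1))) (rm (nv 2) (succ (nv 1)))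
    (scons .num m (scons .num a Expr.var)) k ?_ fun Δ _ h => ?_
  · simp [mk_rm, mk_add, mk_mul, mk_zero]
  · simp at h ⊢
    rw [← h]
    conv_rhs => rw [← mk_rm_add_self]
    rw [mk_rm, mk_rm]
    congr 1
    simp only [mk_add, mk_mul, mk_succ]; ring

theorem mk_quot_add_mul (a m k : Expr R .num) :
    (mk (quot (add a (mul (succ m) k)) (succ m)) : Q T Γ) = mk (quot a (succ m)) + mk k := by
  rw [← mk_add]
  refine mk_ind (quot (add (nv 2) (mul (succ (nv 1)) (nv 0))) (succ (nv 1)))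
    (add (quot (nv 2) (succ (nv 1))) (nv 0))
    (scons .num m (scons .num a Expr.var)) k ?_ fun Δ _ h => ?_
  · simp [mk_quot, mk_add, mk_mul, mk_zero]
  · simp at h ⊢
    rw [mk_add, mk_succ, ← add_assoc, ← mk_add, ← h, ← mk_quot_add_self, mk_quot, mk_quot]
    congr 1
    simp only [mk_add, mk_mul, mk_succ]; ring

/-- Division of `a + m·k`, in terms of classes. -/
theorem Q.rm_add_mul {x m : Q T Γ} (hm : 1 ≤ m) (k : Q T Γ) :
    Q.bin .rm (x + m * k) m = Q.bin .rm x m := by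
  obtain ⟨n, rfl⟩ := exists_add_of_le hm
  induction x using Q.ind with | _ a
  induction k using Q.ind with | _ k
  induction n using Q.ind with | _ n
  rw [add_comm 1, ← mk_succ]
  exact mk_rm_add_mul a n k

theorem Q.quot_add_mul {x m : Q T Γ} (hm : 1 ≤ m) (k : Q T Γ) :
    Q.bin .quot (x + m * k) m = Q.bin .quot x m + k := by
  obtain ⟨n, rfl⟩ := exists_add_of_le hm
  induction x using Q.ind with | _ a
  induction k using Q.ind with | _ k
  induction n using Q.ind with | _ n
  rw [add_comm 1, ← mk_succ]
  exact mk_quot_add_mul a n k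

theorem Q.rm_of_lt {x m : Q T Γ} (h : x + 1 ≤ m) : Q.bin .rm x m = x := by
  obtain ⟨n, rfl⟩ := exists_add_of_le (le_add_self.trans h)
  induction x using Q.ind with | _ a
  induction n using Q.ind with | _ n
  rw [add_comm 1] at h ⊢
  rw [← mk_succ n]
  exact mk_rm_of_le (le_of_add_le_add_right h)

theorem Q.quot_of_lt {x m : Q T Γ} (h : x + 1 ≤ m) : Q.bin .quot x m = 0 := by
  obtain ⟨n, rfl⟩ := exists_add_of_le (le_add_self.trans h)
  induction x using Q.ind with | _ a
  induction n using Q.ind with | _ n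
  rw [add_comm 1] at h ⊢
  rw [← mk_succ n]
  exact mk_quot_of_le (le_of_add_le_add_right h)

end

/-! ### Bounded sums -/

section
variable {T : Set (Fml R)} [hT : IsArith T] {Γ : List (Fml R)}

/-- The operation of a functional constant with a fixed functor. -/
def Q.fnl (f : FnlConst) (u : Expr R .fn) : Q T Γ → Q T Γ :=
  Quotient.map (fun a => .fnl f a u) (fun _ _ h => Prov.fnl_congr_arg f u h)

theorem mk_fnl (f : FnlConst) (a : Expr R .num) (u : Expr R .fn) :
    (mk (.fnl f a u) : Q T Γ) = Q.fnl f u (mk a) := rfl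

theorem mk_sum_zero (u : Expr R .fn) : (mk (.fnl .sum .zero u) : Q T Γ) = 0 :=
  mk_eq.2 (Prov.ax_inst (fun r => IA₁.sum_zero (r := r)) .zero .zero .zero u)

theorem mk_sum_succ (a : Expr R .num) (u : Expr R .fn) :
    (mk (.fnl .sum (succ a) u) : Q T Γ) = mk (.fnl .sum a u) + mk (.app u a) :=
  mk_eq.2 (Prov.ax_inst (fun r => IA₁.sum_succ (r := r)) a a a u)

theorem Expr.sub_var_shift {s' : Srt} (s : Srt) (e : Expr R s') :
    e.sub (Subst.shift s Expr.var) = e.shift s := by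
  rw [← Expr.sub_shift, Expr.sub_var]

/-- The value of a functor `λx.t` in a weakened context. -/
theorem mk_lam_shift (t e : Expr R .num) :
    (mk (.app ((Expr.lam t).shift .num) e) : Q T Γ) =
      mk (t.sub (scons .num e (Subst.shift .num Expr.var))) := by
  rw [← Expr.sub_var_shift]
  exact mk_eq.2 (Prov.lam_conv_sub _ _ _)

theorem mk_lam (t e : Expr R .num) :
    (mk (.app (.lam t) e) : Q T Γ) = mk (t.sub (scons .num e Expr.var)) := by
  rw [← instSub_eq]
  exact mk_eq.2 (Prov.lam_conv _ _)

theorem mk_lam_shift_var (t : Expr R .num) :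
    (mk (.app ((Expr.lam t).shift .num) (nv 0)) : Q T Γ) = mk t :=
  mk_eq.2 (Prov.lam_shift_app t)

theorem mk_sum_eq_zero {y : Expr R .num} {u : Expr R .fn}
    (h : ∀ Δ : List (Fml R), Γ.map (Fml.shift .num) ⊆ Δ → (mk (nv 0) + 1 : Q T Δ) ≤ mk (y.shift .num) →
      (mk (.app (u.shift .num) (nv 0)) : Q T Δ) = 0) : (mk (.fnl .sum y u) : Q T Γ) = 0 := by
  refine mk_ind_le (.fnl .sum (nv 0) (fv 0)) .zero (scons .num y (scons .fn u Expr.var)) y (nv 0)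
    (mk_sum_zero _) ?_ le_rfl
  intro Δ hΔ h₁ h₂
  simp at h₁ h₂ ⊢
  rw [mk_sum_succ, h₂, h Δ hΔ h₁, mk_zero, add_zero]

theorem mk_sum_of_one {x n : Expr R .num} {u : Expr R .fn}
    (h : ∀ Δ : List (Fml R), Γ.map (Fml.shift .num) ⊆ Δ → (mk (nv 0) + 1 : Q T Δ) ≤ mk (n.shift .num) →
      (mk (.app (u.shift .num) (nv 0)) : Q T Δ) = 1) (hx : (mk x : Q T Γ) ≤ mk n) :
    (mk (.fnl .sum x u) : Q T Γ) = mk x := by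
  refine mk_ind_le (.fnl .sum (nv 0) (fv 0)) (nv 0) (scons .num n (scons .fn u Expr.var)) x (nv 0)
    (mk_sum_zero _) ?_ hx
  intro Δ hΔ h₁ h₂
  simp at h₁ h₂ ⊢
  rw [mk_sum_succ, h₂, h Δ hΔ h₁, mk_succ]

theorem mk_sum_add_of_zero {n k : Expr R .num} {u : Expr R .fn}
    (h : ∀ Δ : List (Fml R), Γ.map (Fml.shift .num) ⊆ Δ →
      (mk (.app (u.shift .num) (add (n.shift .num) (nv 0))) : Q T Δ) = 0) :
    (mk (.fnl .sum (add n k) u) : Q T Γ) = mk (.fnl .sum n u) := by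
  refine mk_ind (.fnl .sum (add (nv 1) (nv 0)) (fv 0)) (.fnl .sum (nv 1) (fv 0))
    (scons .num n (scons .fn u Expr.var)) k ?_ fun Δ hΔ h₂ => ?_
  · simp [mk_fnl, mk_add, mk_zero]
  · simp at h₂ ⊢
    rw [← h₂, mk_fnl, mk_add, mk_succ, ← add_assoc, ← mk_add, ← mk_succ, ← mk_fnl, mk_sum_succ,
      h Δ hΔ, add_zero]

/-- A value of a functor is at most its sum over a larger bound. -/
theorem mk_app_le_sum {i N : Expr R .num} (u : Expr R .fn) (h : (mk i + 1 : Q T Γ) ≤ mk N) :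
    (mk (.app u i) : Q T Γ) ≤ mk (.fnl .sum N u) := by
  have key : ∀ k : Expr R .num,
      (mk (.app u i) : Q T Γ) ≤ mk (.fnl .sum (add (succ i) k) u) := by
    intro k
    refine mk_le.2 (Prov.ind_sub (leF (.app (fv 0) (nv 1)) (.fnl .sum (add (succ (nv 1)) (nv 0)) (fv 0)))
      (scons .num i (scons .fn u Expr.var)) k (mk_le.1 ?_) (.assume fun Δ _ h => mk_le.1 ?_))
    · simp [mk_fnl .sum (add (succ i) .zero), mk_add, mk_zero]
      rw [← mk_fnl, mk_sum_succ]
      exact le_add_self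
    · replace h := mk_le.2 h
      simp at h ⊢
      rw [mk_fnl, mk_add, mk_succ (nv 0), ← add_assoc, ← mk_add, ← mk_succ, ← mk_fnl, mk_sum_succ]
      exact h.trans le_self_add
  have h₁ := key (monus N (succ i))
  rw [← mk_succ] at h
  rwa [mk_fnl, mk_add, mk_monus, Q.add_sub_of_le h, ← mk_fnl] at h₁

/-! ### Pairing

The pair of `a` and `b` is coded by `(a + b)(a + b + 1) + a`; the sum `a + b` is recovered by counting
the `i` with `(i + 1)(i + 2) ≤ z`. -/

/-- The code of a pair. -/
def opair (a b : Expr R .num) : Expr R .num := add (mul (add a b) (succ (add a b))) a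

/-- The largest `s` with `s (s + 1) ≤ z`. -/
def root (z : Expr R .num) : Expr R .num :=
  bsum z (sgbar (monus (mul (succ (nv 0)) (succ (succ (nv 0)))) (z.shift .num)))

/-- The first component of a pair. -/
def pfst (z : Expr R .num) : Expr R .num := monus z (mul (root z) (succ (root z)))

/-- The second component of a pair. -/
def psnd (z : Expr R .num) : Expr R .num := monus (root z) (pfst z)

@[simp] theorem opair_sub (a b : Expr R .num) (σ : Subst R) :
    (opair a b).sub σ = opair (a.sub σ) (b.sub σ) := rfl

@[simp] theorem root_sub (z : Expr R .num) (σ : Subst R) : (root z).sub σ = root (z.sub σ) := by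
  simp only [root, bsum, Expr.sub, sgbar_sub, monus_sub, Expr.shift_sub_lift]
  rfl

@[simp] theorem pfst_sub (z : Expr R .num) (σ : Subst R) : (pfst z).sub σ = pfst (z.sub σ) := by
  simp [pfst]

@[simp] theorem psnd_sub (z : Expr R .num) (σ : Subst R) : (psnd z).sub σ = psnd (z.sub σ) := by
  simp [psnd]

theorem mk_opair (a b : Expr R .num) :
    (mk (opair a b) : Q T Γ) = (mk a + mk b) * (mk a + mk b + 1) + mk a := by
  simp only [opair, mk_add, mk_mul, mk_succ]

theorem mk_root_opair (a b : Expr R .num) : (mk (root (opair a b)) : Q T Γ) = mk a + mk b := by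
  set n := add a b with hn
  have hz : ∀ Δ : List (Fml R), (mk ((opair a b).shift .num) : Q T Δ) =
      mk (n.shift .num) * (mk (n.shift .num) + 1) + mk (a.shift .num) := fun Δ => by
    rw [← Expr.sub_var_shift, opair_sub, mk_opair, Expr.sub_var_shift, Expr.sub_var_shift]
    rfl
  have hle : (mk n : Q T Γ) ≤ mk (opair a b) := by
    rw [mk_opair, ← mk_add, mul_add, mul_one, add_assoc]
    exact le_add_self.trans' le_self_add
  have h₂ : (mk (opair a b) : Q T Γ) = mk (add n (monus (opair a b) n)) := by
    rw [mk_add n, mk_monus, Q.add_sub_of_le hle]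
  rw [root, bsum, mk_fnl, h₂, ← mk_fnl, mk_sum_add_of_zero, mk_sum_of_one (n := n) ?_ le_rfl, hn, mk_add]
  · intro Δ _ h
    obtain ⟨k, hk⟩ := exists_add_of_le h
    rw [mk_lam_shift_var, mk_sgbar, mk_monus, hz, hk, tsub_eq_zero_of_le, Q.sgbar_zero]
    simp only [mk_mul, mk_succ]
    refine le_trans ?_ le_self_add
    exact mul_le_mul le_self_add (add_le_add le_self_add le_rfl) _root_.zero_le _root_.zero_le
  · intro Δ _
    rw [mk_lam_shift]
    simp only [sgbar_sub, monus_sub, mul_sub, succ_sub, nv_sub, scons_num_zero, Expr.shift_sub,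
      Expr.sub_var_shift, mk_sgbar, mk_monus, hz, mk_mul, mk_succ, mk_add]
    rw [hn]
    simp only [add_shift, mk_add]
    set x : Q T Δ := mk (a.shift .num)
    set y : Q T Δ := mk (b.shift .num)
    set i : Q T Δ := mk (nv 0)
    have : (x + y + i + 1) * (x + y + i + 1 + 1) =
        ((x + y) * (2 * i + 1) + y + i * i + 3 * i + 1) + 1
          + ((x + y) * (x + y + 1) + x) := by
      ring
    rw [this, add_tsub_cancel_right, Q.sgbar_succ]

theorem mk_pfst (a b : Expr R .num) : (mk (pfst (opair a b)) : Q T Γ) = mk a := by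
  rw [pfst, mk_monus, mk_mul, mk_succ, mk_root_opair, mk_opair, add_tsub_cancel_left]

theorem mk_psnd (a b : Expr R .num) : (mk (psnd (opair a b)) : Q T Γ) = mk b := by
  rw [psnd, mk_monus, mk_pfst, mk_root_opair, add_tsub_cancel_left]

theorem mk_pfst_congr {z z' : Expr R .num} (h : (mk z : Q T Γ) = mk z') :
    (mk (pfst z) : Q T Γ) = mk (pfst z') := by
  simpa using mk_eq.2 (Prov.sub_congr_arg (pfst (nv 0)) Expr.var (mk_eq.1 h))

theorem mk_psnd_congr {z z' : Expr R .num} (h : (mk z : Q T Γ) = mk z') :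
    (mk (psnd z) : Q T Γ) = mk (psnd z') := by
  simpa using mk_eq.2 (Prov.sub_congr_arg (psnd (nv 0)) Expr.var (mk_eq.1 h))

/-! ### Finite sequences

A sequence is coded by a base and a number whose digits in that base are the entries. -/

/-- The entry with index `i` of the sequence coded by `c`. -/
def entry (c i : Expr R .num) : Expr R .num := rm (quot (psnd c) (exp (pfst c) i)) (pfst c)

@[simp] theorem entry_sub (c i : Expr R .num) (σ : Subst R) :
    (entry c i).sub σ = entry (c.sub σ) (i.sub σ) := by
  simp [entry]

/-- The summands of the number with the values of `u` as digits in base `b`. -/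
def digitFn (b : Expr R .num) (u : Expr R .fn) : Expr R .fn :=
  .lam (mul (.app (u.shift .num) (nv 0)) (exp (b.shift .num) (nv 0)))

/-- The code of the first `N` values of `u`. The base exceeds their sum, hence all of them. -/
def seqCode (N : Expr R .num) (u : Expr R .fn) : Expr R .num :=
  opair (succ (.fnl .sum N u)) (.fnl .sum N (digitFn (succ (.fnl .sum N u)) u))

theorem mk_digitFn_shift (b : Expr R .num) (u : Expr R .fn) (e : Expr R .num) :
    (mk (.app ((digitFn b u).shift .num) e) : Q T Γ) =
      mk (.app (u.shift .num) e) * Q.bin .exp (mk (b.shift .num)) (mk e) := by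
  rw [digitFn, mk_lam_shift]
  simp only [mul_sub, app_sub, Expr.shift_sub, Expr.sub_var_shift, nv_sub, scons_num_zero, exp_sub,
    mk_mul, mk_exp]

theorem mk_digitFn (b : Expr R .num) (u : Expr R .fn) (e : Expr R .num) :
    (mk (.app (digitFn b u) e) : Q T Γ) = mk (.app u e) * Q.bin .exp (mk b) (mk e) := by
  rw [digitFn, mk_lam]
  simp only [mul_sub, app_sub, Expr.shift_sub, Expr.sub_var, nv_sub, scons_num_zero, exp_sub,
    mk_mul, mk_exp]

theorem mk_digits_lt {y N : Expr R .num} (u : Expr R .fn) (h : (mk y : Q T Γ) ≤ mk N) :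
    (mk (.fnl .sum y (digitFn (succ (.fnl .sum N u)) u)) + 1 : Q T Γ) ≤
      Q.bin .exp (mk (.fnl .sum N u) + 1) (mk y) := by
  set b := succ (.fnl .sum N u) with hb
  rw [Q.le_iff, ← mk_succ, ← mk_succ, ← mk_exp, ← hb, ← mk_monus]
  refine mk_ind_le (monus (succ (.fnl .sum (nv 0) (fv 0))) (exp (nv 1) (nv 0))) .zero
    (scons .num b (scons .num N (scons .fn (digitFn b u) Expr.var))) y (nv 1) ?_ ?_ h
  · simp [mk_monus, mk_exp, mk_succ, mk_sum_zero, mk_zero, Q.exp_zero]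
  · intro Δ _ h₁ h₂
    simp at h₁ h₂ ⊢
    rw [mk_monus, mk_zero, ← Q.le_iff, mk_exp] at h₂ ⊢
    have h₃ := mk_app_le_sum (u.shift .num) h₁
    rw [mk_succ] at h₂ ⊢
    rw [mk_sum_succ, mk_digitFn_shift, mk_succ (nv 0), Q.exp_succ]
    have h₄ : (mk (b.shift .num) : Q T Δ) = mk (.fnl .sum (N.shift .num) (u.shift .num)) + 1 := by
      rw [hb, succ_shift, fnl_shift, mk_succ]
    set B : Q T Δ := Q.bin .exp (mk (b.shift .num)) (mk (nv 0))
    calc _ = mk (.fnl .sum (nv 0) ((digitFn b u).shift .num)) + 1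
          + mk (.app (u.shift .num) (nv 0)) * B := by ring
      _ ≤ B + mk (.fnl .sum (N.shift .num) (u.shift .num)) * B := by gcongr
      _ = B * mk (b.shift .num) := by rw [h₄]; ring

theorem mk_digit {i N : Expr R .num} (u : Expr R .fn) (h : (mk i + 1 : Q T Γ) ≤ mk N) :
    (mk (rm (quot (.fnl .sum N (digitFn (succ (.fnl .sum N u)) u))
      (exp (succ (.fnl .sum N u)) i)) (succ (.fnl .sum N u))) : Q T Γ) = mk (.app u i) := by
  set b := succ (.fnl .sum N u) with hb
  have key : ∀ k : Expr R .num,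
      (mk (rm (quot (.fnl .sum (add (succ i) k) (digitFn b u)) (exp b i)) b) : Q T Γ) =
        mk (.app u i) := by
    intro k
    refine mk_ind (rm (quot (.fnl .sum (add (succ (nv 1)) (nv 0)) (fv 0)) (exp (nv 2) (nv 1))) (nv 2))
      (.app (fv 1) (nv 1)) (scons .num i (scons .num b (scons .fn (digitFn b u)
        (scons .fn u Expr.var)))) k ?_ fun Δ _ h₂ => ?_
    · simp [mk_rm, mk_quot, mk_fnl .sum (add (succ i) .zero), mk_add, mk_zero]
      have h₁ : (mk i : Q T Γ) ≤ mk N := le_self_add.trans h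
      have hu := mk_app_le_sum u h
      rw [← mk_fnl, mk_sum_succ, mk_digitFn, mk_exp, hb, mk_succ, mul_comm,
        Q.quot_add_mul (Q.one_le_exp _ _), Q.quot_of_lt (mk_digits_lt u h₁), zero_add,
        Q.rm_of_lt (by gcongr)]
    · simp at h₂ ⊢
      have hb1 : (1 : Q T Δ) ≤ mk (b.shift .num) := by
        rw [hb, succ_shift, mk_succ]; exact le_add_self
      have hb2 : (1 : Q T Δ) ≤ Q.bin .exp (mk (b.shift .num)) (mk (i.shift .num)) := by
        rw [hb, succ_shift, mk_succ]; exact Q.one_le_exp _ _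
      have hs : (mk (.fnl .sum (add (succ (i.shift .num)) (succ (nv 0))) ((digitFn b u).shift .num)) :
          Q T Δ) = mk (.fnl .sum (add (succ (i.shift .num)) (nv 0)) ((digitFn b u).shift .num)) +
          Q.bin .exp (mk (b.shift .num)) (mk (i.shift .num)) * (mk (b.shift .num) *
            (mk (.app (u.shift .num) (add (succ (i.shift .num)) (nv 0))) *
              Q.bin .exp (mk (b.shift .num)) (mk (nv 0)))) := by
        rw [mk_fnl, mk_add, mk_succ (nv 0), ← add_assoc, ← mk_add, ← mk_succ, ← mk_fnl, mk_sum_succ,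
          mk_digitFn_shift, mk_add, Q.exp_add, mk_succ, Q.exp_succ]
        ring
      rw [mk_rm, mk_quot, hs, mk_exp, Q.quot_add_mul hb2, Q.rm_add_mul hb1, ← mk_exp, ← mk_quot,
        ← mk_rm, h₂]
  have h₁ := key (monus N (succ i))
  rw [← mk_succ] at h
  rwa [mk_rm, mk_quot, mk_fnl, mk_add, mk_monus, Q.add_sub_of_le h, ← mk_fnl, ← mk_quot, ← mk_rm]
    at h₁

/-- The entries of a code are the coded values. -/
theorem mk_entry_seqCode {i N : Expr R .num} (u : Expr R .fn) (h : (mk i + 1 : Q T Γ) ≤ mk N) :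
    (mk (entry (seqCode N u) i) : Q T Γ) = mk (.app u i) := by
  rw [← mk_digit u h, entry, seqCode, mk_rm, mk_quot, mk_exp, mk_pfst, mk_psnd, ← mk_exp, ← mk_quot,
    ← mk_rm]

end

/-! ### Extensionality -/

section
variable {T : Set (Fml R)} [hT : IsArith T] {Γ : List (Fml R)}

theorem Prov.eqFn_shift {u v : Expr R .fn} (h : Prov T Γ (eqFn u v)) (s : Srt) :
    Prov T (Γ.map (Fml.shift s)) (eqFn (u.shift s) (v.shift s)) := by
  have := h.shift s
  rwa [show (eqFn u v).shift s = _ from eqE_shift (s := .fn) s u v] at this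

theorem mk_app_congr {u v : Expr R .fn} (h : Prov T Γ (eqFn u v)) {a b : Expr R .num}
    (h' : (mk a : Q T Γ) = mk b) : (mk (.app u a) : Q T Γ) = mk (.app v b) := by
  rw [mk_app, h', ← mk_app]
  exact mk_eq.2 (h.eqFn_app b)

theorem mk_fnl_congr (f : FnlConst) {u v : Expr R .fn} (h : Prov T Γ (eqFn u v)) (a : Expr R .num) :
    (mk (.fnl f a u) : Q T Γ) = mk (.fnl f a v) := by
  have prod : ∀ {u v : Expr R .fn}, Prov T Γ (eqFn u v) →
      (mk (.fnl .prod a u) : Q T Γ) = mk (.fnl .prod a v) := by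
    intro u v h
    refine mk_ind (.fnl .prod (nv 0) (fv 0)) (.fnl .prod (nv 0) (fv 1))
      (scons .fn u (scons .fn v Expr.var)) a ?_ fun Δ hΔ h₂ => ?_
    · exact (mk_eq.2 (Prov.ax_inst (fun r => IA₁.prod_zero (r := r)) a a a u)).trans
        (mk_eq.2 (Prov.ax_inst (fun r => IA₁.prod_zero (r := r)) a a a v)).symm
    · have hs : ∀ w : Expr R .fn, (mk (.fnl .prod (succ (nv 0)) w) : Q T Δ) =
          mk (.fnl .prod (nv 0) w) * mk (.app w (nv 0)) := fun w =>
        mk_eq.2 (Prov.ax_inst (fun r => IA₁.prod_succ (r := r)) (nv 0) a a w)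
      simp at h₂ ⊢
      rw [hs, hs, h₂, mk_app_congr ((h.eqFn_shift .num).mono hΔ) rfl]
  cases f with
  | sum =>
    refine mk_ind (.fnl .sum (nv 0) (fv 0)) (.fnl .sum (nv 0) (fv 1))
      (scons .fn u (scons .fn v Expr.var)) a ?_ fun Δ hΔ h₂ => ?_
    · simp [mk_sum_zero]
    · simp at h₂ ⊢
      rw [mk_sum_succ, mk_sum_succ, h₂, mk_app_congr ((h.eqFn_shift .num).mono hΔ) rfl]
  | prod => exact prod h
  | minLe =>
    refine mk_ind (.fnl .minLe (nv 0) (fv 0)) (.fnl .minLe (nv 0) (fv 1))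
      (scons .fn u (scons .fn v Expr.var)) a ?_ fun Δ hΔ h₂ => ?_
    · exact (mk_eq.2 (Prov.ax_inst (fun r => IA₁.minLe_zero (r := r)) a a a u)).trans
        ((mk_app_congr h rfl).trans
          (mk_eq.2 (Prov.ax_inst (fun r => IA₁.minLe_zero (r := r)) a a a v)).symm)
    · have hs : ∀ w : Expr R .fn, (mk (.fnl .minLe (succ (nv 0)) w) : Q T Δ) =
          Q.bin .min (mk (.fnl .minLe (nv 0) w)) (mk (.app w (succ (nv 0)))) := fun w =>
        mk_eq.2 (Prov.ax_inst (fun r => IA₁.minLe_succ (r := r)) (nv 0) a a w)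
      simp at h₂ ⊢
      rw [hs, hs, h₂, mk_app_congr ((h.eqFn_shift .num).mono hΔ) rfl]
  | maxLe =>
    refine mk_ind (.fnl .maxLe (nv 0) (fv 0)) (.fnl .maxLe (nv 0) (fv 1))
      (scons .fn u (scons .fn v Expr.var)) a ?_ fun Δ hΔ h₂ => ?_
    · exact (mk_eq.2 (Prov.ax_inst (fun r => IA₁.maxLe_zero (r := r)) a a a u)).trans
        ((mk_app_congr h rfl).trans
          (mk_eq.2 (Prov.ax_inst (fun r => IA₁.maxLe_zero (r := r)) a a a v)).symm)
    · have hs : ∀ w : Expr R .fn, (mk (.fnl .maxLe (succ (nv 0)) w) : Q T Δ) =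
          Q.bin .max (mk (.fnl .maxLe (nv 0) w)) (mk (.app w (succ (nv 0)))) := fun w =>
        mk_eq.2 (Prov.ax_inst (fun r => IA₁.maxLe_succ (r := r)) (nv 0) a a w)
      simp at h₂ ⊢
      rw [hs, hs, h₂, mk_app_congr ((h.eqFn_shift .num).mono hΔ) rfl]
  | bar =>
    have e : ∀ w : Expr R .fn, (mk (.fnl .bar a w) : Q T Γ) = mk (.fnl .prod a (.lam (exp
        (prime (nv 0)) (add (.app (w.shift .num) (nv 0)) (numeral 1))))) := fun w =>
      mk_eq.2 (Prov.ax_inst (fun r => IA₁.bar_def (r := r)) a a a w)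
    rw [e, e]
    refine prod (Prov.lam_congr (mk_eq.1 ?_))
    rw [mk_exp, mk_exp, mk_add, mk_add, mk_app_congr (h.eqFn_shift .num) rfl]
  | tilde =>
    have e : ∀ w : Expr R .fn, (mk (.fnl .tilde a w) : Q T Γ) = mk (.fnl .prod a (.lam (exp
        (prime (nv 0)) (.app (w.shift .num) (nv 0))))) := fun w =>
      mk_eq.2 (Prov.ax_inst (fun r => IA₁.tilde_def (r := r)) a a a w)
    rw [e, e]
    refine prod (Prov.lam_congr (mk_eq.1 ?_))
    rw [mk_exp, mk_exp, mk_app_congr (h.eqFn_shift .num) rfl]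

/-! ### Uniqueness of functions defined by recursion -/

@[simp] theorem recEqs_sub (x : Expr R .num) (u b : Expr R .fn) (σ : Subst R) :
    (recEqs x u b).sub σ = recEqs (x.sub σ) (u.sub σ) (b.sub σ) := by
  simp only [recEqs, Fml.sub, Expr.sub, succ_sub, pair_sub, Expr.shift_sub_lift]
  rfl

@[simp] theorem recFml_sub (x : Expr R .num) (u : Expr R .fn) (y w : Expr R .num) (σ : Subst R) :
    (recFml x u y w).sub σ = recFml (x.sub σ) (u.sub σ) (y.sub σ) (w.sub σ) := by
  simp only [recFml, Fml.sub, recEqs_sub, app_sub, Expr.shift_sub_lift]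
  rfl

theorem recEqs_ren (x : Expr R .num) (u b : Expr R .fn) (ρ : Srt → ℕ → ℕ) :
    (recEqs x u b).ren ρ = recEqs (x.ren ρ) (u.ren ρ) (b.ren ρ) := by
  simp only [Fml.ren_eq_sub, Expr.ren_eq_sub, recEqs_sub]

theorem recFml_ren (x : Expr R .num) (u : Expr R .fn) (y w : Expr R .num) (ρ : Srt → ℕ → ℕ) :
    (recFml x u y w).ren ρ = recFml (x.ren ρ) (u.ren ρ) (y.ren ρ) (w.ren ρ) := by
  simp only [Fml.ren_eq_sub, Expr.ren_eq_sub, recFml_sub]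

theorem recEqs_zero {x : Expr R .num} {u b : Expr R .fn} (h : Prov T Γ (recEqs x u b)) :
    (mk (.app b .zero) : Q T Γ) = mk x :=
  mk_eq.2 h.andE₁

theorem recEqs_succ {x : Expr R .num} {u b : Expr R .fn} (h : Prov T Γ (recEqs x u b))
    (e : Expr R .num) :
    (mk (.app b (succ e)) : Q T Γ) = mk (.app u (pair (.app b e) e)) := by
  have := mk_eq.2 (Prov.allE e h.andE₂)
  simpa [Fml.inst_eq, Expr.inst, instSub_eq, Expr.shift_sub, Expr.sub_var] using this

theorem recEqs_intro {x : Expr R .num} {u b : Expr R .fn} (h0 : (mk (.app b .zero) : Q T Γ) = mk x)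
    (hs : (mk (.app (b.shift .num) (succ (nv 0))) : Q T (Γ.map (Fml.shift .num))) =
      mk (.app (u.shift .num) (pair (.app (b.shift .num) (nv 0)) (nv 0)))) :
    Prov T Γ (recEqs x u b) :=
  .andI (mk_eq.1 h0) (.allI (mk_eq.1 hs))

theorem mk_pair_congr {a a' b b' : Expr R .num} (h : (mk a : Q T Γ) = mk a')
    (h' : (mk b : Q T Γ) = mk b') : (mk (pair a b) : Q T Γ) = mk (pair a' b') := by
  simp only [pair, mk_mul, mk_exp, h, h']

theorem recEqs_shift {x : Expr R .num} {u b : Expr R .fn} (h : Prov T Γ (recEqs x u b)) (s : Srt) :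
    Prov T (Γ.map (Fml.shift s)) (recEqs (x.shift s) (u.shift s) (b.shift s)) := by
  have := h.shift s
  rwa [Fml.shift, recEqs_ren] at this

theorem recEqs_unique {x x' : Expr R .num} {u u' b b' : Expr R .fn} (h : Prov T Γ (recEqs x u b))
    (h' : Prov T Γ (recEqs x' u' b')) (hx : (mk x : Q T Γ) = mk x') (hu : Prov T Γ (eqFn u u'))
    (e : Expr R .num) : (mk (.app b e) : Q T Γ) = mk (.app b' e) := by
  refine mk_ind (.app (fv 0) (nv 0)) (.app (fv 1) (nv 0)) (scons .fn b (scons .fn b' Expr.var)) e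
    ?_ fun Δ hΔ ih => ?_
  · simp
    rw [recEqs_zero h, recEqs_zero h', hx]
  · simp at ih ⊢
    rw [recEqs_succ ((recEqs_shift h .num).mono hΔ), recEqs_succ ((recEqs_shift h' .num).mono hΔ)]
    exact mk_app_congr ((hu.eqFn_shift .num).mono hΔ) (mk_pair_congr ih rfl)

theorem Prov.recEqs_unique_fn {x : Expr R .num} {u b b' : Expr R .fn} (h : Prov T Γ (recEqs x u b))
    (h' : Prov T Γ (recEqs x u b')) : Prov T Γ (eqFn b b') :=
  .eqFn_intro (mk_eq.1 (recEqs_unique (recEqs_shift h .num) (recEqs_shift h' .num) rfl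
    (.eqFn_refl _) _))

theorem recFml_shift {x : Expr R .num} {u : Expr R .fn} {y w : Expr R .num}
    (h : Prov T Γ (recFml x u y w)) (s : Srt) :
    Prov T (Γ.map (Fml.shift s)) (recFml (x.shift s) (u.shift s) (y.shift s) (w.shift s)) := by
  have := h.shift s
  rwa [Fml.shift, recFml_ren] at this

theorem Prov.recFml_intro {x : Expr R .num} {u : Expr R .fn} {y w : Expr R .num} (b : Expr R .fn)
    (h : Prov T Γ (recEqs x u b)) (h' : Prov T Γ (.eq (.app b y) w)) :
    Prov T Γ (recFml x u y w) := by
  refine .exI b (.andI ?_ ?_)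
  · rw [← Fml.inst, Fml.inst_eq, recEqs_sub]
    simpa [Expr.shift_sub, Expr.sub_var] using h
  · rw [← Fml.inst, Fml.inst_eq]
    simpa [Expr.shift_sub, Expr.sub_var] using h'

theorem recFml_unique {x x' : Expr R .num} {u u' : Expr R .fn} {y y' w w' : Expr R .num}
    (h : Prov T Γ (recFml x u y w)) (h' : Prov T Γ (recFml x' u' y' w'))
    (hx : (mk x : Q T Γ) = mk x') (hu : Prov T Γ (eqFn u u')) (hy : (mk y : Q T Γ) = mk y') :
    (mk w : Q T Γ) = mk w' := by
  refine mk_eq.2 (.exE h (.assume fun Δ hΔ h₁ => ?_))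
  have h₂ := (recFml_shift h' .fn).mono hΔ
  refine .exE h₂ (.assume fun Δ' hΔ' h₃ => mk_eq.1 ?_)
  have h₄ := h₁.shift .fn
  simp only [Fml.shift, Fml.ren, recEqs_ren] at h₄
  have hΔΔ : (Γ.map (Fml.shift .fn)).map (Fml.shift .fn) ⊆ Δ' :=
    List.Subset.trans (List.map_subset _ hΔ) hΔ'
  have hy' := mk_mono hΔΔ (mk_shift .fn (mk_shift .fn hy))
  have := recEqs_unique (h₄.andE₁.mono hΔ') h₃.andE₁
    (mk_mono hΔΔ (mk_shift .fn (mk_shift .fn hx)))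
    (((hu.eqFn_shift .fn).eqFn_shift .fn).mono hΔΔ) ((y.shift .fn).shift .fn)
  have h₅ := mk_eq.2 (h₄.andE₂.mono hΔ')
  have h₆ := mk_eq.2 h₃.andE₂
  refine h₅.symm.trans (this.trans ?_)
  rw [mk_app, hy', ← mk_app]
  exact h₆

theorem Prov.rcr_congr (c : R) {a a' b b' : Expr R .num} {u u' : Expr R .fn}
    (h : Prov T Γ (.eq a a')) (hu : Prov T Γ (eqFn u u')) (h' : Prov T Γ (.eq b b')) :
    Prov T Γ (.eq (.rcr c a u b) (.rcr c a' u' b')) := by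
  have ax : ∀ (a b : Expr R .num) (u : Expr R .fn), Prov T Γ (recFml a u b (.rcr c a u b)) := by
    intro a b u
    have := (hT.recAx c).sub_nil (env a b b u)
    rw [recFml_sub] at this
    exact this.of_nil
  exact mk_eq.1 (recFml_unique (ax a b u) (ax a' b' u') (mk_eq.2 h) hu (mk_eq.2 h'))

/-- Provable equality of two substitutions. -/
def EqSub (T : Set (Fml R)) (Γ : List (Fml R)) (σ τ : Subst R) : Prop :=
  ∀ s n, Prov T Γ (eqE s (σ s n) (τ s n))

theorem EqSub.mono {σ τ : Subst R} {Δ : List (Fml R)} (h : EqSub T Γ σ τ) (hs : Γ ⊆ Δ) :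
    EqSub T Δ σ τ := fun s n => (h s n).mono hs

theorem EqSub.shift {σ τ : Subst R} (h : EqSub T Γ σ τ) (s : Srt) :
    EqSub T (Γ.map (Fml.shift s)) (σ.shift s) (τ.shift s) := fun s' n => by
  have := (h s' n).shift s
  rwa [eqE_shift] at this

theorem EqSub.refl (σ : Subst R) : EqSub T Γ σ σ := fun _ _ => Prov.eqE_refl _

theorem EqSub.symm {σ τ : Subst R} (h : EqSub T Γ σ τ) : EqSub T Γ τ σ :=
  fun s n => (h s n).eqE_symm

theorem EqSub.scons {σ τ : Subst R} (h : EqSub T Γ σ τ) {s : Srt} {a b : Expr R s}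
    (h' : Prov T Γ (eqE s a b)) : EqSub T Γ (scons s a σ) (scons s b τ) := by
  intro s' n
  cases s <;> cases s' <;> cases n <;> first | exact h' | exact h _ _

theorem EqSub.lift {σ τ : Subst R} (h : EqSub T Γ σ τ) (s : Srt) :
    EqSub T (Γ.map (Fml.shift s)) (liftSub s σ) (liftSub s τ) := by
  rw [liftSub_eq, liftSub_eq]
  exact (h.shift s).scons (Prov.eqE_refl _)

theorem Prov.sub_congr {s : Srt} (e : Expr R s) {σ τ : Subst R} (h : EqSub T Γ σ τ) :
    Prov T Γ (eqE s (e.sub σ) (e.sub τ)) := by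
  induction e generalizing Γ σ τ with
  | var s n => exact h s n
  | zero => exact .eq_refl _
  | un f => exact .eqFn_refl _
  | bin f a b iha ihb => exact .bin_congr f (iha h) (ihb h)
  | fnl f a u iha ihu =>
    exact .eq_trans (.fnl_congr_arg f _ (iha h)) (mk_eq.1 (mk_fnl_congr f (ihu h) _))
  | rcr c a u b iha ihu ihb => exact .rcr_congr c (iha h) (ihu h) (ihb h)
  | app u a ihu iha => exact mk_eq.1 (mk_app_congr (ihu h) (mk_eq.2 (iha h)))
  | lam t ih => exact .lam_congr (ih (h.lift .num))

/-- The replacement theorem: provably equal substitutions may be exchanged in a formula. -/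
theorem Prov.replace (A : Fml R) {σ τ : Subst R} (h : EqSub T Γ σ τ) (hA : Prov T Γ (A.sub σ)) :
    Prov T Γ (A.sub τ) := by
  induction A generalizing Γ σ τ with
  | eq a b =>
    exact .eq_trans (Prov.sub_congr a h).eqE_symm (.eq_trans hA (Prov.sub_congr b h))
  | and A B ihA ihB => exact .andI (ihA h hA.andE₁) (ihB h hA.andE₂)
  | or A B ihA ihB =>
    exact .orE hA (.assume fun Δ hs h' => .orI₁ (ihA (h.mono hs) h'))
      (.assume fun Δ hs h' => .orI₂ (ihB (h.mono hs) h'))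
  | imp A B ihA ihB =>
    exact .impI (.assume fun Δ hs h' => ihB (h.mono hs) (.impE (hA.mono hs)
      (ihA (h.mono hs).symm h')))
  | neg A ih =>
    refine .negI (B := A.sub σ) (.assume fun Δ hs h' => ih (h.mono hs).symm h') ?_
    exact hA.weaken
  | all s A ih =>
    refine .allI (ih (h.lift s) ?_)
    rw [liftSub_eq]
    exact (hA.shift_sub s).allE_sub _
  | ex s A ih =>
    refine .exE hA (.assume fun Δ hs h' => ?_)
    have := ih ((h.lift s).mono hs) h'
    rw [liftSub_eq] at this
    rw [Fml.sub_shift]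
    exact this.exI_sub _

end

/-! ### Existence of functions defined by recursion -/

/-- An arithmetical system with the schema `QF-AC₀₀`. -/
class HasChoice (T : Set (Fml R)) : Prop extends IsArith T where
  choice : ∀ A, QFAC₀₀ A → A ∈ T

/-- The formula `v` codes the first values, up to the argument `y`, of the function defined by
recursion from `x` and `u`. It is quantifier-free. -/
def approxF (x : Expr R .num) (u : Expr R .fn) (y v : Expr R .num) : Fml R :=
  .and (.eq (entry v .zero) x)
    (.eq (.fnl .sum y (.lam (dist (entry (v.shift .num) (succ (nv 0)))
      (.app (u.shift .num) (pair (entry (v.shift .num) (nv 0)) (nv 0)))))) .zero)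

section
variable {T : Set (Fml R)} [hT : IsArith T] {Γ : List (Fml R)}

@[simp] theorem entry_shift (c i : Expr R .num) (s : Srt) :
    (entry c i).shift s = entry (c.shift s) (i.shift s) := by
  simp only [← Expr.sub_var_shift, entry_sub]

@[simp] theorem approxF_sub (x : Expr R .num) (u : Expr R .fn) (y v : Expr R .num) (σ : Subst R) :
    (approxF x u y v).sub σ = approxF (x.sub σ) (u.sub σ) (y.sub σ) (v.sub σ) := by
  simp only [approxF, Fml.sub, Expr.sub, entry_sub, dist_sub, pair_sub, succ_sub,
    Expr.shift_sub_lift]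
  rfl

theorem approxF_shift {x : Expr R .num} {u : Expr R .fn} {y v : Expr R .num}
    (h : Prov T Γ (approxF x u y v)) (s : Srt) :
    Prov T (Γ.map (Fml.shift s)) (approxF (x.shift s) (u.shift s) (y.shift s) (v.shift s)) := by
  have := h.shift s
  rwa [Fml.shift, Fml.ren_eq_sub, approxF_sub, ← Expr.ren_eq_sub, ← Expr.ren_eq_sub,
    ← Expr.ren_eq_sub, ← Expr.ren_eq_sub] at this

theorem mk_entry_congr {c c' i i' : Expr R .num} (h : (mk c : Q T Γ) = mk c')
    (h' : (mk i : Q T Γ) = mk i') : (mk (entry c i) : Q T Γ) = mk (entry c' i') := by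
  simp only [entry, mk_rm, mk_quot, mk_exp, h', mk_pfst_congr h, mk_psnd_congr h]

theorem approxF_zero {x : Expr R .num} {u : Expr R .fn} {y v : Expr R .num}
    (h : Prov T Γ (approxF x u y v)) : (mk (entry v .zero) : Q T Γ) = mk x :=
  mk_eq.2 h.andE₁

theorem approxF_succ {x : Expr R .num} {u : Expr R .fn} {y v : Expr R .num}
    (h : Prov T Γ (approxF x u y v)) {e : Expr R .num} (he : (mk e + 1 : Q T Γ) ≤ mk y) :
    (mk (entry v (succ e)) : Q T Γ) = mk (.app u (pair (entry v e) e)) := by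
  have h₁ := mk_eq.2 h.andE₂
  have h₂ := mk_app_le_sum (.lam _) he |>.trans h₁.le
  have h₃ := le_antisymm h₂ _root_.zero_le
  rw [mk_lam] at h₃
  simpa [mk_zero, mk_dist_eq_zero, Expr.shift_sub, Expr.sub_var] using h₃

theorem approxF_intro {x : Expr R .num} {u : Expr R .fn} {y v : Expr R .num}
    (h0 : (mk (entry v .zero) : Q T Γ) = mk x)
    (hs : ∀ Δ : List (Fml R), Γ.map (Fml.shift .num) ⊆ Δ →
      (mk (nv 0) + 1 : Q T Δ) ≤ mk (y.shift .num) →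
      (mk (entry (v.shift .num) (succ (nv 0))) : Q T Δ) =
        mk (.app (u.shift .num) (pair (entry (v.shift .num) (nv 0)) (nv 0)))) :
    Prov T Γ (approxF x u y v) := by
  refine .andI (mk_eq.1 h0) (mk_eq.1 (mk_sum_eq_zero fun Δ hΔ h => ?_))
  rw [mk_lam_shift_var, mk_dist_eq_zero]
  exact hs Δ hΔ h

/-- The functor with the entries of `v` as values up to the argument `y`, and the value prescribed by
the recursion equation at the next argument. -/
def nextFn (u : Expr R .fn) (y v : Expr R .num) : Expr R .fn :=
  .lam (add (mul (sgbar (monus (nv 0) (y.shift .num))) (entry (v.shift .num) (nv 0)))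
    (mul (sg (monus (nv 0) (y.shift .num)))
      (.app (u.shift .num) (pair (entry (v.shift .num) (y.shift .num)) (y.shift .num)))))

/-- The code of an approximation with one more value. -/
def nextCode (u : Expr R .fn) (y v : Expr R .num) : Expr R .num :=
  seqCode (succ (succ y)) (nextFn u y v)

theorem mk_nextFn (u : Expr R .fn) (y v e : Expr R .num) :
    (mk (.app (nextFn u y v) e) : Q T Γ) =
      Q.app (.un .sgbar) (mk e - mk y) * mk (entry v e) +
        Q.app (.un .sg) (mk e - mk y) * mk (.app u (pair (entry v y) y)) := by
  rw [nextFn, mk_lam]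
  simp only [add_sub, mul_sub, sgbar_sub, sg_sub, monus_sub, nv_sub, scons_num_zero, app_sub,
    pair_sub, entry_sub, Expr.shift_sub, Expr.sub_var, mk_add, mk_mul, mk_sg, mk_sgbar, mk_monus]

theorem mk_nextCode_of_le {u : Expr R .fn} {y v e : Expr R .num} (h : (mk e : Q T Γ) ≤ mk y) :
    (mk (entry (nextCode u y v) e) : Q T Γ) = mk (entry v e) := by
  rw [nextCode, mk_entry_seqCode, mk_nextFn, Q.le_iff.1 h, Q.sgbar_zero, Q.sg_zero, one_mul,
    zero_mul, add_zero]
  rw [mk_succ, mk_succ]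
  exact (add_le_add_left h 1).trans le_self_add

theorem mk_nextCode_succ (u : Expr R .fn) (y v : Expr R .num) :
    (mk (entry (nextCode u y v) (succ y)) : Q T Γ) = mk (.app u (pair (entry v y) y)) := by
  rw [nextCode, mk_entry_seqCode, mk_nextFn, mk_succ, add_tsub_cancel_left, ← zero_add (1 : Q T Γ),
    Q.sgbar_succ, Q.sg_succ, zero_mul, one_mul, zero_add]
  rw [mk_succ (succ y)]

@[simp] theorem seqCode_sub (N : Expr R .num) (u : Expr R .fn) (σ : Subst R) :
    (seqCode N u).sub σ = seqCode (N.sub σ) (u.sub σ) := by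
  simp only [seqCode, digitFn, opair_sub, succ_sub, Expr.sub, mul_sub, exp_sub,
    Expr.shift_sub_lift, succ_shift, fnl_shift]
  rfl

@[simp] theorem nextCode_sub (u : Expr R .fn) (y v : Expr R .num) (σ : Subst R) :
    (nextCode u y v).sub σ = nextCode (u.sub σ) (y.sub σ) (v.sub σ) := by
  simp only [nextCode, seqCode_sub, nextFn, succ_sub, Expr.sub, add_sub, mul_sub, sg_sub, sgbar_sub,
    monus_sub, entry_sub, pair_sub, Expr.shift_sub_lift]
  rfl

theorem nextCode_shift (u : Expr R .fn) (y v : Expr R .num) (s : Srt) :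
    (nextCode u y v).shift s = nextCode (u.shift s) (y.shift s) (v.shift s) := by
  simp only [← Expr.sub_var_shift, nextCode_sub]

theorem Prov.approxF_nextCode {x : Expr R .num} {u : Expr R .fn} {y v : Expr R .num}
    (h : Prov T Γ (approxF x u y v)) : Prov T Γ (approxF x u (succ y) (nextCode u y v)) := by
  refine approxF_intro ?_ fun Δ hΔ hle => ?_
  · rw [mk_nextCode_of_le _root_.zero_le, approxF_zero h]
  · have h₁ := (approxF_shift h .num).mono hΔ
    rw [nextCode_shift]
    rw [succ_shift, mk_succ] at hle
    have hle' : (mk (nv 0) : Q T Δ) ≤ mk (y.shift .num) := le_of_add_le_add_right hle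
    have e : (mk (.app (u.shift .num) (pair (entry (nextCode (u.shift .num) (y.shift .num)
        (v.shift .num)) (nv 0)) (nv 0))) : Q T Δ) =
        mk (.app (u.shift .num) (pair (entry (v.shift .num) (nv 0)) (nv 0))) :=
      mk_app_congr (.eqFn_refl _) (mk_pair_congr (mk_nextCode_of_le hle') rfl)
    rw [e]
    refine mk_eq.2 (Prov.cases_le (y.shift .num) (nv 0) (fun Δ' hΔ' h₂ => mk_eq.1 ?_)
      (fun Δ' hΔ' h₂ => mk_eq.1 ?_))
    · have h₃ := le_antisymm (mk_le_mono hΔ' hle') h₂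
      rw [mk_entry_congr rfl (mk_succ_congr h₃), mk_nextCode_succ]
      exact mk_app_congr (.eqFn_refl _) (mk_pair_congr (mk_entry_congr rfl h₃.symm) h₃.symm)
    · rw [← mk_succ] at h₂
      rw [mk_nextCode_of_le h₂]
      rw [mk_succ] at h₂
      exact approxF_succ (h₁.mono hΔ') h₂

theorem Prov.exists_approxF (x : Expr R .num) (u : Expr R .fn) (y : Expr R .num) :
    Prov T Γ (.ex .num (approxF (x.shift .num) (u.shift .num) (y.shift .num) (nv 0))) := by
  have key := Prov.ind_sub (T := T) (Γ := Γ) (.ex .num (approxF (nv 2) (fv 0) (nv 1) (nv 0)))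
    (scons .num x (scons .fn u Expr.var)) y
    (.exI_sub (seqCode (succ .zero) (.lam (x.shift .num))) ?_)
    (.assume fun Δ _ h => .exE_sub h (.assume fun Δ' _ h' => ?_))
  · simp only [Fml.sub, liftSub_eq, approxF_sub, nv_sub, fv_sub] at key
    exact key
  · rw [approxF_sub]
    refine approxF_intro (u := u) (x := x) ?_ fun Δ hΔ hle => ?_
    · change mk (entry (seqCode (succ .zero) (.lam (x.shift .num))) .zero) = _
      rw [mk_entry_seqCode, mk_lam, Expr.shift_sub, Expr.sub_var]
      rw [mk_succ]
    · have : (1 : Q T Δ) ≤ 0 := le_add_self.trans hle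
      refine mk_eq.2 (.negE (A := .eq (succ .zero) .zero) ?_ (mk_eq.1 ?_))
      · exact Prov.ax_inst (fun r => IA₁.succ_ne (r := r)) .zero .zero .zero idleFn
      · exact le_antisymm this _root_.zero_le
  · rw [Fml.sub_shift]
    refine .exI_sub (nextCode ((u.shift .num).shift .num) (nv 1) (nv 0)) ?_
    simp only [approxF_sub] at h' ⊢
    exact h'.approxF_nextCode

/-- Two approximations agree as far as both are defined. -/
theorem approxF_unique {x : Expr R .num} {u : Expr R .fn} {y y' v v' e : Expr R .num}
    (h : Prov T Γ (approxF x u y v)) (h' : Prov T Γ (approxF x u y' v'))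
    (hy : (mk y : Q T Γ) ≤ mk y') (he : (mk e : Q T Γ) ≤ mk y) :
    (mk (entry v e) : Q T Γ) = mk (entry v' e) := by
  refine mk_ind_le (entry (nv 1) (nv 0)) (entry (nv 2) (nv 0))
    (scons .num v (scons .num v' (scons .num y Expr.var))) e (nv 2) ?_ ?_ he
  · simp
    rw [approxF_zero h, approxF_zero h']
  · intro Δ hΔ h₁ h₂
    simp at h₁ h₂ ⊢
    rw [approxF_succ ((approxF_shift h .num).mono hΔ) h₁, approxF_succ
      ((approxF_shift h' .num).mono hΔ) (h₁.trans (mk_le_mono hΔ (mk_le_shift .num hy)))]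
    exact mk_app_congr (.eqFn_refl _) (mk_pair_congr h₂ rfl)

theorem approxF_eq_rec {x : Expr R .num} {u b : Expr R .fn} {y v e : Expr R .num}
    (h : Prov T Γ (approxF x u y v)) (h' : Prov T Γ (recEqs x u b)) (he : (mk e : Q T Γ) ≤ mk y) :
    (mk (.app b e) : Q T Γ) = mk (entry v e) := by
  refine mk_ind_le (.app (fv 0) (nv 0)) (entry (nv 1) (nv 0))
    (scons .num v (scons .num y (scons .fn b Expr.var))) e (nv 1) ?_ ?_ he
  · simp
    rw [approxF_zero h, recEqs_zero h']
  · intro Δ hΔ h₁ h₂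
    simp at h₁ h₂ ⊢
    rw [approxF_succ ((approxF_shift h .num).mono hΔ) h₁, recEqs_succ ((recEqs_shift h' .num).mono hΔ)]
    exact mk_app_congr (.eqFn_refl _) (mk_pair_congr h₂ rfl)

/-- A family of approximations yields the function. -/
theorem Prov.recEqs_of_approxF {x : Expr R .num} {u g : Expr R .fn}
    (h : Prov T Γ ((Fml.all .num (approxF (nv 1) (fv 0) (nv 0) (.app (fv 1) (nv 0)))).sub
      (scons .num x (scons .fn u (scons .fn g Expr.var))))) :
    Prov T Γ (recEqs x u (.lam (entry (.app (g.shift .num) (nv 0)) (nv 0)))) := by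
  have key := fun e => h.allE_sub e
  have key' := fun e => (h.shift_sub .num).allE_sub e
  simp at key key'
  refine recEqs_intro ?_ ?_
  · rw [mk_lam]
    simp [Expr.shift_sub, Expr.sub_var]
    exact approxF_zero (key .zero)
  · have hle : (mk (nv 0) : Q T (Γ.map (Fml.shift .num))) ≤ mk (succ (nv 0)) := by
      rw [mk_succ]; exact le_self_add
    rw [mk_app_congr (.eqFn_refl _) (mk_pair_congr (mk_lam_shift_var _) rfl), mk_lam_shift]
    simp only [entry_sub, app_sub, Expr.shift_sub, Expr.sub_var_shift, nv_sub, scons_num_zero]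
    rw [approxF_succ (key' (succ (nv 0))) (mk_succ _).symm.le]
    exact mk_app_congr (.eqFn_refl _) (mk_pair_congr
      (approxF_unique (key' (nv 0)) (key' (succ (nv 0))) hle le_rfl).symm rfl)

/-- To prove `∃!β C(β)` it suffices to give a witness and to compare it with all others. -/
theorem Prov.exUnique_intro {C : Fml R} {σ : Subst R} (b : Expr R .fn)
    (h : Prov T Γ (C.sub (scons .fn b σ)))
    (h' : ∀ Δ : List (Fml R), Γ.map (Fml.shift .fn) ⊆ Δ → ∀ b' : Expr R .fn,
      Prov T Δ (C.sub (scons .fn b' (σ.shift .fn))) → Prov T Δ (eqFn (b.shift .fn) b')) :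
    Prov T Γ ((exUniqueFn C).sub σ) := by
  refine .exI_sub b (.andI h (.allI_sub (.impI (.assume fun Δ hΔ h₁ => ?_))))
  rw [eqFn_sub]
  refine h' Δ hΔ (fv 0) ?_
  rw [Fml.sub_ren] at h₁
  convert h₁ using 2
  funext s n; cases s <;> cases n <;> rfl

end

section
variable {T : Set (Fml R)} [hT : HasChoice T] {Γ : List (Fml R)}

/-- Choice of approximations, uniformly in the number variable with index `0`. -/
theorem Prov.exists_approxF_family (t : Expr R .num) (u : Expr R .fn) (s : Expr R .num) :
    Prov T Γ (.ex .fn (.all .num (approxF (t.shift .fn) (u.shift .fn) (s.shift .fn)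
      (.app (fv 0) (nv 0))))) := by
  have h := Prov.impE (T := T) (Γ := Γ) (.ax (hT.choice _ (.mk (approxF (t.shift .num) (u.shift .num)
    (s.shift .num) (nv 0)) ⟨trivial, trivial⟩))) (.allI (.exists_approxF t u s))
  have e : ∀ (σ : Subst R), (∀ n, σ .num (n + 1) = nv n) → (∀ n, σ .fn n = fv (n + 1)) →
      ∀ {s' : Srt} (e : Expr R s'), (e.shift .num).sub σ = e.shift .fn := by
    intro σ h₁ h₂ s' e
    rw [Expr.shift, Expr.sub_ren, Expr.shift, Expr.ren_eq_sub]
    congr 1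
    funext s n
    cases s
    · exact h₁ n
    · exact h₂ n
  rw [approxF_sub, e _ (fun _ => rfl) (fun _ => rfl), e _ (fun _ => rfl) (fun _ => rfl),
    e _ (fun _ => rfl) (fun _ => rfl)] at h
  exact h

theorem Expr.shift_comm {s : Srt} (e : Expr R s) :
    (e.shift .num).shift .fn = (e.shift .fn).shift .num := by
  simp only [Expr.shift, Expr.ren_ren]
  congr 1
  funext s n; cases s <;> rfl

/-- Definition of functions by recursion. -/
theorem Prov.exists_rec (x : Expr R .num) (u : Expr R .fn) :
    Prov T Γ ((Fml.ex .fn (recEqs (nv 0) (fv 1) (fv 0))).sub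
      (scons .num x (scons .fn u Expr.var))) := by
  refine .exE (.exists_approxF_family (x.shift .num) (u.shift .num) (nv 0))
    (.assume fun Δ _ h => ?_)
  rw [Fml.sub_shift]
  refine .exI_sub (.lam (entry (.app ((fv 0).shift .num) (nv 0)) (nv 0))) ?_
  rw [recEqs_sub]
  refine .recEqs_of_approxF ?_
  simp [liftSub_eq, ← Expr.shift_comm]
  exact h

theorem Prov.recFml_of_approxF {t s v : Expr R .num} {u : Expr R .fn}
    (h : Prov T Γ (approxF t u s v)) : Prov T Γ (recFml t u s (entry v s)) := by
  refine .exE_sub (.exists_rec t u) (.assume fun Δ hΔ h₁ => ?_)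
  rw [Fml.shift, recFml_ren]
  rw [recEqs_sub] at h₁
  refine .recFml_intro (fv 0) h₁ (mk_eq.1 ?_)
  change mk (.app (fv 0) (s.shift .fn)) = mk ((entry v s).shift .fn)
  rw [entry_shift]
  exact approxF_eq_rec ((approxF_shift h .fn).mono hΔ) h₁ le_rfl

theorem Expr.family_sub {s : Srt} (e : Expr R s) (b : Expr R .fn) :
    (e.shift .fn).sub (scons .num (.var .num 0)
      (Subst.shift .num (scons .fn b (Subst.shift .fn Expr.var)))) = e.shift .fn := by
  rw [Expr.shift, Expr.sub_ren, Expr.ren_eq_sub]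
  congr 1
  funext s n; cases s <;> cases n <;> rfl

theorem Prov.recFml_congr {x : Expr R .num} {u : Expr R .fn} {y w w' : Expr R .num}
    (h : Prov T Γ (recFml x u y w)) (hw : (mk w : Q T Γ) = mk w') :
    Prov T Γ (recFml x u y w') := by
  have h₁ : Prov T Γ ((recFml (nv 1) (fv 0) (nv 2) (nv 0)).sub
      (scons .num w (env x y y u))) := by rw [recFml_sub]; exact h
  have h₂ := Prov.replace _ ((EqSub.refl (env x y y u)).scons (s := .num) (mk_eq.1 hw)) h₁
  rw [recFml_sub] at h₂
  exact h₂

/-- The values obtained by recursion, uniformly in the number variable with index `0`. -/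
theorem Prov.exists_recFml_family (t : Expr R .num) (u : Expr R .fn) (s : Expr R .num) :
    Prov T Γ (.ex .fn (.all .num (recFml (t.shift .fn) (u.shift .fn) (s.shift .fn)
      (.app (fv 0) (nv 0))))) := by
  refine .exE (.exists_approxF_family t u s) (.assume fun Δ hΔ h => ?_)
  rw [← Fml.sub_var (.ex _ _), Fml.sub_shift]
  refine .exI_sub (.lam (entry (.app (fv 0) (nv 0)) (s.shift .fn))) (.allI_sub ?_)
  rw [recFml_sub, Expr.family_sub, Expr.family_sub, Expr.family_sub]
  exact h.all_var.recFml_of_approxF.recFml_congr (mk_lam_shift_var _).symm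

/-- The values obtained by recursion form a unique function. -/
theorem Prov.exUnique_recFml_family (t : Expr R .num) (u : Expr R .fn) (s : Expr R .num) :
    Prov T Γ (exUniqueFn (.all .num (recFml (t.shift .fn) (u.shift .fn) (s.shift .fn)
      (.app (fv 0) (nv 0))))) := by
  refine .exE (.exists_recFml_family t u s) (.assume fun Δ hΔ h => ?_)
  rw [← Fml.sub_var (exUniqueFn _), Fml.sub_shift]
  refine .exUnique_intro (fv 0) (.allI_sub ?_) fun Δ' hΔ' b' h' => .eqFn_intro ?_
  · rw [recFml_sub, Expr.family_sub, Expr.family_sub, Expr.family_sub]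
    exact h.all_var
  · rw [← Fml.sub_var (.all _ _)] at h
    have h₁ := (((h.shift_sub .fn).mono hΔ').shift_sub .num).allE_sub (nv 0)
    have h₂ := (h'.shift_sub .num).allE_sub (nv 0)
    have e : ∀ {s' : Srt} (e : Expr R s'), (e.shift .fn).sub (scons .num (nv 0)
        (Subst.shift .num (Subst.shift .fn Expr.var))) = (e.shift .fn).sub (scons .num (nv 0)
        (Subst.shift .num (scons .fn b' (Subst.shift .fn (Subst.shift .fn Expr.var))))) := by
      intro s' e
      rw [Expr.shift, Expr.sub_ren, Expr.sub_ren]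
      congr 1
      funext s n; cases s <;> cases n <;> rfl
    rw [recFml_sub] at h₁ h₂
    rw [e, e, e] at h₁
    exact mk_eq.1 (recFml_unique h₁ h₂ rfl (.eqFn_refl _) rfl)

end

/-! ### Claims on definition by recursion -/

instance (r : Expr Empty .num) : HasChoice (IA₁QF r) where
  base := ⟨r, fun _ h => .inl h⟩
  recAx c := c.elim
  choice _ h := .inr h

theorem exists_unique_rec (r : Expr Empty .num) :
    Prov (IA₁QF r) [] (exUniqueFn (recEqs (nv 0) (fv 1) (fv 0))) := by
  have h := Prov.exists_rec (T := IA₁QF r) (Γ := []) (nv 0) (fv 0)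
  refine .exE_sub h (.assume fun Δ hΔ h => ?_)
  rw [← Fml.sub_var (exUniqueFn _), Fml.sub_shift]
  refine .exUnique_intro (fv 0) ?_ fun Δ' hΔ' b' h' => ?_
  · simpa using h
  · rw [recEqs_sub] at h h'
    exact ((recEqs_shift h .fn).mono hΔ').recEqs_unique_fn h'

theorem exists_rec_and_unique (r : Expr Empty .num) :
    Prov (IA₁QF r) [] (.ex .fn (recEqs (nv 0) (fv 1) (fv 0))) ∧
    Prov (IA₁QF r) [] (exUniqueFn (recEqs (nv 0) (fv 1) (fv 0))) ∧
    (∀ (t s : Expr Empty .num) (u : Expr Empty .fn) (e : ℕ → ℕ),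
      Prov (IA₁QF r) [] (exUniqueFn (.all .num
        (recFml (t.sub (wSub e)) (u.sub (wSub e)) (s.sub (wSub e)) (.app (fv 0) (nv 0)))))) := by
  refine ⟨?_, exists_unique_rec r, fun t s u e => ?_⟩
  · have h := Prov.exists_rec (T := IA₁QF r) (Γ := []) (nv 0) (fv 0)
    exact h
  · let σ : Subst Empty
      | .num, n => comp (nv 0) (numeral (e n))
      | .fn, n => fv n
    -- The substitution `wSub e` does not involve the bound variable `γ`.
    have hn : ∀ n : ℕ, (numeral n : Expr Empty .num).shift .fn = numeral n := by
      intro n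
      induction n with
      | zero => rfl
      | succ n ih => rw [numeral, succ_shift, ih]
    have hσ : wSub e = σ.shift .fn := by
      funext s n
      cases s
      · simp [σ, wSub, comp, hn]
      · rfl
    simp only [hσ, ← Expr.sub_shift]
    exact .exUnique_recFml_family _ _ _

/-! ### Graphs of expressions -/

/-- The renaming that raises the number variables by `a` and the function variables by `b`. -/
def up (a b : ℕ) : Srt → ℕ → ℕ
  | .num, n => n + a
  | .fn, n => n + b

/-- `∃x (F(x) & K(x))`, where the variables of `F` other than the one with index `0` are first
renamed by `ρ`. -/
def bnd (s : Srt) (ρ : Srt → ℕ → ℕ) (F K : Fml R) : Fml R := .ex s (.and (F.ren (liftRen s ρ)) K)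

/-- The graph of an expression of a language with additional constants as a formula of any other such
language: the variable with index `0` of the sort of `e` stands for the value, the other variables of
this sort are those of `e`, raised by one. An additional constant is described by the formula
`A(x, α, y, w)`. -/
def Expr.graph {R : Type} (R' : Type) : {s : Srt} → Expr R s → Fml R'
  | _, .var s n => eqE s (.var s 0) (.var s (n + 1))
  | _, .zero => .eq (nv 0) .zero
  | _, .un f => eqFn (fv 0) (.un f)
  | _, .bin f a b => bnd .num (up 1 0) (a.graph R') (bnd .num (up 2 0) (b.graph R')
      (.eq (nv 2) (.bin f (nv 1) (nv 0))))
  | _, .fnl f a u => bnd .num (up 1 0) (a.graph R') (bnd .fn (up 2 0) (u.graph R')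
      (.eq (nv 1) (.fnl f (nv 0) (fv 0))))
  | _, .rcr _ t u s => bnd .num (up 1 0) (t.graph R') (bnd .fn (up 2 0) (u.graph R')
      (bnd .num (up 2 1) (s.graph R') (recFml (nv 1) (fv 0) (nv 0) (nv 2))))
  | _, .app u t => bnd .fn (up 1 0) (u.graph R') (bnd .num (up 1 1) (t.graph R')
      (.eq (nv 1) (.app (fv 0) (nv 0))))
  | _, .lam t => .all .num (bnd .num (up 0 1) (t.graph R') (.eq (nv 0) (.app (fv 0) (nv 1))))

theorem scons_liftRen (s : Srt) (e : Expr R s) (σ : Subst R) (ρ : Srt → ℕ → ℕ) :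
    (fun s' n => scons s e σ s' (liftRen s ρ s' n)) = scons s e (fun s' n => σ s' (ρ s' n)) := by
  funext s' n; cases s <;> cases s' <;> cases n <;> rfl

theorem scons_up_one_zero (a : Expr R .num) (σ : Subst R) :
    (fun s n => scons .num a σ s (up 1 0 s n)) = σ := by
  funext s n; cases s <;> rfl

theorem scons_up_two_zero (a b : Expr R .num) (σ : Subst R) :
    (fun s n => scons .num a (scons .num b σ) s (up 2 0 s n)) = σ := by
  funext s n; cases s <;> rfl

theorem scons_up_one_one (u : Expr R .fn) (b : Expr R .num) (σ : Subst R) :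
    (fun s n => scons .fn u (scons .num b σ) s (up 1 1 s n)) = σ := by
  funext s n; cases s <;> rfl

theorem scons_up_two_one (u : Expr R .fn) (a b : Expr R .num) (σ : Subst R) :
    (fun s n => scons .fn u (scons .num a (scons .num b σ)) s (up 2 1 s n)) = σ := by
  funext s n; cases s <;> rfl

theorem scons_up_zero_one (u : Expr R .fn) (a : Expr R .num) (σ : Subst R) :
    (fun s n => scons .num a (scons .fn u σ) s (up 0 1 s n)) = scons .num a σ := by
  funext s n; cases s <;> cases n <;> rfl

section
variable {T : Set (Fml R)} [hT : IsArith T] {Γ : List (Fml R)}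

theorem Prov.bnd_intro {s : Srt} {ρ : Srt → ℕ → ℕ} {F K : Fml R} {σ : Subst R} (x : Expr R s)
    (h : Prov T Γ (F.sub (scons s x fun s' n => σ s' (ρ s' n))))
    (h' : Prov T Γ (K.sub (scons s x σ))) : Prov T Γ ((bnd s ρ F K).sub σ) := by
  refine .exI_sub x (.andI ?_ h')
  rw [Fml.sub_ren, scons_liftRen]
  exact h

theorem Prov.bnd_elim {s : Srt} {ρ : Srt → ℕ → ℕ} {F K C : Fml R} {σ : Subst R}
    (h : Prov T Γ ((bnd s ρ F K).sub σ))
    (h' : ∀ Δ : List (Fml R), Γ.map (Fml.shift s) ⊆ Δ →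
      Prov T Δ (F.sub (scons s (.var s 0) (Subst.shift s fun s' n => σ s' (ρ s' n)))) →
      Prov T Δ (K.sub (scons s (.var s 0) (σ.shift s))) → Prov T Δ (C.shift s)) :
    Prov T Γ C := by
  refine .exE_sub h (.assume fun Δ hΔ h₁ => h' Δ hΔ ?_ h₁.andE₂)
  have := h₁.andE₁
  rw [Fml.sub_ren, scons_liftRen] at this
  exact this

/-- The value that satisfies `F` is unique. -/
def Functional (T : Set (Fml R)) (s : Srt) (F : Fml R) : Prop :=
  ∀ (Γ : List (Fml R)) (τ : Subst R) (v v' : Expr R s), Prov T Γ (F.sub (scons s v τ)) →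
    Prov T Γ (F.sub (scons s v' τ)) → Prov T Γ (eqE s v v')

/-- If the value satisfying `F` is known, it may be used in `K`. -/
theorem Prov.bnd_use {s : Srt} {ρ : Srt → ℕ → ℕ} {F K : Fml R} {σ : Subst R} (hF : Functional T s F)
    {x : Expr R s} (h : Prov T Γ (F.sub (scons s x fun s' n => σ s' (ρ s' n))))
    (h' : Prov T Γ ((bnd s ρ F K).sub σ)) : Prov T Γ (K.sub (scons s x σ)) := by
  refine .bnd_elim h' fun Δ hΔ h₁ h₂ => ?_
  have h₃ := (h.shift_sub s).mono hΔ
  rw [scons_shift] at h₃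
  rw [Fml.sub_shift, scons_shift]
  exact .replace K ((EqSub.refl _).scons (hF _ _ _ _ h₁ h₃)) h₂

theorem Prov.bnd_map {s : Srt} {ρ : Srt → ℕ → ℕ} {F K F' K' : Fml R} {σ σ' : Subst R}
    (h : Prov T Γ ((bnd s ρ F K).sub σ))
    (h' : ∀ Δ : List (Fml R), Γ.map (Fml.shift s) ⊆ Δ →
      Prov T Δ (F.sub (scons s (.var s 0) (Subst.shift s fun s' n => σ s' (ρ s' n)))) →
      Prov T Δ (K.sub (scons s (.var s 0) (σ.shift s))) →
      Prov T Δ (F'.sub (scons s (.var s 0) (Subst.shift s fun s' n => σ' s' (ρ s' n)))) ∧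
      Prov T Δ (K'.sub (scons s (.var s 0) (σ'.shift s)))) :
    Prov T Γ ((bnd s ρ F' K').sub σ') := by
  refine .bnd_elim h fun Δ hΔ h₁ h₂ => ?_
  obtain ⟨h₃, h₄⟩ := h' Δ hΔ h₁ h₂
  rw [Fml.sub_shift]
  exact .bnd_intro _ h₃ h₄

/-- The number variable with index `k` is determined in `A` by the other variables. -/
def Determined (T : Set (Fml R)) (k : ℕ) (A : Fml R) : Prop :=
  ∀ (Γ : List (Fml R)) (σ σ' : Subst R), (∀ n, n ≠ k → σ .num n = σ' .num n) →
    (∀ n, σ .fn n = σ' .fn n) → Prov T Γ (A.sub σ) → Prov T Γ (A.sub σ') →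
    Prov T Γ (.eq (σ .num k) (σ' .num k))

/-- The condition `Determined` is stable under the binders in a graph, unlike `Functional`, and is
therefore what an induction over nested `bnd` carries along. -/
theorem Determined.functional {F : Fml R} (h : Determined T 0 F) : Functional T .num F :=
  fun Γ τ v v' h₁ h₂ => h Γ (scons .num v τ) (scons .num v' τ)
    (fun n hn => by cases n <;> simp_all) (fun n => rfl) h₁ h₂

theorem Determined.bnd {s : Srt} {ρ : Srt → ℕ → ℕ} {F K : Fml R} {k : ℕ} (hF : Functional T s F)
    (hρ : ∀ n, ρ .num n ≠ k) (hK : Determined T (shiftRen s .num k) K) :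
    Determined T k (bnd s ρ F K) := by
  intro Γ σ σ' h₁ h₂ h h'
  refine .bnd_elim h fun Δ hΔ h₃ h₄ => ?_
  have h₅ := (h'.shift_sub s).mono hΔ
  have e : (Subst.shift s fun s' n => σ s' (ρ s' n)) = fun s' n => σ'.shift s s' (ρ s' n) := by
    funext s' n
    cases s'
    · simp [h₁ _ (hρ n)]
    · simp [h₂]
  rw [e] at h₃
  have h₆ := Prov.bnd_use hF h₃ h₅
  have := hK Δ _ _ (fun n hn => ?_) (fun n => ?_) h₄ h₆
  · cases s <;> exact this
  · cases s
    · cases n with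
      | zero => rfl
      | succ n => simp [h₁ n (fun h => hn (by simp [h, shiftRen]))]
    · simp [h₁ n (fun h => hn (by simp [h, shiftRen]))]
  · cases s
    · simp [h₂]
    · cases n with
      | zero => rfl
      | succ n => simp [h₂]

theorem Determined.eq {k : ℕ} {t : Expr R .num} (ht : ∀ σ σ' : Subst R,
    (∀ n, n ≠ k → σ .num n = σ' .num n) → (∀ n, σ .fn n = σ' .fn n) → t.sub σ = t.sub σ') :
    Determined T k (.eq (nv k) t) := by
  intro Γ σ σ' h₁ h₂ h h'
  have e := ht σ σ' h₁ h₂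
  simp only [Fml.sub, nv_sub, e] at h h'
  exact h.eq_trans h'.eq_symm

/-- The value of an expression is unique. -/
theorem Expr.graph_functional {R₀ : Type} {s : Srt} (e : Expr R₀ s) : Functional T s (e.graph R) := by
  induction e with
  | var s n =>
    intro Γ τ v v' h h'
    rw [graph, eqE_sub] at h h'
    have e₁ : ∀ v : Expr R s, (Expr.var s 0).sub (scons s v τ) = v := by
      intro v; cases s <;> rfl
    have e₂ : ∀ v : Expr R s, (Expr.var s (n + 1)).sub (scons s v τ) = τ s n := by
      intro v; cases s <;> rfl
    rw [e₁, e₂] at h h'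
    exact h.eqE_trans h'.eqE_symm
  | zero => exact (Determined.eq fun _ _ _ _ => rfl).functional
  | un f =>
    intro Γ τ v v' h h'
    rw [graph, eqFn_sub] at h h'
    exact h.eqFn_trans h'.eqFn_symm
  | bin f a b iha ihb =>
    refine (Determined.bnd iha (fun n => by simp [up]) (.bnd ihb (fun n => by simp [up, shiftRen])
      (.eq fun σ σ' h₁ h₂ => ?_))).functional
    simp [h₁ 0 (by simp [shiftRen]), h₁ 1 (by simp [shiftRen])]
  | fnl f a u iha ihu =>
    refine (Determined.bnd iha (fun n => by simp [up]) (.bnd ihu (fun n => by simp [up, shiftRen])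
      (.eq fun σ σ' h₁ h₂ => ?_))).functional
    simp [h₁ 0 (by simp [shiftRen]), h₂]
  | rcr c t u s iht ihu ihs =>
    refine (Determined.bnd iht (fun n => by simp [up]) (.bnd ihu (fun n => by simp [up, shiftRen])
      (.bnd ihs (fun n => by simp [up, shiftRen]) ?_))).functional
    intro Γ σ σ' h₁ h₂ h h'
    rw [recFml_sub] at h h'
    have e₁ := h₁ 0 (by simp [shiftRen])
    have e₂ := h₁ 1 (by simp [shiftRen])
    simp only [nv_sub, fv_sub, e₁, e₂, h₂] at h h'
    exact mk_eq.1 (recFml_unique h h' rfl (.eqFn_refl _) rfl)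
  | app u t ihu iht =>
    refine (Determined.bnd ihu (fun n => by simp [up]) (.bnd iht (fun n => by simp [up, shiftRen])
      (.eq fun σ σ' h₁ h₂ => ?_))).functional
    simp [h₁ 0 (by simp [shiftRen]), h₂]
  | lam t ih =>
    intro Γ τ v v' h h'
    refine .eqFn_intro ?_
    have h₁ := (h.shift_sub .num).allE_sub (nv 0)
    have h₂ := (h'.shift_sub .num).allE_sub (nv 0)
    refine .bnd_elim h₁ fun Δ hΔ h₃ h₄ => ?_
    have h₅ := (h₂.shift_sub .num).mono hΔ
    have h₆ := Prov.bnd_use ih (x := nv 0) (by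
      simp only [scons_shift, scons_up_zero_one] at h₃ ⊢
      exact h₃) h₅
    simp [scons_shift] at h₄ h₆
    exact h₄.eq_symm.eq_trans h₆

/-- In a system with the additional constants, every expression has itself as value. -/
theorem Expr.graph_self {s : Srt} (e : Expr R s) (τ : Subst R) :
    Prov T Γ ((e.graph R).sub (scons s (e.sub τ) τ)) := by
  induction e generalizing Γ τ with
  | var s n =>
    rw [graph, eqE_sub]
    cases s <;> exact .eqE_refl _
  | zero => exact .eq_refl _
  | un f => rw [graph, eqFn_sub]; exact .eqFn_refl _
  | bin f a b iha ihb =>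
    refine .bnd_intro (a.sub τ) ?_ (.bnd_intro (b.sub τ) ?_ (.eq_refl _))
    · rw [scons_up_one_zero]; exact iha τ
    · rw [scons_up_two_zero]; exact ihb τ
  | fnl f a u iha ihu =>
    refine .bnd_intro (a.sub τ) ?_ (.bnd_intro (u.sub τ) ?_ (.eq_refl _))
    · rw [scons_up_one_zero]; exact iha τ
    · rw [scons_up_two_zero]; exact ihu τ
  | rcr c t u s iht ihu ihs =>
    refine .bnd_intro (t.sub τ) ?_ (.bnd_intro (u.sub τ) ?_ (.bnd_intro (s.sub τ) ?_ ?_))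
    · rw [scons_up_one_zero]; exact iht τ
    · rw [scons_up_two_zero]; exact ihu τ
    · rw [scons_up_two_one]; exact ihs τ
    · have := (hT.recAx c).sub_nil (env (t.sub τ) (s.sub τ) (s.sub τ) (u.sub τ))
      rw [recFml_sub] at this ⊢
      exact this.of_nil
  | app u t ihu iht =>
    refine .bnd_intro (u.sub τ) ?_ (.bnd_intro (t.sub τ) ?_ (.eq_refl _))
    · rw [scons_up_one_zero]; exact ihu τ
    · rw [scons_up_one_one]; exact iht τ
  | lam t ih =>
    refine .allI_sub (.bnd_intro (t.sub (liftSub .num τ)) ?_ ?_)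
    · rw [scons_shift, scons_up_zero_one, liftSub_eq]
      exact ih _
    · exact (Prov.lam_shift_app _).eq_symm

end

/-! ### Values under substitution -/

theorem bnd_ren {s : Srt} {ρ₀ ρ ρ' : Srt → ℕ → ℕ} (F K : Fml R)
    (h : (fun s n => ρ' s (ρ₀ s n)) = fun s n => ρ₀ s (ρ s n)) :
    (bnd s ρ₀ F K).ren ρ' = bnd s ρ₀ (F.ren (liftRen s ρ)) (K.ren (liftRen s ρ')) := by
  simp only [bnd, Fml.ren, Fml.ren_ren, ← liftRen_comp, h]

theorem Expr.graph_ren {s : Srt} (e : Expr R₁ s) (ρ : Srt → ℕ → ℕ) :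
    (e.ren ρ).graph R = (e.graph R).ren (liftRen s ρ) := by
  have h1 : ∀ ρ : Srt → ℕ → ℕ, (fun s n => liftRen .num ρ s (up 1 0 s n)) = fun s n => up 1 0 s (ρ s n) := by
    intro ρ; funext s n; cases s <;> rfl
  have h2 : ∀ ρ : Srt → ℕ → ℕ, (fun s n => liftRen .num (liftRen .num ρ) s (up 2 0 s n)) =
      fun s n => up 2 0 s (ρ s n) := by
    intro ρ; funext s n; cases s <;> rfl
  have h3 : ∀ ρ : Srt → ℕ → ℕ, (fun s n => liftRen .fn (liftRen .num (liftRen .num ρ)) s (up 2 1 s n)) =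
      fun s n => up 2 1 s (ρ s n) := by
    intro ρ; funext s n; cases s <;> rfl
  have h4 : ∀ ρ : Srt → ℕ → ℕ, (fun s n => liftRen .fn (liftRen .num ρ) s (up 1 1 s n)) =
      fun s n => up 1 1 s (ρ s n) := by
    intro ρ; funext s n; cases s <;> rfl
  have h5 : ∀ ρ : Srt → ℕ → ℕ, (fun s n => liftRen .num (liftRen .fn ρ) s (up 0 1 s n)) =
      fun s n => up 0 1 s (liftRen .num ρ s n) := by
    intro ρ; funext s n; cases s <;> cases n <;> rfl
  induction e generalizing ρ with
  | var s n => rw [Expr.ren, graph, graph, eqE_ren]; cases s <;> rfl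
  | zero => rfl
  | un f => rfl
  | bin f a b iha ihb =>
    rw [Expr.ren, graph, graph, bnd_ren _ _ (h1 ρ), bnd_ren _ _ (h2 ρ), iha, ihb]
    rfl
  | fnl f a u iha ihu =>
    rw [Expr.ren, graph, graph, bnd_ren _ _ (h1 ρ), bnd_ren _ _ (h2 ρ), iha, ihu]
    rfl
  | rcr c t u s iht ihu ihs =>
    rw [Expr.ren, graph, graph, bnd_ren _ _ (h1 ρ), bnd_ren _ _ (h2 ρ), bnd_ren _ _ (h3 ρ), iht, ihu, ihs,
      recFml_ren]
    rfl
  | app u t ihu iht =>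
    rw [Expr.ren, graph, graph, bnd_ren _ _ (h1 ρ), bnd_ren _ _ (h4 ρ), ihu, iht]
    rfl
  | lam t ih =>
    rw [Expr.ren, graph, graph, Fml.ren, bnd_ren _ _ (h5 ρ), ih]
    rfl

theorem Expr.graph_map {s : Srt} (ι : R₁ ↪ R₂) (e : Expr R₁ s) :
    (e.map ι).graph R = e.graph R := by
  induction e <;> simp_all [Expr.map, Expr.graph]

section
variable {T : Set (Fml R)} [hT : IsArith T] {Γ : List (Fml R)}

/-- In the environment `κ`, the expressions `σ` have the values `τ`. -/
def Values (T : Set (Fml R)) (Γ : List (Fml R)) (σ : Subst R₁) (τ κ : Subst R) : Prop :=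
  ∀ s n, Prov T Γ (((σ s n).graph R).sub (scons s (τ s n) κ))

theorem Values.shift {σ : Subst R₁} {τ κ : Subst R} (h : Values T Γ σ τ κ) (s : Srt)
    {Δ : List (Fml R)} (hs : Γ.map (Fml.shift s) ⊆ Δ) : Values T Δ σ (τ.shift s) (κ.shift s) := by
  intro s' n
  have := ((h s' n).shift_sub s).mono hs
  rw [scons_shift] at this
  exact this

theorem Expr.graph_shift_sub {s' : Srt} (s : Srt) (e : Expr R₁ s') (v : Expr R s') (x : Expr R s)
    (κ : Subst R) : ((e.shift s).graph R).sub (scons s' v (scons s x κ)) =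
      (e.graph R).sub (scons s' v κ) := by
  rw [Expr.shift, Expr.graph_ren, Fml.sub_ren, scons_liftRen, scons_shiftRen]

theorem Expr.graph_var {s : Srt} (n : ℕ) (κ : Subst R) :
    Prov T Γ (((Expr.var s n : Expr R₁ s).graph R).sub (scons s (κ s n) κ)) := by
  rw [graph, eqE_sub]
  cases s <;> exact .eqE_refl _

theorem Values.scons {σ : Subst R₁} {τ κ : Subst R} (h : Values T Γ σ τ κ) {s : Srt}
    (x : Expr R s) : Values T Γ (liftSub s σ) (scons s x τ) (scons s x κ) := by
  intro s' n
  have h₁ : ∀ s' n, Prov T Γ ((((σ s' n).shift s).graph R).sub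
      (TwoSortedArith.scons s' (τ s' n) (TwoSortedArith.scons s x κ))) := by
    intro s' n; rw [Expr.graph_shift_sub]; exact h s' n
  cases s <;> cases s' <;> cases n <;>
    first | exact h₁ _ _ | exact Expr.graph_var (κ := TwoSortedArith.scons _ x κ) 0

/-- The values of `σ` and the value of an expression at these values make up its value under the
substitution `σ`. -/
theorem Values.graph_sub {σ : Subst R₁} {τ κ : Subst R} (h : Values T Γ σ τ κ) {s : Srt}
    (e : Expr R₁ s) {v : Expr R s} (h' : Prov T Γ ((e.graph R).sub (TwoSortedArith.scons s v τ))) :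
    Prov T Γ (((e.sub σ).graph R).sub (TwoSortedArith.scons s v κ)) := by
  induction e generalizing Γ σ τ κ with
  | var s n =>
    rw [Expr.graph, eqE_sub] at h'
    have e₁ : (Expr.var s 0).sub (TwoSortedArith.scons s v τ) = v := by cases s <;> rfl
    have e₂ : (Expr.var s (n + 1)).sub (TwoSortedArith.scons s v τ) = τ s n := by cases s <;> rfl
    rw [e₁, e₂] at h'
    exact .replace _ ((EqSub.refl _).scons h'.eqE_symm) (h s n)
  | zero => exact h'
  | un f => exact h'
  | bin f a b iha ihb =>
    refine .bnd_map h' fun Δ hΔ h₁ h₂ => ⟨?_, .bnd_map h₂ fun Δ' hΔ' h₃ h₄ => ⟨?_, h₄⟩⟩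
    · rw [scons_up_one_zero] at h₁ ⊢
      exact iha (h.shift _ hΔ) h₁
    · simp only [scons_shift, scons_up_two_zero] at h₃ ⊢
      exact ihb ((h.shift _ hΔ).shift _ hΔ') h₃
  | fnl f a u iha ihu =>
    refine .bnd_map h' fun Δ hΔ h₁ h₂ => ⟨?_, .bnd_map h₂ fun Δ' hΔ' h₃ h₄ => ⟨?_, h₄⟩⟩
    · rw [scons_up_one_zero] at h₁ ⊢
      exact iha (h.shift _ hΔ) h₁
    · simp only [scons_shift, scons_up_two_zero] at h₃ ⊢
      exact ihu ((h.shift _ hΔ).shift _ hΔ') h₃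
  | rcr c t u s iht ihu ihs =>
    refine .bnd_map h' fun Δ hΔ h₁ h₂ => ⟨?_, .bnd_map h₂ fun Δ' hΔ' h₃ h₄ => ⟨?_,
      .bnd_map h₄ fun Δ₂ hΔ₂ h₅ h₆ => ⟨?_, ?_⟩⟩⟩
    · rw [scons_up_one_zero] at h₁ ⊢
      exact iht (h.shift _ hΔ) h₁
    · simp only [scons_shift, scons_up_two_zero] at h₃ ⊢
      exact ihu ((h.shift _ hΔ).shift _ hΔ') h₃
    · simp only [scons_shift, scons_up_two_one] at h₅ ⊢
      exact ihs (((h.shift _ hΔ).shift _ hΔ').shift _ hΔ₂) h₅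
    · rw [recFml_sub] at h₆ ⊢
      exact h₆
  | app u t ihu iht =>
    refine .bnd_map h' fun Δ hΔ h₁ h₂ => ⟨?_, .bnd_map h₂ fun Δ' hΔ' h₃ h₄ => ⟨?_, h₄⟩⟩
    · rw [scons_up_one_zero] at h₁ ⊢
      exact ihu (h.shift _ hΔ) h₁
    · simp only [scons_shift, scons_up_one_one] at h₃ ⊢
      exact iht ((h.shift _ hΔ).shift _ hΔ') h₃
  | lam t ih =>
    refine .allI_sub (.bnd_map ((h'.shift_sub .num).allE_sub (nv 0)) fun Δ hΔ h₁ h₂ => ⟨?_, h₂⟩)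
    simp only [scons_shift, scons_up_zero_one] at h₁ ⊢
    exact ih (((h.shift .num (List.Subset.refl _)).shift _ hΔ).scons _) h₁

/-- The expressions of the smaller language are their own values. -/
theorem Values.map (ι : R ↪ R₁) (σ : Subst R) :
    Values T Γ (fun s n => (σ s n).map ι) σ Expr.var := by
  intro s n
  have := (σ s n).graph_self (T := T) (Γ := Γ) Expr.var
  rwa [Expr.sub_var, ← Expr.graph_map ι] at this

end

/-! ### Existence of values -/

/-- The value with argument `w` of the family of numbers, or of functions, coded by `δ`. -/
def valOf : (s : Srt) → Expr R .fn → Expr R .num → Expr R s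
  | .num, δ, w => .app δ w
  | .fn, δ, w => .lam (.app (δ.shift .num) (opair (w.shift .num) (nv 0)))

/-- A code of the family of numbers, or of functions, that is given by an expression in which the
number variable with index `0` is the argument. -/
def family : (s : Srt) → Expr R s → Expr R .fn
  | .num, x => .lam x
  | .fn, u => .lam (.app (u.sub (scons .num (pfst (nv 0)) (Subst.shift .num Expr.var)))
      (psnd (nv 0)))

theorem valOf_sub (s : Srt) (δ : Expr R .fn) (w : Expr R .num) (σ : Subst R) :
    (valOf s δ w).sub σ = valOf s (δ.sub σ) (w.sub σ) := by
  cases s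
  · rfl
  · simp [valOf, Expr.sub, Expr.shift_sub_lift, liftSub]

section
variable {T : Set (Fml R)} [hT : IsArith T] {Γ : List (Fml R)}

theorem Prov.valOf_family {s : Srt} (x : Expr R s) :
    Prov T Γ (eqE s x (valOf s ((family s x).shift .num) (nv 0))) := by
  cases s with
  | num => exact mk_eq.1 (mk_lam_shift_var x).symm
  | fn =>
    refine .eqFn_symm (.eqFn_intro (.eq_trans (Prov.lam_shift_app _) ?_))
    rw [family, ← Expr.sub_var_shift, ← Expr.sub_var_shift, Expr.sub_sub]
    refine .eq_trans (Prov.lam_conv_sub _ _ _) ?_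
    rw [app_sub, Expr.sub_sub, psnd_sub, nv_sub, scons_num_zero, nv_shift_num]
    refine mk_eq.1 (mk_app_congr (u := _) ?_ (mk_psnd _ _))
    rw [← Expr.sub_var_shift]
    refine Prov.sub_congr (s := .fn) x fun s n => ?_
    cases s
    · cases n with
      | zero =>
        rw [scons_num_zero, pfst_sub, nv_sub, scons_num_zero]
        exact mk_eq.1 (mk_pfst _ _)
      | succ n => exact .eq_refl _
    · exact .eqFn_refl _

/-- `δ` codes a family of values satisfying `F` at all arguments. -/
def Rep (T : Set (Fml R)) (Γ : List (Fml R)) (s : Srt) (F : Fml R) (τ : Subst R)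
    (δ : Expr R .fn) : Prop :=
  Prov T (Γ.map (Fml.shift .num)) (F.sub (scons s (valOf s (δ.shift .num) (nv 0)) τ))

/-- The formula stating that some function codes a family of values satisfying `F` at all arguments;
in `τ` the number variable with index `0` is the argument. -/
def repEx (s : Srt) (F : Fml R) (τ : Subst R) : Fml R :=
  .ex .fn (.all .num (F.sub (scons s (valOf s (fv 0) (nv 0)) (τ.shift .fn))))

theorem Subst.shift_comm (τ : Subst R) :
    Subst.shift .fn (Subst.shift .num τ) = Subst.shift .num (Subst.shift .fn τ) := by
  funext s n; exact Expr.shift_comm _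

theorem repEx_shift (s : Srt) (F : Fml R) (τ : Subst R) :
    (repEx s F τ).shift .fn = repEx s F (τ.shift .fn) := by
  have e : ∀ {s} (e : Expr R s), ((e.shift .fn).ren (liftRen .num (liftRen .fn (shiftRen .fn)))) =
      (e.shift .fn).shift .fn := by
    intro s e
    simp only [Expr.shift, Expr.ren_ren]
    congr 1
    funext s n; cases s
    · cases n <;> rfl
    · rfl
  rw [repEx, Fml.shift, Fml.ren, Fml.ren, Fml.ren_sub, repEx]
  congr 3
  funext s' n
  cases s <;> cases s' <;> cases n <;> first | exact e _ | rfl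

theorem Rep.repEx {s : Srt} {F : Fml R} {τ : Subst R} {δ : Expr R .fn} (h : Rep T Γ s F τ δ) :
    Prov T Γ (repEx s F τ) := by
  rw [← Fml.sub_var (TwoSortedArith.repEx _ _ _)]
  refine .exI_sub δ (.allI_sub ?_)
  have e : (fun s' n => (scons s (valOf s (fv 0) (nv 0)) (τ.shift .fn) s' n).sub
      (scons .num (.var .num 0) (Subst.shift .num (scons .fn δ Expr.var)))) =
      scons s (valOf s (δ.shift .num) (nv 0)) τ := by
    rw [scons_sub, valOf_sub]
    congr 1
    funext s' n
    rw [Subst.shift_apply, scons_shift, Expr.shift, Expr.sub_ren]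
    refine (congrArg _ ?_).trans (Expr.sub_var _)
    funext s n; cases s <;> cases n <;> rfl
  rw [Fml.sub_sub, e]
  exact h

theorem Prov.repEx_intro {s : Srt} {F : Fml R} {τ : Subst R} (x : Expr R s)
    (h : Prov T (Γ.map (Fml.shift .num)) (F.sub (scons s x τ))) : Prov T Γ (TwoSortedArith.repEx s F τ) :=
  Rep.repEx (δ := family s x) (.replace F ((EqSub.refl _).scons (.valOf_family x)) h)

theorem Prov.repEx_elim {s : Srt} {F C : Fml R} {τ : Subst R} (h : Prov T Γ (repEx s F τ))
    (h' : ∀ Δ : List (Fml R), Γ.map (Fml.shift .fn) ⊆ Δ → Rep T Δ s F (τ.shift .fn) (fv 0) →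
      Prov T Δ (C.shift .fn)) : Prov T Γ C :=
  .exE h (.assume fun Δ hΔ h₁ => h' Δ hΔ h₁.all_var)

theorem Rep.shift {s : Srt} {F : Fml R} {τ : Subst R} {δ : Expr R .fn} (h : Rep T Γ s F τ δ)
    {Δ : List (Fml R)} (hs : Γ.map (Fml.shift .fn) ⊆ Δ) :
    Rep T Δ s F (τ.shift .fn) (δ.shift .fn) := by
  have h₁ := h.shift_sub .fn
  rw [scons_shift] at h₁
  have e : (valOf s (δ.shift .num) (nv 0)).shift .fn =
      valOf s ((δ.shift .fn).shift .num) (nv 0) := by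
    rw [← Expr.sub_var_shift, valOf_sub, Expr.sub_var_shift, Expr.shift_comm]
    rfl
  rw [e] at h₁
  refine h₁.mono ?_
  have : (Γ.map (Fml.shift .num)).map (Fml.shift .fn) =
      (Γ.map (Fml.shift .fn)).map (Fml.shift .num) := by
    simp only [List.map_map]
    congr 1
    funext A
    simp only [Function.comp, Fml.shift, Fml.ren_ren]
    congr 1
    funext s n; cases s <;> rfl
  rw [this]
  exact List.map_subset _ hs

end

section
variable {T : Set (Fml R)} [hT : HasChoice T] {Γ : List (Fml R)}

/-- Every expression of a language with additional constants has a value, and the values for all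
arguments are given by one function. The uniformity carries the induction through `λ`, where the
argument is a pair of the given argument and the argument of the function, and through the additional
constants, where it takes the uniform definition by recursion. -/
theorem Expr.repEx_graph {s : Srt} (e : Expr R₁ s) (τ : Subst R) :
    Prov T Γ (repEx s (e.graph R) τ) := by
  induction e generalizing Γ τ with
  | var s n => exact .repEx_intro (τ s n) (Expr.graph_var n τ)
  | zero => exact .repEx_intro .zero (.eq_refl _)
  | un f => exact .repEx_intro (.un f) (by rw [graph, eqFn_sub]; exact .eqFn_refl _)
  | bin f a b iha ihb =>
    refine .repEx_elim (iha τ) fun Δ hΔ h₁ => .repEx_elim (ihb (τ.shift .fn)) fun Δ' hΔ' h₂ => ?_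
    rw [repEx_shift, repEx_shift]
    refine .repEx_intro (.bin f (.app (fv 1) (nv 0)) (.app (fv 0) (nv 0)))
      (.bnd_intro (.app (fv 1) (nv 0)) ?_ (.bnd_intro (.app (fv 0) (nv 0)) ?_ (.eq_refl _)))
    · rw [scons_up_one_zero]; exact h₁.shift hΔ'
    · rw [scons_up_two_zero]; exact h₂
  | fnl f a u iha ihu =>
    refine .repEx_elim (iha τ) fun Δ hΔ h₁ => .repEx_elim (ihu (τ.shift .fn)) fun Δ' hΔ' h₂ => ?_
    rw [repEx_shift, repEx_shift]
    refine .repEx_intro (.fnl f (.app (fv 1) (nv 0)) (valOf .fn (fv 0) (nv 0)))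
      (.bnd_intro (.app (fv 1) (nv 0)) ?_ (.bnd_intro (valOf .fn (fv 0) (nv 0)) ?_ (.eq_refl _)))
    · rw [scons_up_one_zero]; exact h₁.shift hΔ'
    · rw [scons_up_two_zero]; exact h₂
  | app u t ihu iht =>
    refine .repEx_elim (ihu τ) fun Δ hΔ h₁ => .repEx_elim (iht (τ.shift .fn)) fun Δ' hΔ' h₂ => ?_
    rw [repEx_shift, repEx_shift]
    refine .repEx_intro (.app (valOf .fn (fv 1) (nv 0)) (.app (fv 0) (nv 0)))
      (.bnd_intro (valOf .fn (fv 1) (nv 0)) ?_ (.bnd_intro (.app (fv 0) (nv 0)) ?_ (.eq_refl _)))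
    · rw [scons_up_one_zero]; exact h₁.shift hΔ'
    · rw [scons_up_one_one]; exact h₂
  | rcr c t u s iht ihu ihs =>
    refine .repEx_elim (iht τ) fun Δ hΔ h₁ => .repEx_elim (ihu (τ.shift .fn)) fun Δ' hΔ' h₂ =>
      .repEx_elim (ihs ((τ.shift .fn).shift .fn)) fun Δ₂ hΔ₂ h₃ => ?_
    rw [repEx_shift, repEx_shift, repEx_shift]
    refine .exE (.exists_recFml_family (.app (fv 2) (nv 0)) (valOf .fn (fv 1) (nv 0))
      (.app (fv 0) (nv 0))) (.assume fun Δ₃ hΔ₃ h₄ => ?_)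
    rw [repEx_shift]
    refine .repEx_intro (.app (fv 0) (nv 0))
      (.bnd_intro (.app (fv 3) (nv 0)) ?_ (.bnd_intro (valOf .fn (fv 2) (nv 0)) ?_
        (.bnd_intro (.app (fv 1) (nv 0)) ?_ ?_)))
    · rw [scons_up_one_zero]; exact ((h₁.shift hΔ').shift hΔ₂).shift hΔ₃
    · rw [scons_up_two_zero]; exact (h₂.shift hΔ₂).shift hΔ₃
    · rw [scons_up_two_one]; exact h₃.shift hΔ₃
    · rw [recFml_sub]
      exact h₄.all_var
  | lam t ih =>
    have h₁ := ih (Γ := Γ) (scons .num (psnd (nv 0))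
      fun s n => (τ s n).sub (scons .num (pfst (nv 0)) (Subst.shift .num Expr.var)))
    refine .repEx_elim h₁ fun Δ hΔ h₂ => ?_
    rw [repEx_shift]
    refine .repEx_intro (.lam (.app (fv 0) (opair (nv 1) (nv 0)))) (.allI_sub
      (.bnd_intro (.app (fv 0) (opair (nv 1) (nv 0))) ?_ (Prov.lam_shift_app _).eq_symm))
    rw [scons_shift, scons_up_zero_one]
    -- The family is taken at the pair of the given argument and the bound variable.
    have h₃ := Prov.sub h₂ (scons .num (opair (nv 1) (nv 0))
      (Subst.shift .num (Subst.shift .num Expr.var)))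
    have hΔ' : (Δ.map (Fml.shift .num)).map (Fml.sub · (scons .num (opair (nv 1) (nv 0))
        (Subst.shift .num (Subst.shift .num Expr.var)))) =
        (Δ.map (Fml.shift .num)).map (Fml.shift .num) := by
      simp only [List.map_map]
      congr 1
      funext A
      simp only [Function.comp, Fml.shift_sub, ← Fml.sub_shift, Fml.sub_var]
    rw [hΔ', Fml.sub_sub] at h₃
    have key : ∀ {s : Srt} (e : Expr R s), Prov T ((Δ.map (Fml.shift .num)).map (Fml.shift .num))
        (eqE s (((e.sub (scons .num (pfst (nv 0)) (Subst.shift .num Expr.var))).shift .fn).sub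
          (scons .num (opair (nv 1) (nv 0)) (Subst.shift .num (Subst.shift .num Expr.var))))
          ((e.shift .fn).shift .num)) := by
      intro s e
      rw [Expr.sub_shift, Expr.sub_sub, ← Expr.sub_var_shift .fn e, Expr.sub_shift]
      refine Prov.sub_congr e fun s n => ?_
      cases s with
      | num =>
        cases n with
        | zero =>
          rw [scons_shift, scons_num_zero, ← Expr.sub_var_shift, pfst_sub, pfst_sub]
          exact mk_eq.1 (mk_pfst _ _)
        | succ n => exact .eq_refl _
      | fn => exact .eqFn_refl _
    refine .replace _ (fun s n => ?_) h₃
    cases s with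
    | num =>
      match n with
      | 0 => exact .eq_refl _
      | 1 =>
        change Prov T _ (.eq (((psnd (nv 0)).shift .fn).sub _) _)
        rw [← Expr.sub_var_shift]
        simp
        exact mk_eq.1 (mk_psnd _ _)
      | n + 2 => exact key (τ .num n)
    | fn => exact key (τ .fn n)

/-- The expressions of a language with additional constants have values. -/
theorem Expr.exists_value {s : Srt} (e : Expr R₁ s) (τ : Subst R) {C : Fml R}
    (h : ∀ Δ : List (Fml R), Γ.map (Fml.shift s) ⊆ Δ →
      Prov T Δ ((e.graph R).sub (scons s (.var s 0) (τ.shift s))) → Prov T Δ (C.shift s)) :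
    Prov T Γ C := by
  have key : Prov T Γ ((Fml.ex s (e.graph R)).sub τ) := by
    refine .repEx_elim (e.repEx_graph (τ.shift .num)) fun Δ hΔ h₁ => ?_
    have h₂ := Prov.allE .zero (Prov.allI (Prov.exI_sub (σ := Subst.shift .num (τ.shift .fn))
      (A := e.graph R) _ (by rw [← Subst.shift_comm]; exact h₁)))
    rw [← Fml.sub_shift, Fml.inst_eq, Fml.shift_sub, Fml.sub_var] at h₂
    rw [Fml.sub_shift]
    exact h₂
  exact .exE_sub key (.assume h)

end

/-! ### Elimination of the additional constants -/

/-- The expression, if no additional constant occurs in it. -/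
def Expr.strip : {s : Srt} → Expr R s → Option (Expr Empty s)
  | _, .var s n => some (.var s n)
  | _, .zero => some .zero
  | _, .un f => some (.un f)
  | _, .bin f a b => a.strip.bind fun a' => b.strip.map (.bin f a')
  | _, .fnl f a u => a.strip.bind fun a' => u.strip.map (.fnl f a')
  | _, .rcr _ _ _ _ => none
  | _, .app u t => u.strip.bind fun u' => t.strip.map (.app u')
  | _, .lam t => t.strip.map .lam

/-- The translation of an equation: it is unchanged if no additional constant occurs in it, and
otherwise states that both sides have a common value. -/
def trEq (a b : Expr R .num) : Fml Empty :=
  match a.strip, b.strip with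
  | some a', some b' => .eq a' b'
  | _, _ => .ex .num (.and (a.graph Empty) (b.graph Empty))

/-- The elimination of the additional constants from a formula. -/
def tr : Fml R → Fml Empty
  | .eq a b => trEq a b
  | .and A B => .and (tr A) (tr B)
  | .or A B => .or (tr A) (tr B)
  | .imp A B => .imp (tr A) (tr B)
  | .neg A => .neg (tr A)
  | .all s A => .all s (tr A)
  | .ex s A => .ex s (tr A)

theorem Expr.strip_map {s : Srt} (ι : Empty ↪ R) (e : Expr Empty s) : (e.map ι).strip = some e := by
  induction e with
  | rcr c => exact c.elim
  | _ => simp_all [Expr.map, Expr.strip]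

theorem tr_map (ι : Empty ↪ R) (E : Fml Empty) : tr (E.map ι) = E := by
  induction E <;> simp_all [Fml.map, tr, trEq, Expr.strip_map]

theorem Expr.map_of_strip {s : Srt} (ι : Empty ↪ R) {e : Expr R s} {e' : Expr Empty s}
    (h : e.strip = some e') : e'.map ι = e := by
  induction e with
  | rcr c => simp [Expr.strip] at h
  | bin f a b iha ihb | fnl f a b iha ihb | app a b iha ihb =>
    simp only [Expr.strip, Option.bind_eq_some_iff, Option.map_eq_some_iff] at h
    obtain ⟨a', ha, b', hb, rfl⟩ := h
    simp [Expr.map, iha ha, ihb hb]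
  | lam t ih =>
    simp only [Expr.strip, Option.map_eq_some_iff] at h
    obtain ⟨t', ht, rfl⟩ := h
    simp [Expr.map, ih ht]
  | _ => simp only [Expr.strip, Option.some.injEq] at h; subst h; rfl

theorem Expr.strip_ren {s : Srt} (e : Expr R s) (ρ : Srt → ℕ → ℕ) :
    (e.ren ρ).strip = e.strip.map (·.ren ρ) := by
  induction e generalizing ρ with
  | bin f a b iha ihb | fnl f a b iha ihb | app a b iha ihb =>
    simp only [Expr.ren, Expr.strip, iha, ihb]
    cases a.strip <;> cases b.strip <;> rfl
  | lam t ih =>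
    simp only [Expr.ren, Expr.strip, ih]
    cases t.strip <;> rfl
  | _ => rfl

theorem trEq_ren (a b : Expr R .num) (ρ : Srt → ℕ → ℕ) :
    trEq (a.ren ρ) (b.ren ρ) = (trEq a b).ren ρ := by
  simp only [trEq, Expr.strip_ren, Expr.graph_ren]
  cases a.strip <;> cases b.strip <;> rfl

theorem tr_ren (E : Fml R) (ρ : Srt → ℕ → ℕ) : tr (E.ren ρ) = (tr E).ren ρ := by
  induction E generalizing ρ <;> simp_all [Fml.ren, tr, trEq_ren]

theorem tr_shift (E : Fml R) (s : Srt) : tr (E.shift s) = (tr E).shift s := tr_ren _ _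

theorem map_tr_shift (Γ : List (Fml R)) (s : Srt) :
    (Γ.map (Fml.shift s)).map tr = (Γ.map tr).map (Fml.shift s) := by
  simp [tr_shift]

section
variable {T : Set (Fml Empty)} [hT : HasChoice T] {Γ : List (Fml Empty)}

/-- The translation of an equation expresses the equality of the values. -/
theorem trEq_iff {a b : Expr R .num} {x y : Expr Empty .num} {τ : Subst Empty}
    (ha : Prov T Γ ((a.graph Empty).sub (scons .num x τ)))
    (hb : Prov T Γ ((b.graph Empty).sub (scons .num y τ))) :
    Prov T Γ ((trEq a b).sub τ) ↔ Prov T Γ (.eq x y) := by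
  have key : Prov T Γ ((Fml.ex .num (.and (a.graph Empty) (b.graph Empty))).sub τ) ↔
      Prov T Γ (.eq x y) := by
    refine ⟨fun h => .exE_sub h (.assume fun Δ hΔ h₁ => ?_), fun h => .exI_sub x (.andI ha ?_)⟩
    · have hx := (ha.shift_sub .num).mono hΔ
      have hy := (hb.shift_sub .num).mono hΔ
      rw [scons_shift] at hx hy
      exact ((a.graph_functional _ _ _ _ hx h₁.andE₁).eq_trans
        (b.graph_functional _ _ _ _ h₁.andE₂ hy) :)
    · exact .replace _ ((EqSub.refl _).scons (s := .num) h.eq_symm) hb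
  unfold trEq
  split
  · next a' b' ha' hb' =>
    have ι : Empty ↪ R := Function.Embedding.ofIsEmpty
    rw [← Expr.map_of_strip ι ha', Expr.graph_map] at ha
    rw [← Expr.map_of_strip ι hb', Expr.graph_map] at hb
    have h₁ : Prov T Γ (.eq (a'.sub τ) x) := a'.graph_functional _ _ _ _ (a'.graph_self τ) ha
    have h₂ : Prov T Γ (.eq (b'.sub τ) y) := b'.graph_functional _ _ _ _ (b'.graph_self τ) hb
    exact ⟨fun h => (h₁.eq_symm.eq_trans h).eq_trans h₂, fun h => (h₁.eq_trans h).eq_trans h₂.eq_symm⟩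
  · exact key

theorem Values.mono {σ : Subst R} {τ κ : Subst Empty} (h : Values T Γ σ τ κ) {Δ : List (Fml Empty)}
    (hs : Γ ⊆ Δ) : Values T Δ σ τ κ := fun s n => (h s n).mono hs

/-- Translation and substitution commute, up to provable equivalence. -/
theorem Values.tr_sub {σ : Subst R} {τ κ : Subst Empty} (h : Values T Γ σ τ κ) (E : Fml R) :
    Prov T Γ ((tr E).sub τ) ↔ Prov T Γ ((tr (E.sub σ)).sub κ) := by
  induction E generalizing Γ σ τ κ with
  | eq a b =>
    have key : ∀ {Δ : List (Fml Empty)} {τ κ : Subst Empty} {x y : Expr Empty .num},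
        Values T Δ σ τ κ → Prov T Δ ((a.graph Empty).sub (TwoSortedArith.scons .num x τ)) →
        Prov T Δ ((b.graph Empty).sub (TwoSortedArith.scons .num y τ)) →
        (Prov T Δ ((trEq a b).sub τ) ↔ Prov T Δ ((trEq (a.sub σ) (b.sub σ)).sub κ)) :=
      fun h hx hy => (trEq_iff hx hy).trans (trEq_iff (h.graph_sub a hx) (h.graph_sub b hy)).symm
    constructor <;>
    · intro h₁
      refine a.exists_value τ fun Δ hΔ hx => b.exists_value (τ.shift .num) fun Δ' hΔ' hy => ?_
      have hx' := (hx.shift_sub .num).mono hΔ'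
      rw [scons_shift] at hx'
      have h₂ := (((h₁.shift_sub .num).mono hΔ).shift_sub .num).mono hΔ'
      rw [Fml.sub_shift, Fml.sub_shift]
      first
        | exact (key ((h.shift .num hΔ).shift .num hΔ') hx' hy).1 h₂
        | exact (key ((h.shift .num hΔ).shift .num hΔ') hx' hy).2 h₂
  | and A B ihA ihB =>
    exact ⟨fun h₁ => .andI ((ihA h).1 h₁.andE₁) ((ihB h).1 h₁.andE₂),
      fun h₁ => .andI ((ihA h).2 h₁.andE₁) ((ihB h).2 h₁.andE₂)⟩
  | or A B ihA ihB =>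
    exact ⟨fun h₁ => .orE h₁ (.assume fun Δ hΔ h₂ => .orI₁ ((ihA (h.mono hΔ)).1 h₂))
        (.assume fun Δ hΔ h₂ => .orI₂ ((ihB (h.mono hΔ)).1 h₂)),
      fun h₁ => .orE h₁ (.assume fun Δ hΔ h₂ => .orI₁ ((ihA (h.mono hΔ)).2 h₂))
        (.assume fun Δ hΔ h₂ => .orI₂ ((ihB (h.mono hΔ)).2 h₂))⟩
  | imp A B ihA ihB =>
    exact ⟨fun h₁ => .impI (.assume fun Δ hΔ h₂ => (ihB (h.mono hΔ)).1
        (.impE (h₁.mono hΔ) ((ihA (h.mono hΔ)).2 h₂))),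
      fun h₁ => .impI (.assume fun Δ hΔ h₂ => (ihB (h.mono hΔ)).2
        (.impE (h₁.mono hΔ) ((ihA (h.mono hΔ)).1 h₂)))⟩
  | neg A ih =>
    exact ⟨fun h₁ => .negI (.assume fun Δ hΔ h₂ => (ih (h.mono hΔ)).2 h₂) h₁.weaken,
      fun h₁ => .negI (.assume fun Δ hΔ h₂ => (ih (h.mono hΔ)).1 h₂) h₁.weaken⟩
  | all s A ih =>
    have h' := (h.shift s (List.Subset.refl _)).scons (.var s 0)
    exact ⟨fun h₁ => .allI_sub ((ih h').1 ((h₁.shift_sub s).allE_sub _)),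
      fun h₁ => .allI_sub ((ih h').2 ((h₁.shift_sub s).allE_sub _))⟩
  | ex s A ih =>
    constructor <;>
    · intro h₁
      refine .exE_sub h₁ (.assume fun Δ hΔ h₂ => ?_)
      have h' := (h.shift s hΔ).scons (.var s 0)
      rw [Fml.sub_shift]
      first | exact .exI_sub _ ((ih h').1 h₂) | exact .exI_sub _ ((ih h').2 h₂)

/-- The values for an instantiation: that of `e` for the variable, and the variables themselves
otherwise. -/
theorem Values.inst {s : Srt} {e : Expr R s} {v : Expr Empty s} {κ : Subst Empty}
    (h : Prov T Γ ((e.graph Empty).sub (TwoSortedArith.scons s v κ))) :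
    Values T Γ (instSub s e) (TwoSortedArith.scons s v κ) κ := by
  intro s' n
  have h₁ : ∀ s' n, Prov T Γ (((Expr.var s' n : Expr R s').graph Empty).sub
      (TwoSortedArith.scons s' (κ s' n) κ)) := fun s' n => Expr.graph_var n κ
  cases s <;> cases s' <;> cases n <;> first | exact h | exact h₁ _ _

/-- The formula stating that `A` is equivalent to the vanishing of the variable with index `0`. -/
def vanishF (A : Fml R) : Fml R := Fml.iff (A.shift .num) (.eq (nv 0) .zero)

theorem Prov.repEx_vanish_intro {A : Fml Empty} {τ : Subst Empty} (x : Expr Empty .num)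
    (h : ∀ Δ : List (Fml Empty), Γ.map (Fml.shift .num) ⊆ Δ →
      (Prov T Δ (A.sub τ) ↔ (mk x : Q T Δ) = 0)) :
    Prov T Γ (repEx .num (vanishF A) τ) := by
  refine .repEx_intro x (.andI (.impI ?_) (.impI ?_)) <;> rw [Fml.shift_sub]
  · exact .assume fun Δ hΔ h₁ => (mk_eq (b := .zero)).1 ((h Δ hΔ).1 h₁)
  · exact .assume fun Δ hΔ h₁ => (h Δ hΔ).2 ((mk_eq (b := .zero)).2 h₁)

/-- The use of a function representing `A`. -/
theorem Rep.vanish_iff {A : Fml Empty} {τ : Subst Empty} {δ : Expr Empty .fn}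
    (h : Rep T Γ .num (vanishF A) τ δ) {Δ : List (Fml Empty)} (hΔ : Γ.map (Fml.shift .num) ⊆ Δ) :
    Prov T Δ (A.sub τ) ↔ (mk (.app (δ.shift .num) (nv 0)) : Q T Δ) = 0 := by
  have h₁ : Prov T (Γ.map (Fml.shift .num)) (.imp ((A.shift .num).sub _) _) := h.andE₁
  have h₂ : Prov T (Γ.map (Fml.shift .num)) (.imp _ ((A.shift .num).sub _)) := h.andE₂
  rw [Fml.shift_sub] at h₁ h₂
  exact ⟨fun h₃ => (mk_eq (b := .zero)).2 (.impE (h₁.mono hΔ) h₃),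
    fun h₃ => .impE (h₂.mono hΔ) ((mk_eq (b := .zero)).1 h₃)⟩

theorem Prov.of_succ_eq_zero {C : Fml Empty} {x y : Expr Empty .num} (h : (mk x : Q T Γ) = mk y + 1)
    (h' : (mk x : Q T Γ) = 0) : Prov T Γ C := by
  have h₁ : Prov T Γ (.neg (.eq (succ y) .zero)) :=
    Prov.ax_inst (fun r => IA₁.succ_ne (r := r)) y y y idleFn
  exact .negE h₁ ((mk_eq (b := .zero)).1 (by rw [mk_succ, ← h, h', mk_zero]))

theorem mk_eq_zero_of {x : Expr Empty .num} {Δ : List (Fml Empty)} (h : Prov T Δ (.eq x .zero)) :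
    (mk x : Q T Δ) = 0 := (mk_eq (b := .zero)).2 h

/-- The quantifier-free formulas, with the additional constants eliminated, are represented by
functions: sums represent conjunctions, products represent disjunctions, and `sgbar` negation. -/
theorem repEx_tr (A : Fml R) (hA : A.QuantifierFree) (τ : Subst Empty) :
    Prov T Γ (repEx .num (vanishF (tr A)) τ) := by
  induction A generalizing Γ τ with
  | all | ex => exact hA.elim
  | eq a b =>
    refine .repEx_elim (a.repEx_graph τ) fun Δ hΔ h₁ =>
      .repEx_elim (b.repEx_graph (τ.shift .fn)) fun Δ' hΔ' h₂ => ?_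
    rw [repEx_shift, repEx_shift]
    refine .repEx_vanish_intro (dist (.app (fv 1) (nv 0)) (.app (fv 0) (nv 0))) fun Δ₂ hΔ₂ => ?_
    rw [mk_dist_eq_zero, mk_eq]
    exact trEq_iff ((h₁.shift hΔ').mono hΔ₂) (Prov.mono h₂ hΔ₂)
  | neg A ih =>
    refine .repEx_elim (ih hA τ) fun Δ hΔ h₁ => ?_
    rw [repEx_shift]
    refine .repEx_vanish_intro (sgbar (.app (fv 0) (nv 0))) fun Δ₂ hΔ₂ => ⟨fun h => ?_, fun h => ?_⟩
    · refine mk_eq_zero_of (.cases_pd (.app (fv 0) (nv 0)) (fun Δ₃ hΔ₃ h₃ => ?_)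
        fun Δ₃ hΔ₃ h₃ => mk_eq.1 ?_)
      · exact .negE (h.mono hΔ₃) ((h₁.vanish_iff (List.Subset.trans hΔ₂ hΔ₃)).2 h₃)
      · rw [mk_sgbar, h₃, Q.sgbar_succ]; rfl
    · refine .negI (B := .eq (succ .zero) .zero) (.assume fun Δ₃ hΔ₃ h₃ => ?_)
        (Prov.ax_inst (fun r => IA₁.succ_ne (r := r)) .zero .zero .zero idleFn)
      have h₄ := mk_mono (b := .zero) hΔ₃ h
      rw [mk_sgbar, show (mk (.app (fv 0) (nv 0)) : Q T Δ₃) = 0 from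
        (h₁.vanish_iff (List.Subset.trans hΔ₂ hΔ₃)).1 h₃, Q.sgbar_zero] at h₄
      exact mk_eq.1 h₄
  | and A B ihA ihB =>
    refine .repEx_elim (ihA hA.1 τ) fun Δ hΔ h₁ =>
      .repEx_elim (ihB hA.2 (τ.shift .fn)) fun Δ' hΔ' h₂ => ?_
    rw [repEx_shift, repEx_shift]
    refine .repEx_vanish_intro (add (.app (fv 1) (nv 0)) (.app (fv 0) (nv 0))) fun Δ₂ hΔ₂ => ?_
    have e₁ := (h₁.shift hΔ').vanish_iff hΔ₂
    have e₂ := h₂.vanish_iff hΔ₂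
    rw [mk_add, add_eq_zero]
    exact ⟨fun h => ⟨e₁.1 h.andE₁, e₂.1 h.andE₂⟩, fun h => .andI (e₁.2 h.1) (e₂.2 h.2)⟩
  | or A B ihA ihB =>
    refine .repEx_elim (ihA hA.1 τ) fun Δ hΔ h₁ =>
      .repEx_elim (ihB hA.2 (τ.shift .fn)) fun Δ' hΔ' h₂ => ?_
    rw [repEx_shift, repEx_shift]
    refine .repEx_vanish_intro (mul (.app (fv 1) (nv 0)) (.app (fv 0) (nv 0)))
      fun Δ₂ hΔ₂ => ⟨fun h => ?_, fun h => ?_⟩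
    · refine mk_eq_zero_of (.orE h (.assume fun Δ₃ hΔ₃ h₃ => mk_eq.1 ?_)
        (.assume fun Δ₃ hΔ₃ h₃ => mk_eq.1 ?_)) <;> rw [mk_mul]
      · rw [show (mk (.app (fv 1) (nv 0)) : Q T Δ₃) = 0 from
          ((h₁.shift hΔ').vanish_iff (List.Subset.trans hΔ₂ hΔ₃)).1 h₃, zero_mul]; rfl
      · rw [show (mk (.app (fv 0) (nv 0)) : Q T Δ₃) = 0 from
          (h₂.vanish_iff (List.Subset.trans hΔ₂ hΔ₃)).1 h₃, mul_zero]; rfl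
    · refine .cases_pd (.app (fv 1) (nv 0)) (fun Δ₃ hΔ₃ h₃ => .orI₁
        (((h₁.shift hΔ').vanish_iff (List.Subset.trans hΔ₂ hΔ₃)).2 h₃)) fun Δ₃ hΔ₃ h₃ => ?_
      refine .cases_pd (.app (fv 0) (nv 0)) (fun Δ₄ hΔ₄ h₄ => .orI₂
        ((h₂.vanish_iff (List.Subset.trans hΔ₂ (List.Subset.trans hΔ₃ hΔ₄))).2 h₄))
        fun Δ₄ hΔ₄ h₄ => ?_
      have h₅ := mk_mono (b := .zero) (List.Subset.trans hΔ₃ hΔ₄) h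
      refine .of_succ_eq_zero (y := add (mul (pd (.app (fv 1) (nv 0))) (.app (fv 0) (nv 0)))
        (pd (.app (fv 0) (nv 0)))) ?_ h₅
      have h₆ : (mk (.app (fv 1) (nv 0)) : Q T Δ₄) = mk (pd (.app (fv 1) (nv 0))) + 1 := by
        rw [← mk_succ] at h₃ ⊢
        exact mk_mono hΔ₄ h₃
      rw [mk_mul, h₆, add_mul, one_mul, mk_add, mk_mul, add_assoc, ← h₄]
  | imp A B ihA ihB =>
    refine .repEx_elim (ihA hA.1 τ) fun Δ hΔ h₁ =>
      .repEx_elim (ihB hA.2 (τ.shift .fn)) fun Δ' hΔ' h₂ => ?_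
    rw [repEx_shift, repEx_shift]
    refine .repEx_vanish_intro (mul (sgbar (.app (fv 1) (nv 0))) (.app (fv 0) (nv 0)))
      fun Δ₂ hΔ₂ => ⟨fun h => ?_, fun h => ?_⟩
    · refine mk_eq_zero_of (.cases_pd (.app (fv 1) (nv 0)) (fun Δ₃ hΔ₃ h₃ => mk_eq.1 ?_)
        fun Δ₃ hΔ₃ h₃ => mk_eq.1 ?_) <;> rw [mk_mul]
      · have h₄ := ((h₁.shift hΔ').vanish_iff (List.Subset.trans hΔ₂ hΔ₃)).2 h₃
        rw [show (mk (.app (fv 0) (nv 0)) : Q T Δ₃) = 0 from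
          (h₂.vanish_iff (List.Subset.trans hΔ₂ hΔ₃)).1 (.impE (h.mono hΔ₃) h₄), mul_zero]; rfl
      · rw [mk_sgbar, h₃, Q.sgbar_succ, zero_mul]; rfl
    · refine .impI (.assume fun Δ₃ hΔ₃ h₃ =>
        (h₂.vanish_iff (List.Subset.trans hΔ₂ hΔ₃)).2 ?_)
      have h₄ := mk_mono (b := .zero) hΔ₃ h
      rw [mk_mul, mk_sgbar, show (mk (.app (fv 1) (nv 0)) : Q T Δ₃) = 0 from
        ((h₁.shift hΔ').vanish_iff (List.Subset.trans hΔ₂ hΔ₃)).1 h₃, Q.sgbar_zero, one_mul] at h₄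
      exact h₄

end

/-! ### The translation preserves deducibility -/

section
variable {T : Set (Fml Empty)} [hT : HasChoice T] {Γ : List (Fml Empty)}

/-- If `δ` represents `A` with the argument unpaired, then `A(x, y)` is equivalent to the vanishing of
`δ` at the pair of `x` and `y`. -/
theorem Rep.vanish_pair {A : Fml Empty} {θ κ : Subst Empty} {δ : Expr Empty .fn}
    (h : Rep T Γ .num (vanishF A)
      (scons .num (psnd (nv 0)) (scons .num (pfst (nv 0)) (θ.shift .num))) δ)
    {Δ : List (Fml Empty)} (hΔ : Γ.map (Fml.sub · κ) ⊆ Δ) (x y : Expr Empty .num) :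
    Prov T Δ (A.sub (scons .num y (scons .num x fun s n => (θ s n).sub κ))) ↔
      (mk (.app (δ.sub κ) (opair x y)) : Q T Δ) = 0 := by
  have h₁ := Prov.sub h (scons .num (opair x y) κ)
  have hc : (Γ.map (Fml.shift .num)).map (Fml.sub · (scons .num (opair x y) κ)) =
      Γ.map (Fml.sub · κ) := by
    simp [Fml.shift_sub]
  rw [hc, Fml.sub_sub, scons_sub, valOf_sub, Expr.shift_sub, scons_sub, scons_sub, psnd_sub,
    pfst_sub] at h₁
  have h₂ := h₁.mono hΔ
  have e : (fun s n => (θ.shift .num s n).sub (scons .num (opair x y) κ)) =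
      fun s n => (θ s n).sub κ := by
    funext s n; exact Expr.shift_sub _ _ _ _
  rw [e] at h₂
  have h₃ : Prov T Δ (.imp ((A.shift .num).sub _) _) := h₂.andE₁
  have h₄ : Prov T Δ (.imp _ ((A.shift .num).sub _)) := h₂.andE₂
  rw [Fml.shift_sub] at h₃ h₄
  have hs : EqSub T Δ (scons .num (psnd (opair x y)) (scons .num (pfst (opair x y))
      fun s n => (θ s n).sub κ)) (scons .num y (scons .num x fun s n => (θ s n).sub κ)) :=
    ((EqSub.refl _).scons (s := .num) (mk_eq.1 (mk_pfst x y))).scons (s := .num)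
      (mk_eq.1 (mk_psnd x y))
  exact ⟨fun h₅ => mk_eq_zero_of (.impE h₃ (.replace A hs.symm h₅)),
    fun h₅ => .replace A hs (.impE h₄ ((mk_eq (b := .zero)).1 h₅))⟩

/-- Choice for the translations of quantifier-free formulas. These may contain quantifiers, but are
equivalent to the vanishing of a function at a pair, which is a quantifier-free condition. -/
theorem Prov.choice_tr (A : Fml R) (hA : A.QuantifierFree)
    (h : Prov T Γ (.all .num (.ex .num (tr A)))) :
    Prov T Γ (.ex .fn (.all .num ((tr A).sub fun
      | .num, 0 => .app (fv 0) (nv 0)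
      | .num, n + 1 => nv n
      | .fn, n => fv (n + 1)))) := by
  refine .repEx_elim (repEx_tr A hA (scons .num (psnd (nv 0)) (scons .num (pfst (nv 0))
    (Subst.shift .num Expr.var)))) fun Δ hΔ hδ => ?_
  have e₀ : Subst.shift .fn (scons .num (psnd (nv 0)) (scons .num (pfst (nv 0))
      (Subst.shift .num (Expr.var (R := Empty))))) = scons .num (psnd (nv 0))
      (scons .num (pfst (nv 0)) (Subst.shift .num (Subst.shift .fn Expr.var))) := by
    rw [scons_shift, scons_shift, Subst.shift_comm, ← Expr.sub_var_shift, ← Expr.sub_var_shift,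
      psnd_sub, pfst_sub]
    rfl
  rw [e₀] at hδ
  have h₁ : Prov T Δ (.all .num (.ex .num (.eq (.app (fv 0) (opair (nv 1) (nv 0))) .zero))) := by
    rw [← Fml.sub_var (.all _ _)] at h ⊢
    refine .allI_sub (.exE_sub (((h.shift_sub .fn).mono hΔ).shift_sub .num |>.allE_sub (nv 0))
      (.assume fun Θ hΘ h₂ => ?_))
    rw [Fml.sub_shift]
    refine .exI_sub (nv 0) ((mk_eq (b := .zero)).1 ((hδ.vanish_pair
      (κ := Subst.shift .num (Subst.shift .num Expr.var)) ?_ (nv 1) (nv 0)).1 ?_))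
    · simpa [List.map_map, Function.comp_def, ← Fml.sub_shift, Fml.sub_var] using hΘ
    · convert h₂ using 2
      funext s n
      cases s
      · match n with
        | 0 | 1 | n + 2 => rfl
      · rfl
  have h₂ := Prov.impE (.ax (hT.choice _ (.mk (.eq (.app (fv 0) (opair (nv 1) (nv 0))) .zero) trivial))) h₁
  refine .exE h₂ (.assume fun Θ hΘ h₃ => ?_)
  rw [← Fml.sub_var (.ex _ _), Fml.sub_shift, Fml.sub_shift]
  refine .exI_sub (fv 0) (.allI_sub ?_)
  have h₄ := (hδ.vanish_pair (κ := Subst.shift .num (Subst.shift .fn Expr.var))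
    (Δ := Θ.map (Fml.shift .num)) ?_ (nv 0) (.app (fv 0) (nv 0))).2 (mk_eq_zero_of h₃.all_var)
  · rw [Fml.sub_sub]
    convert h₄ using 2
    funext s n
    cases s
    · match n with
      | 0 | 1 | n + 2 => rfl
    · rfl
  · have := List.map_subset (Fml.shift .num) hΘ
    simpa [List.map_map, Function.comp_def, ← Fml.sub_shift, Fml.sub_var] using this

theorem tr_choice (A : Fml R) (h : QFAC₀₀ A) : Prov T Γ (tr A) := by
  obtain ⟨A, hA⟩ := h
  refine .impI (.assume fun Δ hΔ h₁ => ?_)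
  have h₂ := Prov.choice_tr A hA h₁
  refine .exE h₂ (.assume fun Δ' hΔ' h₃ => ?_)
  rw [← Fml.sub_var (tr (.ex _ _)), Fml.sub_shift]
  refine .exI_sub (fv 0) ?_
  have e : scons .fn (fv 0) (Subst.shift .fn (Expr.var (R := Empty))) = Expr.var := scons_var_shift .fn
  rw [e, Fml.sub_var]
  refine .allI ?_
  have ι : Empty ↪ R := Function.Embedding.ofIsEmpty
  rw [← Fml.sub_var (tr _)]
  have h₄ := ((Values.map ι fun
      | .num, 0 => .app (fv 0) (nv 0)
      | .num, n + 1 => nv n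
      | .fn, n => fv (n + 1)).tr_sub A).1 h₃.all_var
  convert h₄ using 4
  funext s n
  cases s
  · cases n <;> rfl
  · rfl

/-- The translation of induction is induction for the translated formula, up to the exchange of
translation and substitution. -/
theorem tr_ind (A : Fml R) : Prov T Γ (tr (.imp (.and (A.inst .num .zero)
    (.all .num (.imp A (A.sub fun
      | .num, 0 => succ (nv 0)
      | s, n => .var s n)))) (.all .num A))) := by
  have ι : Empty ↪ R := Function.Embedding.ofIsEmpty
  obtain ⟨r, hr⟩ := hT.base
  refine .impI (.assume fun Δ hΔ h => .impE (.ax (hr _ (.ind (tr A)))) (.andI ?_ (.allI (.impI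
    (.assume fun Δ' hΔ' h' => ?_)))))
  · have h₁ : Prov T Δ (tr (A.inst .num .zero)) := h.andE₁
    rw [Fml.inst_eq]
    rw [← Fml.sub_var (tr _)] at h₁
    refine ((Values.inst (e := .zero) ?_).tr_sub A).2 h₁
    exact .eq_refl _
  · have h₁ : Prov T Δ (.all .num (.imp (tr A) (tr _))) := h.andE₂
    have h₂ := Prov.impE (h₁.all_var.mono hΔ') h'
    rw [← Fml.sub_var (tr (Fml.sub _ _))] at h₂
    refine ((Values.map ι _).tr_sub A).2 ?_
    convert h₂ using 4
    funext s n
    cases s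
    · cases n <;> rfl
    · rfl

/-- Translated `λ`-conversion: the value `u` of `λx.t` has, at the value `y` of `s`, the value of `t` at
`y`, and by `Values.graph_sub` this is the value of `t(s)`. -/
theorem tr_lam_conv (t s : Expr R .num) :
    Prov T Γ (tr (.eq (.app (.lam t) s) (t.inst .num s))) := by
  refine (Expr.lam t).exists_value Expr.var fun Δ₁ h₁ hu =>
    s.exists_value (Subst.shift .fn Expr.var) fun Δ₂ h₂ hy => ?_
  have hu₁ := (hu.shift_sub .num).mono h₂
  refine .bnd_elim (hu₁.allE_sub (nv 0)) fun Δ₃ h₃ hx hxu => ?_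
  have hu₂ := (hu₁.shift_sub .num).mono h₃
  have hy₁ := (hy.shift_sub .num).mono h₃
  simp only [scons_shift, scons_up_zero_one] at hu₂ hy₁ hx
  rw [← Fml.sub_var (tr _), Fml.sub_shift, Fml.sub_shift, Fml.sub_shift]
  refine (trEq_iff (x := nv 0) (y := nv 0) ?_ ((Values.inst hy₁).graph_sub t hx)).2 (.eq_refl _)
  refine .bnd_intro (fv 0) ?_ (.bnd_intro (nv 1) ?_ hxu)
  · rw [scons_up_one_zero]; exact hu₂
  · rw [scons_up_one_one]; exact hy₁

end

/-! ### Inclusions of languages -/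

theorem Expr.map_ren {s : Srt} (ι : R₁ ↪ R₂) (e : Expr R₁ s) (ρ : Srt → ℕ → ℕ) :
    (e.ren ρ).map ι = (e.map ι).ren ρ := by
  induction e generalizing ρ <;> simp_all [Expr.map, Expr.ren]

theorem Fml.map_ren (ι : R₁ ↪ R₂) (A : Fml R₁) (ρ : Srt → ℕ → ℕ) :
    (A.ren ρ).map ι = (A.map ι).ren ρ := by
  induction A generalizing ρ <;> simp_all [Fml.map, Fml.ren, Expr.map_ren]

theorem liftSub_map (s : Srt) (ι : R₁ ↪ R₂) (σ : Subst R₁) :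
    liftSub s (fun s n => (σ s n).map ι) = fun s' n => (liftSub s σ s' n).map ι := by
  funext s' n
  cases s <;> cases s' <;> cases n <;>
    first | rfl | simp [liftSub, Expr.shift, Expr.map_ren]

theorem Expr.map_sub {s : Srt} (ι : R₁ ↪ R₂) (e : Expr R₁ s) (σ : Subst R₁) :
    (e.sub σ).map ι = (e.map ι).sub fun s n => (σ s n).map ι := by
  induction e generalizing σ <;> simp_all [Expr.map, Expr.sub, liftSub_map]

theorem Fml.map_sub (ι : R₁ ↪ R₂) (A : Fml R₁) (σ : Subst R₁) :
    (A.sub σ).map ι = (A.map ι).sub fun s n => (σ s n).map ι := by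
  induction A generalizing σ <;> simp_all [Fml.map, Fml.sub, Expr.map_sub, liftSub_map]

theorem instSub_map (ι : R₁ ↪ R₂) (s : Srt) (e : Expr R₁ s) :
    (fun s' n => (instSub s e s' n).map ι) = instSub s (e.map ι) := by
  funext s' n; cases s <;> cases s' <;> cases n <;> rfl

theorem Fml.map_inst (ι : R₁ ↪ R₂) (A : Fml R₁) (s : Srt) (e : Expr R₁ s) :
    (A.inst s e).map ι = (A.map ι).inst s (e.map ι) := by
  rw [Fml.inst, Fml.map_sub, instSub_map, Fml.inst]

theorem Expr.map_inst (ι : R₁ ↪ R₂) {s' : Srt} (t : Expr R₁ s') (s : Srt) (e : Expr R₁ s) :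
    (t.inst s e).map ι = (t.map ι).inst s (e.map ι) := by
  rw [Expr.inst, Expr.map_sub, instSub_map, Expr.inst]

theorem Fml.map_shift (ι : R₁ ↪ R₂) (A : Fml R₁) (s : Srt) :
    (A.shift s).map ι = (A.map ι).shift s :=
  Fml.map_ren _ _ _

theorem Fml.QuantifierFree.map (ι : R₁ ↪ R₂) {A : Fml R₁} (h : A.QuantifierFree) :
    (A.map ι).QuantifierFree := by
  induction A with
  | eq | all | ex => exact h
  | neg A ih => exact ih h
  | and A B ihA ihB | or A B ihA ihB | imp A B ihA ihB => exact ⟨ihA h.1, ihB h.2⟩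

/-- The substitution in the recursion equation of `ccp`. -/
def ccpSub : Subst R
  | .num, 0 => nv 0
  | .num, 1 => ccp (nv 0)
  | s, n => .var s n

theorem map_ccpSub (ι : R₁ ↪ R₂) (r : Expr R₁ .num) :
    (r.sub ccpSub).map ι = (r.map ι).sub ccpSub := by
  rw [Expr.map_sub]
  congr 1
  funext s n
  cases s
  · match n with
    | 0 | 1 | n + 2 => rfl
  · rfl

/-- The recursion equation of `ccp`. -/
def ccpEq (r : Expr R .num) : Fml R :=
  .eq (ccp (succ (nv 0))) (mul (ccp (nv 0)) (exp (prime (nv 0)) (r.sub ccpSub)))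

theorem map_ccpEq (ι : R₁ ↪ R₂) (r : Expr R₁ .num) : (ccpEq r).map ι = ccpEq (r.map ι) := by
  rw [ccpEq, ccpEq, ← map_ccpSub]; rfl

theorem IA₁.map (ι : R₁ ↪ R₂) {r : Expr R₁ .num} {A : Fml R₁} (h : IA₁ r A) :
    IA₁ (r.map ι) (A.map ι) := by
  cases h with
  | ccp_succ =>
    have h : IA₁ (r.map ι) (ccpEq (r.map ι)) := IA₁.ccp_succ
    rw [← map_ccpEq] at h
    exact h
  | lam_conv t s =>
    have := IA₁.lam_conv (r := r.map ι) (t.map ι) (s.map ι)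
    rw [← Expr.map_inst] at this
    exact this
  | ind A =>
    have := IA₁.ind (r := r.map ι) (A.map ι)
    rw [show (Expr.zero : Expr R₂ .num) = Expr.map ι .zero from rfl, ← Fml.map_inst] at this
    convert this using 1
    simp only [Fml.map, Fml.map_sub]
    congr 5
    funext s n
    cases s
    · cases n <;> rfl
    · rfl
  | _ => constructor

theorem QFAC₀₀.map (ι : R₁ ↪ R₂) {A : Fml R₁} (h : QFAC₀₀ A) : QFAC₀₀ (A.map ι) := by
  obtain ⟨A, hA⟩ := h
  convert QFAC₀₀.mk (A.map ι) (hA.map ι) using 1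
  simp only [Fml.map, Fml.map_sub]
  congr 4
  funext s n
  cases s
  · cases n <;> rfl
  · rfl

theorem Prov.map (ι : R₁ ↪ R₂) {T₁ : Set (Fml R₁)} {T₂ : Set (Fml R₂)}
    (hT : ∀ A ∈ T₁, A.map ι ∈ T₂) {Γ : List (Fml R₁)} {A : Fml R₁} (h : Prov T₁ Γ A) :
    Prov T₂ (Γ.map (Fml.map ι)) (A.map ι) := by
  have hs : ∀ (s : Srt) (Γ : List (Fml R₁)), (Γ.map (Fml.shift s)).map (Fml.map ι) =
      (Γ.map (Fml.map ι)).map (Fml.shift s) := by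
    intro s Γ; simp [Fml.map_shift]
  induction h with
  | ax h => exact .ax (hT _ h)
  | hyp h => exact .hyp (List.mem_map_of_mem h)
  | andI _ _ h₁ h₂ => exact .andI h₁ h₂
  | andE₁ _ h => exact .andE₁ h
  | andE₂ _ h => exact .andE₂ h
  | orI₁ _ h => exact .orI₁ h
  | orI₂ _ h => exact .orI₂ h
  | orE _ _ _ h₁ h₂ h₃ => exact .orE h₁ h₂ h₃
  | impI _ h => exact .impI h
  | impE _ _ h₁ h₂ => exact .impE h₁ h₂
  | negI _ _ h₁ h₂ => exact .negI h₁ h₂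
  | negE _ _ h₁ h₂ => exact .negE h₁ h₂
  | allI _ h => rw [hs] at h; exact .allI h
  | allE e _ h => rw [Fml.map_inst]; exact .allE _ h
  | exI e _ h => rw [Fml.map_inst] at h; exact .exI _ h
  | exE _ _ h₁ h₂ =>
    rw [List.map_cons, hs, Fml.map_shift] at h₂
    exact .exE h₁ h₂

theorem Expr.map_graph {R : Type} (ι : R₁ ↪ R₂) {s : Srt} (e : Expr R s) :
    (e.graph R₁).map ι = e.graph R₂ := by
  induction e with
  | var s n => cases s <;> rfl
  | zero => rfl
  | un f => rfl
  | bin f a b iha ihb => simp only [graph, bnd, Fml.map, Fml.map_ren, iha, ihb]; rfl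
  | fnl f a u iha ihu => simp only [graph, bnd, Fml.map, Fml.map_ren, iha, ihu]; rfl
  | rcr c t u s iht ihu ihs => simp only [graph, bnd, Fml.map, Fml.map_ren, iht, ihu, ihs]; rfl
  | app u t ihu iht => simp only [graph, bnd, Fml.map, Fml.map_ren, ihu, iht]; rfl
  | lam t ih => simp only [graph, bnd, Fml.map, Fml.map_ren, ih]; rfl

/-! ### The definitional extension -/

instance (r : Expr Empty .num) : IsArith (IA₁QFRec r) where
  base := ⟨r.map incl, fun _ h => .inl h⟩
  recAx _ := .ax (.inr (.inr .mk))

theorem map_mem (r : Expr Empty .num) (A : Fml Empty) (h : A ∈ IA₁QF r) :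
    A.map incl ∈ IA₁QFRec r :=
  h.elim (fun h => .inl (h.map incl)) fun h => .inr (.inl (h.map incl))

section
variable {T : Set (Fml R)} [hT : IsArith T] {Γ : List (Fml R)}

theorem map_trEq_iff (ι : Empty ↪ R) (a b : Expr R .num) :
    Prov T Γ ((trEq a b).map ι) ↔ Prov T Γ (.eq a b) := by
  unfold trEq
  split
  · next a' b' ha hb =>
    rw [Fml.map, Expr.map_of_strip ι ha, Expr.map_of_strip ι hb]
  · have e : ∀ {Δ : List (Fml R)} (a : Expr R .num) (κ : Subst R),
        Prov T Δ ((a.graph R).sub (scons .num (a.sub κ) κ)) := fun a κ => a.graph_self κ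
    simp only [Fml.map, Expr.map_graph]
    constructor <;> intro h
    · rw [← Fml.sub_var (.ex _ _)] at h
      rw [← Fml.sub_var (.eq a b)]
      refine .exE_sub h (.assume fun Δ hΔ h₁ => ?_)
      rw [Fml.sub_shift]
      have h₂ : Prov T Δ (.eq _ (nv 0)) := a.graph_functional _ _ _ _ (e a _) h₁.andE₁
      have h₃ : Prov T Δ (.eq (nv 0) _) := b.graph_functional _ _ _ _ h₁.andE₂ (e b _)
      exact h₂.eq_trans h₃
    · rw [← Fml.sub_var (.ex _ _)]
      refine .exI_sub a (.andI ?_ ?_)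
      · have := e (Δ := Γ) a Expr.var
        rwa [Expr.sub_var] at this
      · have := e (Δ := Γ) b Expr.var
        rw [Expr.sub_var] at this
        exact .replace _ ((EqSub.refl _).scons (s := .num) h.eq_symm) this

/-- In the presence of the axiom `Rec`, every formula is equivalent to its translation. -/
theorem map_tr_iff (ι : Empty ↪ R) (E : Fml R) : Prov T Γ ((tr E).map ι) ↔ Prov T Γ E := by
  induction E generalizing Γ with
  | eq a b => exact map_trEq_iff ι a b
  | and A B ihA ihB =>
    exact ⟨fun h => .andI (ihA.1 h.andE₁) (ihB.1 h.andE₂),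
      fun h => .andI (ihA.2 h.andE₁) (ihB.2 h.andE₂)⟩
  | or A B ihA ihB =>
    exact ⟨fun h => .orE h (.assume fun _ _ h => .orI₁ (ihA.1 h)) (.assume fun _ _ h => .orI₂ (ihB.1 h)),
      fun h => .orE h (.assume fun _ _ h => .orI₁ (ihA.2 h)) (.assume fun _ _ h => .orI₂ (ihB.2 h))⟩
  | imp A B ihA ihB =>
    exact ⟨fun h => .impI (.assume fun _ hΔ h' => ihB.1 (.impE (h.mono hΔ) (ihA.2 h'))),
      fun h => .impI (.assume fun _ hΔ h' => ihB.2 (.impE (h.mono hΔ) (ihA.1 h')))⟩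
  | neg A ih =>
    exact ⟨fun h => .negI (.assume fun _ _ h' => ih.2 h') h.weaken,
      fun h => .negI (.assume fun _ _ h' => ih.1 h') h.weaken⟩
  | all s A ih => exact ⟨fun h => .allI (ih.1 h.all_var), fun h => .allI (ih.2 h.all_var)⟩
  | ex s A ih =>
    have key : ∀ {Δ : List (Fml R)} {A : Fml R}, Prov T Δ A →
        Prov T Δ (A.sub (scons s (.var s 0) (Subst.shift s Expr.var))) := by
      intro Δ A h; rwa [scons_var_shift, Fml.sub_var]
    refine ⟨fun h => .exE h (.assume fun _ _ h => ?_), fun h => .exE h (.assume fun _ _ h => ?_)⟩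
    · rw [← Fml.sub_var (.ex _ _), Fml.sub_shift]
      exact .exI_sub _ (key (ih.1 h))
    · rw [← Fml.sub_var ((tr (.ex _ _)).map ι), Fml.sub_shift]
      exact .exI_sub _ (key (ih.2 h))

end

/-- All axioms of `IA₁` but induction and `λ`-conversion are free of `rec`, hence their own
translations. -/
theorem tr_ia (r : Expr Empty .num) {A : Fml Unit} (h : IA₁ (r.map incl) A) :
    Prov (IA₁QF r) [] (tr A) := by
  cases h with
  | lam_conv t s => exact tr_lam_conv t s
  | ind A => exact tr_ind A
  | ccp_succ =>
    change Prov _ _ (tr (ccpEq (r.map incl)))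
    rw [← map_ccpEq, tr_map]
    exact .ax (.inl .ccp_succ)
  | _ => exact .ax (.inl (by constructor))

/-- The translation of `Rec` is proved by definition by recursion: the function obtained has the value
that `A` describes. -/
theorem tr_rec {T : Set (Fml Empty)} [hT : HasChoice T] {A : Fml Unit} (h : Rec A) :
    Prov T [] (tr A) := by
  obtain ⟨⟩ := h
  have h := Prov.exists_rec (T := T) (Γ := []) (nv 0) (fv 0)
  refine .exE_sub h (.assume fun Δ _ h₁ => ?_)
  rw [← Fml.sub_var (tr _), Fml.sub_shift]
  refine .exI_sub (fv 0) ?_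
  have e : scons .fn (fv 0) (Subst.shift .fn (Expr.var (R := Empty))) = Expr.var :=
    scons_var_shift .fn
  rw [e]
  rw [recEqs_sub] at h₁
  refine .andI (by rw [Fml.sub_var]; exact h₁) ?_
  have hv : ∀ {s : Srt} (n : ℕ), Prov T Δ (((Expr.var s n : Expr Unit s).graph Empty).sub
      (scons s (.var s n) Expr.var)) := fun n => Expr.graph_var n Expr.var
  refine (trEq_iff (x := .app (fv 0) (nv 1)) (y := .app (fv 0) (nv 1)) ?_ ?_).2 (.eq_refl _)
  · exact .bnd_intro (fv 0) (by rw [scons_up_one_zero]; exact hv 0)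
      (.bnd_intro (nv 1) (by rw [scons_up_one_one]; exact hv 1) (.eq_refl _))
  · refine .bnd_intro (nv 0) (by rw [scons_up_one_zero]; exact hv 0)
      (.bnd_intro (fv 1) (by rw [scons_up_two_zero]; exact hv 1)
        (.bnd_intro (nv 1) (by rw [scons_up_two_one]; exact hv 1) ?_))
    rw [recFml_sub]
    exact .recFml_intro (fv 0) h₁ (.eq_refl _)

/-- The translation preserves deducibility, provided that the translated axioms are theorems. In the
quantifier rules the instantiating expression is replaced by its value. -/
theorem Prov.tr {T₂ : Set (Fml R)} {T₁ : Set (Fml Empty)} [hT : HasChoice T₁]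
    (h₁ : ∀ A ∈ T₂, Prov T₁ [] (tr A)) {Γ : List (Fml R)} {A : Fml R} (h : Prov T₂ Γ A) :
    Prov T₁ (Γ.map TwoSortedArith.tr) (TwoSortedArith.tr A) := by
  induction h with
  | ax h => exact (h₁ _ h).of_nil
  | hyp h => exact .hyp (List.mem_map_of_mem h)
  | andI _ _ h₁ h₂ => exact .andI h₁ h₂
  | andE₁ _ h => exact .andE₁ h
  | andE₂ _ h => exact .andE₂ h
  | orI₁ _ h => exact .orI₁ h
  | orI₂ _ h => exact .orI₂ h
  | orE _ _ _ h₁ h₂ h₃ => exact .orE h₁ h₂ h₃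
  | impI _ h => exact .impI h
  | impE _ _ h₁ h₂ => exact .impE h₁ h₂
  | negI _ _ h₁ h₂ => exact .negI h₁ h₂
  | negE _ _ h₁ h₂ => exact .negE h₁ h₂
  | allI _ h => rw [map_tr_shift] at h; exact .allI h
  | @allE Γ s A e _ h =>
    refine e.exists_value Expr.var fun Δ hΔ hv => ?_
    rw [← Fml.sub_var (TwoSortedArith.tr _), Fml.sub_shift]
    rw [← Fml.sub_var (TwoSortedArith.tr _)] at h
    exact ((Values.inst hv).tr_sub A).1 (((h.shift_sub s).mono hΔ).allE_sub _)
  | @exI Γ s A e _ h =>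
    refine e.exists_value Expr.var fun Δ hΔ hv => ?_
    rw [← Fml.sub_var (TwoSortedArith.tr _), Fml.sub_shift]
    rw [← Fml.sub_var (TwoSortedArith.tr _)] at h
    exact .exI_sub _ (((Values.inst hv).tr_sub A).2 ((h.shift_sub s).mono hΔ))
  | exE _ _ h₁ h₂ =>
    rw [List.map_cons, map_tr_shift, tr_shift] at h₂
    exact .exE h₁ h₂

theorem tr_mem (r : Expr Empty .num) (A : Fml Unit) (h : A ∈ IA₁QFRec r) :
    Prov (IA₁QF r) [] (tr A) := by
  rcases h with h | h | h
  · exact tr_ia r h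
  · exact tr_choice A h
  · exact tr_rec h

/-! ### Recursion on codes -/

/-- Course-of-values recursion in which a parameter may change: a function is computable if its value
at `n` is computed from its values below `n` with another parameter. The recursion theorem provides a
program that calls itself, and totality is proved afterwards. -/
theorem exists_computable_rec (G : ℕ × ℕ → List ℕ → ℕ) (hG : Computable₂ G) (q : ℕ × ℕ → ℕ)
    (hq : Computable q) :
    ∃ F : ℕ → ℕ → ℕ, Computable₂ F ∧
      ∀ p n, F p n = G (p, n) ((List.range n).map (F (q (p, n)))) := by
  -- The evaluation at `n` with parameter `p`, the values below `n` being supplied by the program `c`.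
  let f : Nat.Partrec.Code → ℕ →. ℕ := fun c x =>
    ((Nat.rec (Part.some []) (fun y IH => IH.bind fun l =>
      (c.eval (Nat.pair (q x.unpair) y)).map fun v => l ++ [v]) x.unpair.2 : Part (List ℕ))).map
      (G x.unpair)
  have hf : Partrec₂ f := by
    have hx : Computable fun a : Nat.Partrec.Code × ℕ => a.2.unpair :=
      Computable.unpair.comp Computable.snd
    have hstep : Partrec₂ fun (a : Nat.Partrec.Code × ℕ) (y : ℕ × List ℕ) =>
        (a.1.eval (Nat.pair (q a.2.unpair) y.1)).map fun v => y.2 ++ [v] :=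
      Partrec.map (Nat.Partrec.Code.eval_part.comp (Computable.fst.comp Computable.fst)
        (Primrec₂.natPair.to_comp.comp (hq.comp (hx.comp Computable.fst))
          (Computable.fst.comp Computable.snd)))
        (Computable.list_append.comp (Computable.snd.comp (Computable.snd.comp Computable.fst))
          (Computable.list_cons.comp Computable.snd (Computable.const []))).to₂
    have hrec := Partrec.nat_rec (Computable.snd.comp hx)
      (Computable.const (α := Nat.Partrec.Code × ℕ) ([] : List ℕ)).partrec hstep
    exact Partrec.map hrec (hG.comp (hx.comp Computable.fst) Computable.snd).to₂
  obtain ⟨c, hc⟩ := Nat.Partrec.Code.fixed_point₂ hf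
  have step : ∀ (p n k : ℕ) (φ : ℕ → ℕ), (∀ m < k, c.eval (Nat.pair (q (p, n)) m) = Part.some (φ m)) →
      (Nat.rec (Part.some []) (fun y IH => IH.bind fun l =>
        (c.eval (Nat.pair (q (p, n)) y)).map fun v => l ++ [v]) k : Part (List ℕ)) =
        Part.some ((List.range k).map φ) := by
    intro p n k φ h
    induction k with
    | zero => rfl
    | succ k ih =>
      simp only
      rw [ih fun m hm => h m (by omega), h k (by omega)]
      simp [List.range_succ]
  have eval_eq : ∀ (p n : ℕ) (φ : ℕ → ℕ),
      (∀ m < n, c.eval (Nat.pair (q (p, n)) m) = Part.some (φ m)) →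
      c.eval (Nat.pair p n) = Part.some (G (p, n) ((List.range n).map φ)) := by
    intro p n φ h
    rw [hc]
    simp only [f, Nat.unpair_pair]
    rw [step p n n φ h]
    simp
  have total : ∀ n p, ∃ v, c.eval (Nat.pair p n) = Part.some v := by
    intro n
    induction n using Nat.strong_induction_on with
    | _ n ih =>
      intro p
      choose! φ hφ using fun m (hm : m < n) => ih m hm (q (p, n))
      exact ⟨_, eval_eq p n φ hφ⟩
  choose F hF using fun p n => total n p
  refine ⟨F, ?_, fun p n => ?_⟩
  · have : Partrec fun a : ℕ × ℕ => c.eval (Nat.pair a.1 a.2) :=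
      Nat.Partrec.Code.eval_part.comp (Computable.const c) Primrec₂.natPair.to_comp
    simp only [hF] at this
    exact this
  · have := eval_eq p n (F (q (p, n))) fun m _ => hF _ _
    rw [hF] at this
    exact Part.some_injective this

/-! ### Computability of renamings -/

section
variable {α : Type*} [Primcodable α] {f g h k : α → ℕ} {l : α → List ℕ}

theorem computable_pair (hf : Computable f) (hg : Computable g) :
    Computable fun x => Nat.pair (f x) (g x) :=
  Primrec₂.natPair.to_comp.comp hf hg

theorem computable_left (hf : Computable f) : Computable fun x => (f x).unpair.1 :=
  Computable.fst.comp (Computable.unpair.comp hf)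

theorem computable_right (hf : Computable f) : Computable fun x => (f x).unpair.2 :=
  Computable.snd.comp (Computable.unpair.comp hf)

theorem computable_add (hf : Computable f) (hg : Computable g) : Computable fun x => f x + g x :=
  Primrec.nat_add.to_comp.comp hf hg

theorem computable_sub (hf : Computable f) (hg : Computable g) : Computable fun x => f x - g x :=
  Primrec.nat_sub.to_comp.comp hf hg

theorem computable_if_lt (hf : Computable f) (hg : Computable g) (hh : Computable h)
    (hk : Computable k) : Computable fun x => if f x < g x then h x else k x := by
  have : Computable fun x => decide (f x < g x) := (Primrec.nat_lt.decide.to_comp).comp hf hg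
  refine (Computable.cond this hh hk).of_eq fun x => ?_
  by_cases hx : f x < g x <;> simp [hx]

theorem computable_if_zero (hf : Computable f) (hh : Computable h) (hk : Computable k) :
    Computable fun x => if f x = 0 then h x else k x := by
  refine (computable_if_lt hf (Computable.const 1) hh hk).of_eq fun x => ?_
  simp

theorem computable_getD (hl : Computable l) (hf : Computable f) :
    Computable fun x => (l x).getD (f x) 0 :=
  (Primrec.list_getD 0).to_comp.comp hl hf

theorem computable_cons (hl : Computable l) (hf : Computable f) : Computable fun x => f x :: l x :=
  Computable.list_cons.comp hf hl

end

theorem getD_map_range (F : ℕ → ℕ) {m n : ℕ} (h : m < n) :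
    ((List.range n).map F).getD m 0 = F m := by
  simp [List.getD, h]

/-- The tag of a code. Codes are successors of pairs, and the tag, the first component, tells the
leading symbol. -/
def tag (n : ℕ) : ℕ := (n - 1).unpair.1
/-- The arguments of a code. -/
def arg (n : ℕ) : ℕ := (n - 1).unpair.2
/-- The code with given tag and arguments. -/
def node (t b : ℕ) : ℕ := Nat.pair t b + 1

@[simp] theorem tag_node (t b : ℕ) : tag (node t b) = t := by simp [tag, node]
@[simp] theorem arg_node (t b : ℕ) : arg (node t b) = b := by simp [arg, node]

theorem lt_node {m t b : ℕ} (h : m ≤ b) : m < node t b :=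
  Nat.lt_succ_of_le (h.trans (Nat.right_le_pair _ _))

/-- The renaming that raises the number variables from `c` on by `a` and the function variables from
`d` on by `b`. These suffice for graphs and are closed under passing a binder. -/
def cut (c d a b : ℕ) : Srt → ℕ → ℕ
  | .num, n => if n < c then n else n + a
  | .fn, n => if n < d then n else n + b

theorem liftRen_cut_num (c d a b : ℕ) : liftRen .num (cut c d a b) = cut (c + 1) d a b := by
  funext s n
  cases s
  · cases n with
    | zero => simp [liftRen, cut]
    | succ n => by_cases h : n < c <;> simp [liftRen, cut, h]; omega
  · rfl

theorem liftRen_cut_fn (c d a b : ℕ) : liftRen .fn (cut c d a b) = cut c (d + 1) a b := by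
  funext s n
  cases s
  · rfl
  · cases n with
    | zero => simp [liftRen, cut]
    | succ n => by_cases h : n < d <;> simp [liftRen, cut, h]; omega

/-- A renaming `cut c d a b` as a number. -/
def cutCode (c d a b : ℕ) : ℕ := Nat.pair (Nat.pair c d) (Nat.pair a b)

/-- The renaming with a given code, carried under a binder for a number variable. -/
def incNum (p : ℕ) : ℕ := Nat.pair (Nat.pair (p.unpair.1.unpair.1 + 1) p.unpair.1.unpair.2) p.unpair.2
/-- The renaming with a given code, carried under a binder for a function variable. -/
def incFn (p : ℕ) : ℕ := Nat.pair (Nat.pair p.unpair.1.unpair.1 (p.unpair.1.unpair.2 + 1)) p.unpair.2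

@[simp] theorem incNum_cutCode (c d a b : ℕ) : incNum (cutCode c d a b) = cutCode (c + 1) d a b := by
  simp [incNum, cutCode]
@[simp] theorem incFn_cutCode (c d a b : ℕ) : incFn (cutCode c d a b) = cutCode c (d + 1) a b := by
  simp [incFn, cutCode]

/-- The number to which the renaming with code `p` takes the variable number `m` of the sort with
code `s`. -/
def cutVar (p s m : ℕ) : ℕ :=
  if s = 0 then (if m < p.unpair.1.unpair.1 then m else m + p.unpair.2.unpair.1)
  else (if m < p.unpair.1.unpair.2 then m else m + p.unpair.2.unpair.2)

theorem cutVar_cutCode (c d a b : ℕ) (s : Srt) (m : ℕ) :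
    cutVar (cutCode c d a b) s.code m = cut c d a b s m := by
  cases s <;> simp [cutVar, cutCode, cut, Srt.code]

/-- The recursion step for the renaming of codes of expressions: `x` is the code of the renaming and
that of the expression, and `l` lists the renamed smaller codes. The entries of the list of cases
belong to the tags `0` to `7`. The default value of `getD` is never used on codes, whose components
are smaller. -/
def renStep (x : ℕ × ℕ) (l : List ℕ) : ℕ :=
  [node 0 (Nat.pair (arg x.2).unpair.1 (cutVar x.1 (arg x.2).unpair.1 (arg x.2).unpair.2)),
    x.2, x.2,
    node 3 (Nat.pair (arg x.2).unpair.1 (Nat.pair (l.getD (arg x.2).unpair.2.unpair.1 0)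
      (l.getD (arg x.2).unpair.2.unpair.2 0))),
    node 4 (Nat.pair (arg x.2).unpair.1 (Nat.pair (l.getD (arg x.2).unpair.2.unpair.1 0)
      (l.getD (arg x.2).unpair.2.unpair.2 0))),
    node 5 (Nat.pair (arg x.2).unpair.1 (Nat.pair (l.getD (arg x.2).unpair.2.unpair.1 0)
      (Nat.pair (l.getD (arg x.2).unpair.2.unpair.2.unpair.1 0)
        (l.getD (arg x.2).unpair.2.unpair.2.unpair.2 0)))),
    node 6 (Nat.pair (l.getD (arg x.2).unpair.1 0) (l.getD (arg x.2).unpair.2 0)),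
    node 7 (l.getD (arg x.2) 0)].getD (tag x.2) 0

theorem computable_renStep : Computable₂ renStep := by
  unfold Computable₂ renStep node tag arg cutVar
  have h₁ : Computable fun x : (ℕ × ℕ) × List ℕ => x.1.1 := Computable.fst.comp Computable.fst
  have h₂ : Computable fun x : (ℕ × ℕ) × List ℕ => x.1.2 := Computable.snd.comp Computable.fst
  have h₃ : Computable fun x : (ℕ × ℕ) × List ℕ => x.2 := Computable.snd
  repeat' with_reducible first
    | exact h₁ | exact h₂ | exact h₃ | exact Computable.const _ | refine computable_getD ?_ ?_
    | refine computable_cons ?_ ?_ | refine computable_left ?_ | refine computable_right ?_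
    | refine computable_sub ?_ ?_ | refine computable_pair ?_ ?_ | refine computable_add ?_ ?_
    | refine computable_if_zero ?_ ?_ ?_ | refine computable_if_lt ?_ ?_ ?_ ?_

/-- The parameter for the renaming of the parts of an expression. On codes, `7 - tag` vanishes
only for `λ`. -/
def renParam (x : ℕ × ℕ) : ℕ := if 7 - tag x.2 = 0 then incNum x.1 else x.1

theorem computable_renParam : Computable renParam := by
  unfold renParam tag incNum
  have h₁ : Computable fun x : ℕ × ℕ => x.1 := Computable.fst
  have h₂ : Computable fun x : ℕ × ℕ => x.2 := Computable.snd
  repeat' with_reducible first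
    | exact h₁ | exact h₂ | exact Computable.const _ | refine computable_getD ?_ ?_
    | refine computable_cons ?_ ?_ | refine computable_left ?_ | refine computable_right ?_
    | refine computable_sub ?_ ?_ | refine computable_pair ?_ ?_ | refine computable_add ?_ ?_
    | refine computable_if_zero ?_ ?_ ?_

theorem lt_node_left {m t a b : ℕ} (h : m ≤ a) : m < node t (Nat.pair a b) :=
  lt_node (h.trans (Nat.left_le_pair _ _))

theorem lt_node_right {m t a b : ℕ} (h : m ≤ b) : m < node t (Nat.pair a b) :=
  lt_node (h.trans (Nat.right_le_pair _ _))

section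
variable [Encodable R]

theorem Expr.code_var (s : Srt) (n : ℕ) :
    (Expr.var s n : Expr R s).code = node 0 (Nat.pair s.code n) := rfl
theorem Expr.code_zero : (Expr.zero : Expr R .num).code = node 1 0 := rfl
theorem Expr.code_un (f : UnConst) : (Expr.un f : Expr R .fn).code = node 2 f.code := rfl
theorem Expr.code_bin (f : BinConst) (a b : Expr R .num) :
    (Expr.bin f a b).code = node 3 (Nat.pair f.code (Nat.pair a.code b.code)) := rfl
theorem Expr.code_fnl (f : FnlConst) (a : Expr R .num) (u : Expr R .fn) :
    (Expr.fnl f a u).code = node 4 (Nat.pair f.code (Nat.pair a.code u.code)) := rfl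
theorem Expr.code_rcr (c : R) (t : Expr R .num) (u : Expr R .fn) (s : Expr R .num) :
    (Expr.rcr c t u s).code =
      node 5 (Nat.pair (Encodable.encode c) (Nat.pair t.code (Nat.pair u.code s.code))) := rfl
theorem Expr.code_app (u : Expr R .fn) (t : Expr R .num) :
    (Expr.app u t).code = node 6 (Nat.pair u.code t.code) := rfl
theorem Expr.code_lam (t : Expr R .num) : (Expr.lam t).code = node 7 t.code := rfl
theorem Fml.code_eq (a b : Expr R .num) : (Fml.eq a b).code = node 0 (Nat.pair a.code b.code) := rfl
theorem Fml.code_and (A B : Fml R) : (Fml.and A B).code = node 1 (Nat.pair A.code B.code) := rfl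
theorem Fml.code_or (A B : Fml R) : (Fml.or A B).code = node 2 (Nat.pair A.code B.code) := rfl
theorem Fml.code_imp (A B : Fml R) : (Fml.imp A B).code = node 3 (Nat.pair A.code B.code) := rfl
theorem Fml.code_neg (A : Fml R) : (Fml.neg A).code = node 4 A.code := rfl
theorem Fml.code_all (s : Srt) (A : Fml R) :
    (Fml.all s A).code = node 5 (Nat.pair s.code A.code) := rfl
theorem Fml.code_ex (s : Srt) (A : Fml R) :
    (Fml.ex s A).code = node 6 (Nat.pair s.code A.code) := rfl

end

/-- The renamings `cut c d a b` are computable on codes of expressions. -/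
theorem exists_ren_code : ∃ F : ℕ → ℕ → ℕ, Computable₂ F ∧
    ∀ {R : Type} [Encodable R] {s : Srt} (e : Expr R s) (c d a b : ℕ),
      F (cutCode c d a b) e.code = (e.ren (cut c d a b)).code := by
  obtain ⟨F, hF, hF'⟩ := exists_computable_rec renStep computable_renStep _ computable_renParam
  refine ⟨F, hF, fun {R _ s} e => ?_⟩
  induction e with
  | var s n =>
    intro c d a b
    rw [Expr.code_var, hF']
    simp only [renStep, tag_node, arg_node, Nat.unpair_pair, List.getD_cons_succ,
      List.getD_cons_zero, cutVar_cutCode, Expr.ren, Expr.code_var]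
  | zero =>
    intro c d a b
    rw [Expr.code_zero, hF']
    simp only [renStep, tag_node, arg_node, Nat.unpair_pair, List.getD_cons_succ,
      List.getD_cons_zero, Expr.ren, Expr.code_zero]
  | un f =>
    intro c d a b
    rw [Expr.code_un, hF']
    simp only [renStep, tag_node, arg_node, Nat.unpair_pair, List.getD_cons_succ,
      List.getD_cons_zero, Expr.ren, Expr.code_un]
  | bin f x y ihx ihy =>
    intro c d a b
    rw [Expr.code_bin, hF']
    simp only [renStep, tag_node, arg_node, Nat.unpair_pair, List.getD_cons_succ,
      List.getD_cons_zero, renParam, Nat.reduceSub, OfNat.ofNat_ne_zero, if_false]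
    rw [getD_map_range _ (lt_node_right (Nat.left_le_pair _ _)),
      getD_map_range _ (lt_node_right (Nat.right_le_pair _ _)), ihx, ihy]
    rfl
  | fnl f x y ihx ihy =>
    intro c d a b
    rw [Expr.code_fnl, hF']
    simp only [renStep, tag_node, arg_node, Nat.unpair_pair, List.getD_cons_succ,
      List.getD_cons_zero, renParam, Nat.reduceSub, OfNat.ofNat_ne_zero, if_false]
    rw [getD_map_range _ (lt_node_right (Nat.left_le_pair _ _)),
      getD_map_range _ (lt_node_right (Nat.right_le_pair _ _)), ihx, ihy]
    rfl
  | rcr k x y z ihx ihy ihz =>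
    intro c d a b
    rw [Expr.code_rcr, hF']
    simp only [renStep, tag_node, arg_node, Nat.unpair_pair, List.getD_cons_succ,
      List.getD_cons_zero, renParam, Nat.reduceSub, OfNat.ofNat_ne_zero, if_false]
    rw [getD_map_range _ (lt_node_right (Nat.left_le_pair _ _)),
      getD_map_range _ (lt_node_right ((Nat.left_le_pair _ _).trans (Nat.right_le_pair _ _))),
      getD_map_range _ (lt_node_right ((Nat.right_le_pair _ _).trans (Nat.right_le_pair _ _))),
      ihx, ihy, ihz]
    rfl
  | app x y ihx ihy =>
    intro c d a b
    rw [Expr.code_app, hF']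
    simp only [renStep, tag_node, arg_node, Nat.unpair_pair, List.getD_cons_succ,
      List.getD_cons_zero, renParam, Nat.reduceSub, OfNat.ofNat_ne_zero, one_ne_zero, if_false]
    rw [getD_map_range _ (lt_node_left le_rfl), getD_map_range _ (lt_node_right le_rfl), ihx, ihy]
    rfl
  | lam t ih =>
    intro c d a b
    rw [Expr.code_lam, hF']
    simp only [renStep, tag_node, arg_node, Nat.unpair_pair, List.getD_cons_succ,
      List.getD_cons_zero, renParam, Nat.sub_self, if_true, incNum_cutCode]
    rw [getD_map_range _ (lt_node le_rfl), ih, Expr.ren, Expr.code_lam, liftRen_cut_num]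

/-- The recursion step for the renaming of codes of formulas. -/
def fmlRenStep (F : ℕ → ℕ → ℕ) (x : ℕ × ℕ) (l : List ℕ) : ℕ :=
  [node 0 (Nat.pair (F x.1 (arg x.2).unpair.1) (F x.1 (arg x.2).unpair.2)),
    node 1 (Nat.pair (l.getD (arg x.2).unpair.1 0) (l.getD (arg x.2).unpair.2 0)),
    node 2 (Nat.pair (l.getD (arg x.2).unpair.1 0) (l.getD (arg x.2).unpair.2 0)),
    node 3 (Nat.pair (l.getD (arg x.2).unpair.1 0) (l.getD (arg x.2).unpair.2 0)),
    node 4 (l.getD (arg x.2) 0),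
    node 5 (Nat.pair (arg x.2).unpair.1 (l.getD (arg x.2).unpair.2 0)),
    node 6 (Nat.pair (arg x.2).unpair.1 (l.getD (arg x.2).unpair.2 0))].getD (tag x.2) 0

theorem computable_fmlRenStep {F : ℕ → ℕ → ℕ} (hF : Computable₂ F) :
    Computable₂ (fmlRenStep F) := by
  unfold Computable₂ fmlRenStep node tag arg
  have h₁ : Computable fun x : (ℕ × ℕ) × List ℕ => x.1.1 := Computable.fst.comp Computable.fst
  have h₂ : Computable fun x : (ℕ × ℕ) × List ℕ => x.1.2 := Computable.snd.comp Computable.fst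
  have h₃ : Computable fun x : (ℕ × ℕ) × List ℕ => x.2 := Computable.snd
  repeat' with_reducible first
    | exact h₁ | exact h₂ | exact h₃ | exact Computable.const _ | refine computable_getD ?_ ?_
    | refine computable_cons ?_ ?_ | refine computable_left ?_ | refine computable_right ?_
    | refine computable_sub ?_ ?_ | refine computable_pair ?_ ?_ | refine computable_add ?_ ?_
    | refine hF.comp ?_ ?_

/-- The parameter for the renaming of the parts of a formula. On codes, `5 - tag` vanishes only for
the quantifiers, and the first argument is then the code of the sort. -/
def fmlRenParam (x : ℕ × ℕ) : ℕ :=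
  if 5 - tag x.2 = 0 then (if (arg x.2).unpair.1 = 0 then incNum x.1 else incFn x.1) else x.1

theorem computable_fmlRenParam : Computable fmlRenParam := by
  unfold fmlRenParam tag arg incNum incFn
  have h₁ : Computable fun x : ℕ × ℕ => x.1 := Computable.fst
  have h₂ : Computable fun x : ℕ × ℕ => x.2 := Computable.snd
  repeat' with_reducible first
    | exact h₁ | exact h₂ | exact Computable.const _ | refine computable_left ?_
    | refine computable_right ?_ | refine computable_sub ?_ ?_ | refine computable_pair ?_ ?_
    | refine computable_add ?_ ?_ | refine computable_if_zero ?_ ?_ ?_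

/-- The renamings `cut c d a b` are computable on codes of formulas. -/
theorem exists_fmlRen_code : ∃ F : ℕ → ℕ → ℕ, Computable₂ F ∧
    ∀ {R : Type} [Encodable R] (A : Fml R) (c d a b : ℕ),
      F (cutCode c d a b) A.code = (A.ren (cut c d a b)).code := by
  obtain ⟨F₀, hF₀, hF₀'⟩ := exists_ren_code
  obtain ⟨F, hF, hF'⟩ := exists_computable_rec _ (computable_fmlRenStep hF₀) _ computable_fmlRenParam
  refine ⟨F, hF, fun {R _} A => ?_⟩
  induction A with
  | eq x y =>
    intro c d a b
    rw [Fml.code_eq, hF']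
    simp only [fmlRenStep, tag_node, arg_node, Nat.unpair_pair, List.getD_cons_succ,
      List.getD_cons_zero, hF₀', Fml.ren, Fml.code_eq]
  | and A B ihA ihB | or A B ihA ihB | imp A B ihA ihB =>
    intro c d a b
    first | rw [Fml.code_and, hF'] | rw [Fml.code_or, hF'] | rw [Fml.code_imp, hF']
    simp only [fmlRenStep, tag_node, arg_node, Nat.unpair_pair, List.getD_cons_succ,
      List.getD_cons_zero, fmlRenParam, Nat.reduceSub, OfNat.ofNat_ne_zero, if_false]
    rw [getD_map_range _ (lt_node_left le_rfl), getD_map_range _ (lt_node_right le_rfl), ihA, ihB]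
    rfl
  | neg A ih =>
    intro c d a b
    rw [Fml.code_neg, hF']
    simp only [fmlRenStep, tag_node, arg_node, Nat.unpair_pair, List.getD_cons_succ,
      List.getD_cons_zero, fmlRenParam, Nat.reduceSub, one_ne_zero, if_false]
    rw [getD_map_range _ (lt_node le_rfl), ih]
    rfl
  | all s A ih | ex s A ih =>
    intro c d a b
    first | rw [Fml.code_all, hF'] | rw [Fml.code_ex, hF']
    simp only [fmlRenStep, tag_node, arg_node, Nat.unpair_pair, List.getD_cons_succ,
      List.getD_cons_zero, fmlRenParam, Nat.reduceSub, if_true]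
    rw [getD_map_range _ (lt_node_right le_rfl)]
    cases s
    · simp only [Srt.code, if_true, incNum_cutCode, ih, Fml.ren, Fml.code_all, Fml.code_ex,
        liftRen_cut_num]
    · simp only [Srt.code, one_ne_zero, if_false, incFn_cutCode, ih, Fml.ren, Fml.code_all,
        Fml.code_ex, liftRen_cut_fn]

/-! ### Computability of the translation -/

/-- The recursion step for the recognition of additional constants: the value is `0` if none
occurs. -/
def occursStep (x : ℕ × ℕ) (l : List ℕ) : ℕ :=
  [0, 0, 0,
    l.getD (arg x.2).unpair.2.unpair.1 0 + l.getD (arg x.2).unpair.2.unpair.2 0,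
    l.getD (arg x.2).unpair.2.unpair.1 0 + l.getD (arg x.2).unpair.2.unpair.2 0,
    1,
    l.getD (arg x.2).unpair.1 0 + l.getD (arg x.2).unpair.2 0,
    l.getD (arg x.2) 0].getD (tag x.2) 0

theorem computable_occursStep : Computable₂ occursStep := by
  unfold Computable₂ occursStep tag arg
  have h₂ : Computable fun x : (ℕ × ℕ) × List ℕ => x.1.2 := Computable.snd.comp Computable.fst
  have h₃ : Computable fun x : (ℕ × ℕ) × List ℕ => x.2 := Computable.snd
  repeat' with_reducible first
    | exact h₂ | exact h₃ | exact Computable.const _ | refine computable_getD ?_ ?_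
    | refine computable_cons ?_ ?_ | refine computable_left ?_ | refine computable_right ?_
    | refine computable_sub ?_ ?_ | refine computable_add ?_ ?_

/-- It is decidable on codes whether an additional constant occurs in an expression. -/
theorem exists_occurs_code : ∃ F : ℕ → ℕ, Computable F ∧
    ∀ {R : Type} [Encodable R] {s : Srt} (e : Expr R s), F e.code = 0 ↔ e.strip.isSome := by
  obtain ⟨F, hF, hF'⟩ := exists_computable_rec _ computable_occursStep _ Computable.fst
  refine ⟨F 0, hF.comp (Computable.const 0) Computable.id, fun {R _ s} e => ?_⟩
  induction e with
  | var s n | zero | un f =>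
    first | rw [Expr.code_var, hF'] | rw [Expr.code_zero, hF'] | rw [Expr.code_un, hF']
    simp only [occursStep, tag_node, List.getD_cons_succ, List.getD_cons_zero, Expr.strip,
      Option.isSome_some]
  | bin f x y ihx ihy | fnl f x y ihx ihy =>
    first | rw [Expr.code_bin, hF'] | rw [Expr.code_fnl, hF']
    simp only [occursStep, tag_node, arg_node, Nat.unpair_pair, List.getD_cons_succ,
      List.getD_cons_zero]
    rw [getD_map_range _ (lt_node_right (Nat.left_le_pair _ _)),
      getD_map_range _ (lt_node_right (Nat.right_le_pair _ _)), Nat.add_eq_zero_iff, ihx, ihy,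
      Expr.strip]
    cases x.strip <;> cases y.strip <;> simp
  | rcr k x y z =>
    rw [Expr.code_rcr, hF']
    simp [occursStep, Expr.strip]
  | app x y ihx ihy =>
    rw [Expr.code_app, hF']
    simp only [occursStep, tag_node, arg_node, Nat.unpair_pair, List.getD_cons_succ,
      List.getD_cons_zero]
    rw [getD_map_range _ (lt_node_left le_rfl), getD_map_range _ (lt_node_right le_rfl),
      Nat.add_eq_zero_iff, ihx, ihy, Expr.strip]
    cases x.strip <;> cases y.strip <;> simp
  | lam t ih =>
    rw [Expr.code_lam, hF']
    simp only [occursStep, tag_node, arg_node, List.getD_cons_succ, List.getD_cons_zero]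
    rw [getD_map_range _ (lt_node le_rfl), ih, Expr.strip]
    cases t.strip <;> simp

/-- The code of an equation between function variables or constants with given codes, which are not
affected by the bound number variable. -/
def eqFnCode (u v : ℕ) : ℕ :=
  node 5 (Nat.pair 0 (node 0 (Nat.pair (node 6 (Nat.pair u (node 0 (Nat.pair 0 0))))
    (node 6 (Nat.pair v (node 0 (Nat.pair 0 0)))))))

/-- The code of a formula `bnd s ρ F K`, where `p` is the code of the renaming `liftRen s ρ`. -/
def bndCode (F : ℕ → ℕ → ℕ) (s p A K : ℕ) : ℕ := node 6 (Nat.pair s (node 1 (Nat.pair (F p A) K)))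

/-- The recursion step for the codes of graphs, following the clauses of `Expr.graph`. -/
def graphStep (F : ℕ → ℕ → ℕ) (x : ℕ × ℕ) (l : List ℕ) : ℕ :=
  [if (arg x.2).unpair.1 = 0 then node 0 (Nat.pair (node 0 (Nat.pair 0 0))
      (node 0 (Nat.pair 0 ((arg x.2).unpair.2 + 1))))
    else eqFnCode (node 0 (Nat.pair 1 0)) (node 0 (Nat.pair 1 ((arg x.2).unpair.2 + 1))),
    node 0 (Nat.pair (node 0 (Nat.pair 0 0)) (node 1 0)),
    eqFnCode (node 0 (Nat.pair 1 0)) x.2,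
    bndCode F 0 (cutCode 1 0 1 0) (l.getD (arg x.2).unpair.2.unpair.1 0)
      (bndCode F 0 (cutCode 1 0 2 0) (l.getD (arg x.2).unpair.2.unpair.2 0)
        (node 0 (Nat.pair (node 0 (Nat.pair 0 2)) (node 3 (Nat.pair (arg x.2).unpair.1
          (Nat.pair (node 0 (Nat.pair 0 1)) (node 0 (Nat.pair 0 0)))))))),
    bndCode F 0 (cutCode 1 0 1 0) (l.getD (arg x.2).unpair.2.unpair.1 0)
      (bndCode F 1 (cutCode 0 1 2 0) (l.getD (arg x.2).unpair.2.unpair.2 0)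
        (node 0 (Nat.pair (node 0 (Nat.pair 0 1)) (node 4 (Nat.pair (arg x.2).unpair.1
          (Nat.pair (node 0 (Nat.pair 0 0)) (node 0 (Nat.pair 1 0)))))))),
    bndCode F 0 (cutCode 1 0 1 0) (l.getD (arg x.2).unpair.2.unpair.1 0)
      (bndCode F 1 (cutCode 0 1 2 0) (l.getD (arg x.2).unpair.2.unpair.2.unpair.1 0)
        (bndCode F 0 (cutCode 1 0 2 1) (l.getD (arg x.2).unpair.2.unpair.2.unpair.2 0)
          (recFml (nv 1) (fv 0) (nv 0) (nv 2) : Fml Empty).code)),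
    bndCode F 1 (cutCode 0 1 1 0) (l.getD (arg x.2).unpair.1 0)
      (bndCode F 0 (cutCode 1 0 1 1) (l.getD (arg x.2).unpair.2 0)
        (node 0 (Nat.pair (node 0 (Nat.pair 0 1)) (node 6 (Nat.pair (node 0 (Nat.pair 1 0))
          (node 0 (Nat.pair 0 0))))))),
    node 5 (Nat.pair 0 (bndCode F 0 (cutCode 1 0 0 1) (l.getD (arg x.2) 0)
      (node 0 (Nat.pair (node 0 (Nat.pair 0 0)) (node 6 (Nat.pair (node 0 (Nat.pair 1 0))
        (node 0 (Nat.pair 0 1))))))))].getD (tag x.2) 0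

theorem computable_graphStep {F : ℕ → ℕ → ℕ} (hF : Computable₂ F) : Computable₂ (graphStep F) := by
  unfold Computable₂ graphStep bndCode eqFnCode node tag arg
  have h₂ : Computable fun x : (ℕ × ℕ) × List ℕ => x.1.2 := Computable.snd.comp Computable.fst
  have h₃ : Computable fun x : (ℕ × ℕ) × List ℕ => x.2 := Computable.snd
  repeat' with_reducible first
    | exact h₂ | exact h₃ | exact Computable.const _ | refine computable_getD ?_ ?_
    | refine computable_cons ?_ ?_ | refine computable_left ?_ | refine computable_right ?_
    | refine computable_sub ?_ ?_ | refine computable_pair ?_ ?_ | refine computable_add ?_ ?_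
    | refine computable_if_zero ?_ ?_ ?_ | refine hF.comp ?_ ?_

theorem up_eq_cut (a b : ℕ) : up a b = cut 0 0 a b := by
  funext s n; cases s <;> simp [up, cut]

/-- Graphs are computable on codes. -/
theorem exists_graph_code : ∃ F : ℕ → ℕ, Computable F ∧
    ∀ {R : Type} [Encodable R] {s : Srt} (e : Expr R s), F e.code = (e.graph Empty).code := by
  obtain ⟨F₀, hF₀, hF₀'⟩ := exists_fmlRen_code
  obtain ⟨F, hF, hF'⟩ := exists_computable_rec _ (computable_graphStep hF₀) _ Computable.fst
  have hn : ∀ (a b : ℕ) (A K : Fml Empty), bndCode F₀ 0 (cutCode 1 0 a b) A.code K.code =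
      (bnd .num (up a b) A K).code := by
    intro a b A K
    rw [bndCode, hF₀', bnd, up_eq_cut, liftRen_cut_num]
    rfl
  have hf : ∀ (a b : ℕ) (A K : Fml Empty), bndCode F₀ 1 (cutCode 0 1 a b) A.code K.code =
      (bnd .fn (up a b) A K).code := by
    intro a b A K
    rw [bndCode, hF₀', bnd, up_eq_cut, liftRen_cut_fn]
    rfl
  refine ⟨F 0, hF.comp (Computable.const 0) Computable.id, fun {R _ s} e => ?_⟩
  induction e with
  | var s n =>
    rw [Expr.code_var, hF']
    simp only [graphStep, tag_node, arg_node, Nat.unpair_pair, List.getD_cons_succ,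
      List.getD_cons_zero]
    cases s
    · rfl
    · rfl
  | zero =>
    rw [Expr.code_zero, hF']
    simp only [graphStep, tag_node, List.getD_cons_succ, List.getD_cons_zero]
    rfl
  | un f =>
    rw [Expr.code_un, hF']
    simp only [graphStep, tag_node, List.getD_cons_succ, List.getD_cons_zero]
    rfl
  | bin f x y ihx ihy =>
    rw [Expr.code_bin, hF']
    simp only [graphStep, tag_node, arg_node, Nat.unpair_pair, List.getD_cons_succ,
      List.getD_cons_zero]
    rw [getD_map_range _ (lt_node_right (Nat.left_le_pair _ _)),
      getD_map_range _ (lt_node_right (Nat.right_le_pair _ _)), ihx, ihy, Expr.graph, ← hn, ← hn]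
    rfl
  | fnl f x y ihx ihy =>
    rw [Expr.code_fnl, hF']
    simp only [graphStep, tag_node, arg_node, Nat.unpair_pair, List.getD_cons_succ,
      List.getD_cons_zero]
    rw [getD_map_range _ (lt_node_right (Nat.left_le_pair _ _)),
      getD_map_range _ (lt_node_right (Nat.right_le_pair _ _)), ihx, ihy, Expr.graph, ← hn, ← hf]
    rfl
  | rcr k x y z ihx ihy ihz =>
    rw [Expr.code_rcr, hF']
    simp only [graphStep, tag_node, arg_node, Nat.unpair_pair, List.getD_cons_succ,
      List.getD_cons_zero]
    rw [getD_map_range _ (lt_node_right (Nat.left_le_pair _ _)),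
      getD_map_range _ (lt_node_right ((Nat.left_le_pair _ _).trans (Nat.right_le_pair _ _))),
      getD_map_range _ (lt_node_right ((Nat.right_le_pair _ _).trans (Nat.right_le_pair _ _))),
      ihx, ihy, ihz, Expr.graph, ← hn, ← hf, ← hn]
  | app x y ihx ihy =>
    rw [Expr.code_app, hF']
    simp only [graphStep, tag_node, arg_node, Nat.unpair_pair, List.getD_cons_succ,
      List.getD_cons_zero]
    rw [getD_map_range _ (lt_node_left le_rfl), getD_map_range _ (lt_node_right le_rfl), ihx, ihy,
      Expr.graph, ← hf, ← hn]
    rfl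
  | lam t ih =>
    rw [Expr.code_lam, hF']
    simp only [graphStep, tag_node, arg_node, List.getD_cons_succ, List.getD_cons_zero]
    rw [getD_map_range _ (lt_node le_rfl), ih, Expr.graph, Fml.code_all, ← hn]
    rfl

/-- The recursion step for the translation of codes of formulas. -/
def trStep (H G : ℕ → ℕ) (x : ℕ × ℕ) (l : List ℕ) : ℕ :=
  [if H (arg x.2).unpair.1 + H (arg x.2).unpair.2 = 0 then x.2 else node 6 (Nat.pair 0
      (node 1 (Nat.pair (G (arg x.2).unpair.1) (G (arg x.2).unpair.2)))),
    node 1 (Nat.pair (l.getD (arg x.2).unpair.1 0) (l.getD (arg x.2).unpair.2 0)),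
    node 2 (Nat.pair (l.getD (arg x.2).unpair.1 0) (l.getD (arg x.2).unpair.2 0)),
    node 3 (Nat.pair (l.getD (arg x.2).unpair.1 0) (l.getD (arg x.2).unpair.2 0)),
    node 4 (l.getD (arg x.2) 0),
    node 5 (Nat.pair (arg x.2).unpair.1 (l.getD (arg x.2).unpair.2 0)),
    node 6 (Nat.pair (arg x.2).unpair.1 (l.getD (arg x.2).unpair.2 0))].getD (tag x.2) 0

theorem computable_trStep {H G : ℕ → ℕ} (hH : Computable H) (hG : Computable G) :
    Computable₂ (trStep H G) := by
  unfold Computable₂ trStep node tag arg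
  have h₂ : Computable fun x : (ℕ × ℕ) × List ℕ => x.1.2 := Computable.snd.comp Computable.fst
  have h₃ : Computable fun x : (ℕ × ℕ) × List ℕ => x.2 := Computable.snd
  repeat' with_reducible first
    | exact h₂ | exact h₃ | exact Computable.const _ | refine computable_getD ?_ ?_
    | refine computable_cons ?_ ?_ | refine computable_left ?_ | refine computable_right ?_
    | refine computable_sub ?_ ?_ | refine computable_pair ?_ ?_ | refine computable_add ?_ ?_
    | refine computable_if_zero ?_ ?_ ?_ | refine hH.comp ?_ | refine hG.comp ?_

theorem Expr.code_map [Encodable R₁] [Encodable R₂] (ι : R₁ ↪ R₂)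
    (h : ∀ c, Encodable.encode (ι c) = Encodable.encode c) {s : Srt} (e : Expr R₁ s) :
    (e.map ι).code = e.code := by
  induction e <;> simp_all [Expr.map, Expr.code]

theorem Expr.code_of_strip [Encodable R] {s : Srt} {e : Expr R s} {e' : Expr Empty s}
    (h : e.strip = some e') : e'.code = e.code := by
  rw [← Expr.map_of_strip Function.Embedding.ofIsEmpty h, Expr.code_map _ fun c => c.elim]

theorem effective_tr [Encodable R] : Effective (tr : Fml R → Fml Empty) := by
  obtain ⟨H, hH, hH'⟩ := exists_occurs_code
  obtain ⟨G, hG, hG'⟩ := exists_graph_code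
  obtain ⟨F, hF, hF'⟩ := exists_computable_rec _ (computable_trStep hH hG) _ Computable.fst
  refine ⟨F 0, hF.comp (Computable.const 0) Computable.id, fun E => ?_⟩
  induction E with
  | eq a b =>
    rw [Fml.code_eq, hF']
    simp only [trStep, tag_node, arg_node, Nat.unpair_pair, List.getD_cons_zero, hG',
      Nat.add_eq_zero_iff, hH', tr, trEq]
    cases ha : a.strip with
    | none => simp; rfl
    | some a' =>
      cases hb : b.strip with
      | none => simp; rfl
      | some b' =>
        simp [Fml.code_eq, Expr.code_of_strip ha, Expr.code_of_strip hb]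
  | and A B ihA ihB | or A B ihA ihB | imp A B ihA ihB =>
    first | rw [Fml.code_and, hF'] | rw [Fml.code_or, hF'] | rw [Fml.code_imp, hF']
    simp only [trStep, tag_node, arg_node, Nat.unpair_pair, List.getD_cons_succ,
      List.getD_cons_zero]
    rw [getD_map_range _ (lt_node_left le_rfl), getD_map_range _ (lt_node_right le_rfl), ihA, ihB]
    rfl
  | neg A ih =>
    rw [Fml.code_neg, hF']
    simp only [trStep, tag_node, arg_node, List.getD_cons_succ, List.getD_cons_zero]
    rw [getD_map_range _ (lt_node le_rfl), ih]
    rfl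
  | all s A ih | ex s A ih =>
    first | rw [Fml.code_all, hF'] | rw [Fml.code_ex, hF']
    simp only [trStep, tag_node, arg_node, Nat.unpair_pair, List.getD_cons_succ,
      List.getD_cons_zero]
    rw [getD_map_range _ (lt_node_right le_rfl), ih]
    rfl

theorem isDefinitionalExtension_rec (r : Expr Empty .num) :
    IsDefinitionalExtension incl (IA₁QF r) (IA₁QFRec r) := by
  refine ⟨fun Γ E h => h.map incl (map_mem r), tr, effective_tr, tr_map incl, fun E => ?_,
    fun Γ E h => h.tr (tr_mem r), fun _ _ => rfl, fun _ _ => rfl, fun _ _ => rfl, fun _ => rfl,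
    fun _ _ => rfl, fun _ _ => rfl⟩
  exact .andI (.impI (.assume fun _ _ h => (map_tr_iff incl E).1 h))
    (.impI (.assume fun _ _ h => (map_tr_iff incl E).2 h))

end TwoSortedArith

open TwoSortedArith in
theorem corollary8p6 (r : Expr Empty .num) (hr : r.VarsBelow 2 0) (hccp : r.CcpFree) :
    Prov (IA₁QF r) [] (.ex .fn (recEqs (nv 0) (fv 1) (fv 0))) ∧
    Prov (IA₁QF r) [] (exUniqueFn (recEqs (nv 0) (fv 1) (fv 0))) ∧
    (∀ (t s : Expr Empty .num) (u : Expr Empty .fn) (e : ℕ → ℕ),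
      Prov (IA₁QF r) [] (exUniqueFn (.all .num
        (recFml (t.sub (wSub e)) (u.sub (wSub e)) (s.sub (wSub e)) (.app (fv 0) (nv 0)))))) ∧
    IsDefinitionalExtension incl (IA₁QF r) (IA₁QFRec r) := by
  obtain ⟨h₁, h₂, h₃⟩ := exists_rec_and_unique r
  exact ⟨h₁, h₂, h₃, isDefinitionalExtension_rec r⟩
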